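/- Let $r_0,R_0,H,\Omega>0$ and put $\mathcal D=[0,\tfrac1{2r_0^2})\times[0,H]$, with points $p=(s,z)$, and $\mathbb R^2_+=[0,\infty)^2$, with points $q=(\Upsilon,Z)$; $\langle p,q\rangle=s\Upsilon+zZ$. Let $$e(s)=\frac{r_0^4}{(1-2sr_0^2)^2},\qquad m(s)=\frac{\Omega^2r_0^2}{2(1-2r_0^2s)}\qquad(0\le 2r_0^2s<1).$$ Let $\mathcal H_0$ be the set of Borel functions $\rho:[0,H]\to[0,\tfrac1{2r_0^2})$, and $D_\rho=\{(s,z): z\in[0,H],\ 0\le s\le\rho(z)\}$. Let $\sigma$ be a Borel probability measure on $\mathbb R^2$ whose support $\Delta$ is contained in $[0,R_0]^2$. **Primal problem.** Minimize $$I(\rho,\gamma)=\int_{D_\rho\times\Delta}\Bigl(-\langle p,q\rangle+\frac{\Upsilon}{2r_0^2}-\Omega\sqrt\Upsilon+m(s)\Bigr)\gamma(dp,dq)$$ over all pairs $(\rho,\gamma)$ with $\rho\in\mathcal H_0$, $\int_{D_\rho}e(s)\,ds\,dz=1$ and $\gamma$ a Borel measure on $\mathbb R^2\times\mathbb R^2$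 with marginals $e(s)\chi_{D_\rho}\mathcal L^2$ and $\sigma$. **Dual problem.** Let $\mathcal U$ be the set of pairs $(\Psi,P)\in C(\mathbb R^2_+)\times C(\overline{\mathcal D})$ with $P(p)+\Psi(q)\ge\langle p,q\rangle$ on $\mathcal D\times\mathbb R^2_+$, and $\mathcal U_0\subset\mathcal U$ the set of Legendre pairs, i.e. those with $P(p)=\sup_{q\in\Delta}(\langle p,q\rangle-\Psi(q))$ for $p\in\mathcal D$ and $\Psi(q)=\sup_{p\in\mathcal D}(\langle p,q\rangle-P(p))$ for $q\in\mathbb R^2_+$. Maximize over $\mathcal U$ $$J[\sigma](\Psi,P)=\int\Bigl(\frac{\Upsilon}{2r_0^2}-\Omega\sqrt\Upsilon-\Psi\Bigr)d\sigma+\inf_{\rho\in\mathcal H_0}\int_0^H\int_0^{\rho(z)}\bigl(m(s)-P(s,z)\bigr)e(s)\,ds\,dz .$$ **Theorem.** There are $\bar\Psi,\bar P,\bar\rho,\bar\gamma$ such that: 1. $(\bar\Psi,\bar P)\in\mathcal U_0$ maximizes $J[\sigma]$ over $\mathcal U$, and it is the only such pair in $\mathcal U_0$ (equality of $\Psi$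 on $\mathbb R^2_+$ and of $P$ on $\overline{\mathcal D}$). 2. $(\bar\rho,\bar\gamma)$ minimizes $I$ in the primal problem; if $\sigma(\{Z=0\})=0$, it is the only minimizer ($\rho$ up to equality a.e. on $[0,H]$). 3. $\bar\rho$ is monotone nondecreasing on $[0,H]$, and $\bar\rho\le M$ for some $M<\tfrac1{2r_0^2}$. 4. $(\bar\Psi,\bar P,\bar\rho)$ solves the free-boundary Monge–Ampère system $$e(\partial_\Upsilon\Psi)\det\nabla^2\Psi=\sigma,\qquad \nabla\Psi(\operatorname{spt}\sigma)=D_\rho,\qquad P(\rho(z),z)=m(\rho(z))\ \text{ on }\{\rho>0\}$$ in the dual weak sense: $\nabla\bar P_\#\bigl(e(s)\chi_{D_{\bar\rho}}\mathcal L^2\bigr)=\sigma$ and $\bar P(\bar\rho(z),z)=m(\bar\rho(z))$ whenever $\bar\rho(z)>0$. If $\sigma\ll\mathcal L^2$, it also solves the system in the weak sense: $\nabla\bar\Psi_\#\sigma=e(s)\chi_{D_{\bar\rho}}\mathcal L^2$, with the same boundary condition. 5. If moreover $\operatorname{spt}\sigma\subset[0,R_0]\times[\tfrac1{R_0},R_0]$,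 then $\partial D_{\bar\rho}$ is a finite union of graphs, over one of the coordinate axes, of Lipschitz functions on compact intervals. -/

import Mathlib

open Set MeasureTheory

open scoped NNReal ENNReal

noncomputable section

namespace MongeAmpere

/-- The domain `𝒟 = [0, 1/(2 r₀²)) × [0, H]` of the physical variables `p = (s, z)`. -/
def physDomain (r₀ H : ℝ) : Set (ℝ × ℝ) := Ico 0 (1 / (2 * r₀ ^ 2)) ×ˢ Icc 0 H

/-- The quadrant `ℝ²₊ = [0, ∞)²` of the dual variables `q = (Υ, Z)`. -/
def quadrant : Set (ℝ × ℝ) := Ici 0 ×ˢ Ici 0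

/-- The pairing `⟨p, q⟩ = s Υ + z Z`. -/
def pairing (p q : ℝ × ℝ) : ℝ := p.1 * q.1 + p.2 * q.2

/-- The density `e(s) = r₀⁴ / (1 - 2 s r₀²)²`, used for `0 ≤ 2 r₀² s < 1`. -/
def density (r₀ s : ℝ) : ℝ := r₀ ^ 4 / (1 - 2 * s * r₀ ^ 2) ^ 2

/-- The function `s ↦ Ω² r₀² / (2 (1 - 2 r₀² s))`, used for `0 ≤ 2 r₀² s < 1`. -/
def boundaryValue (r₀ Ω s : ℝ) : ℝ := Ω ^ 2 * r₀ ^ 2 / (2 * (1 - 2 * r₀ ^ 2 * s))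

/-- The class `ℋ₀` of Borel functions `[0, H] → [0, 1/(2 r₀²))`; only the values on `[0, H]`
matter. -/
def heights (r₀ H : ℝ) : Set (ℝ → ℝ) :=
  {ρ | Measurable ((Icc 0 H).domRestrict ρ) ∧ ∀ z ∈ Icc 0 H, ρ z ∈ Ico 0 (1 / (2 * r₀ ^ 2))}

/-- The region `D_ρ = {(s, z) : 0 ≤ s ≤ ρ(z), z ∈ [0, H]}`. -/
def region (H : ℝ) (ρ : ℝ → ℝ) : Set (ℝ × ℝ) :=
  {p | p.2 ∈ Icc 0 H ∧ 0 ≤ p.1 ∧ p.1 ≤ ρ p.2}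

/-- The measure `e(s) χ_{D_ρ}(s, z) ds dz`. -/
def regionMeasure (r₀ H : ℝ) (ρ : ℝ → ℝ) : Measure (ℝ × ℝ) :=
  ((volume : Measure (ℝ × ℝ)).restrict (region H ρ)).withDensity
    fun p => ENNReal.ofReal (density r₀ p.1)

/-- The integral with value `+∞` when the integrand is not integrable. It is applied only to
measurable integrands that are bounded below, with respect to finite measures. -/
def extIntegral {α : Type*} [MeasurableSpace α] (f : α → ℝ) (μ : Measure α) : EReal :=
  open Classical in if Integrable f μ then ((∫ x, f x ∂μ : ℝ) : EReal) else ⊤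

/-! ### Primal problem -/

/-- The set `𝔏_σ` of admissible pairs `(ρ, γ)`: the marginals of `γ` are `e(s) χ_{D_ρ} ℒ²`
and `σ`. -/
def admissible (r₀ H : ℝ) (σ : Measure (ℝ × ℝ)) :
    Set ((ℝ → ℝ) × Measure ((ℝ × ℝ) × (ℝ × ℝ))) :=
  {x | x.1 ∈ heights r₀ H ∧ regionMeasure r₀ H x.1 univ = 1 ∧
    x.2.map Prod.fst = regionMeasure r₀ H x.1 ∧ x.2.map Prod.snd = σ}

/-- The integrand
`-⟨p, q⟩ + Υ / (2 r₀²) - Ω √Υ + r₀² Ω² / (2 (1 - 2 r₀² s))` of the primal functional. -/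
def cost (r₀ Ω : ℝ) (x : (ℝ × ℝ) × (ℝ × ℝ)) : ℝ :=
  -pairing x.1 x.2 + x.2.1 / (2 * r₀ ^ 2) - Ω * √x.2.1 + boundaryValue r₀ Ω x.1.1

/-- The primal functional `I(ρ, γ)`, the integral of the cost over `D_ρ × spt σ`. -/
def primal (r₀ H Ω : ℝ) (σ : Measure (ℝ × ℝ)) (ρ : ℝ → ℝ)
    (γ : Measure ((ℝ × ℝ) × (ℝ × ℝ))) : EReal :=
  extIntegral (cost r₀ Ω) (γ.restrict (region H ρ ×ˢ σ.support))

/-- `(ρ, γ)` minimizes the primal functional over `𝔏_σ`. -/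
def IsPrimalMinimizer (r₀ H Ω : ℝ) (σ : Measure (ℝ × ℝ)) (ρ : ℝ → ℝ)
    (γ : Measure ((ℝ × ℝ) × (ℝ × ℝ))) : Prop :=
  (ρ, γ) ∈ admissible r₀ H σ ∧
    ∀ ρ' γ', (ρ', γ') ∈ admissible r₀ H σ → primal r₀ H Ω σ ρ γ ≤ primal r₀ H Ω σ ρ' γ'

/-! ### Dual problem -/

/-- `Π_P(ϱ, z) = ∫₀^ϱ (Ω² r₀² / (2 (1 - 2 s r₀²)) - P(s, z)) e(s) ds`. -/
def heightPotential (r₀ Ω : ℝ) (P : ℝ × ℝ → ℝ) (ϱ z : ℝ) : ℝ :=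
  ∫ s in (0 : ℝ)..ϱ, (boundaryValue r₀ Ω s - P (s, z)) * density r₀ s

/-- `j(P) = inf_{ρ ∈ ℋ₀} ∫₀^H Π_P(ρ(z), z) dz`. -/
def dualHeight (r₀ H Ω : ℝ) (P : ℝ × ℝ → ℝ) : EReal :=
  ⨅ ρ ∈ heights r₀ H,
    extIntegral (fun z => heightPotential r₀ Ω P (ρ z) z) (volume.restrict (Icc 0 H))

/-- The dual functional `J[σ](Ψ, P)`. -/
def dual (r₀ H Ω : ℝ) (σ : Measure (ℝ × ℝ)) (Ψ P : ℝ × ℝ → ℝ) : EReal :=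
  ((∫ q, (q.1 / (2 * r₀ ^ 2) - Ω * √q.1 - Ψ q) ∂σ : ℝ) : EReal) + dualHeight r₀ H Ω P

/-- The set `𝒰` of pairs `(Ψ, P) ∈ C(ℝ²₊) × C(closure 𝒟)` with `P(p) + Ψ(q) ≥ ⟨p, q⟩`; only
the values of `Ψ` on `ℝ²₊` and of `P` on the closure of `𝒟` matter. -/
def dualPairs (r₀ H : ℝ) : Set ((ℝ × ℝ → ℝ) × (ℝ × ℝ → ℝ)) :=
  {x | ContinuousOn x.1 quadrant ∧ ContinuousOn x.2 (closure (physDomain r₀ H)) ∧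
    ∀ p ∈ physDomain r₀ H, ∀ q ∈ quadrant, pairing p q ≤ x.2 p + x.1 q}

/-- The set `𝒰₀` of pairs in `𝒰` that are Legendre transforms of each other:
`P(p) = sup_{q ∈ Δ} (⟨p, q⟩ - Ψ(q))` on `𝒟` and `Ψ(q) = sup_{p ∈ 𝒟} (⟨p, q⟩ - P(p))` on
`ℝ²₊`. -/
def legendrePairs (r₀ H : ℝ) (Δ : Set (ℝ × ℝ)) : Set ((ℝ × ℝ → ℝ) × (ℝ × ℝ → ℝ)) :=
  {x | x ∈ dualPairs r₀ H ∧
    (∀ p ∈ physDomain r₀ H, IsLUB ((fun q => pairing p q - x.1 q) '' Δ) (x.2 p)) ∧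
    ∀ q ∈ quadrant, IsLUB ((fun p => pairing p q - x.2 p) '' physDomain r₀ H) (x.1 q)}

/-- `(Ψ, P)` is a pair of Legendre transforms (with `Δ = spt σ`) that maximizes `J[σ]` over
`𝒰`. -/
def IsDualMaximizer (r₀ H Ω : ℝ) (σ : Measure (ℝ × ℝ)) (Ψ P : ℝ × ℝ → ℝ) : Prop :=
  (Ψ, P) ∈ legendrePairs r₀ H σ.support ∧
    ∀ Ψ' P', (Ψ', P') ∈ dualPairs r₀ H → dual r₀ H Ω σ Ψ' P' ≤ dual r₀ H Ω σ Ψ P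

/-! ### The Monge-Ampère system and the regularity of the free boundary -/

/-- The gradient of a function of two real variables (zero where it is not differentiable). -/
def grad (f : ℝ × ℝ → ℝ) (x : ℝ × ℝ) : ℝ × ℝ :=
  (fderiv ℝ f x (1, 0), fderiv ℝ f x (0, 1))

/-- The free boundary condition
`P(ρ(z), z) = Ω² r₀² / (2 (1 - 2 r₀² ρ(z)))` on `{ρ > 0}`. -/
def FreeBoundaryCondition (r₀ H Ω : ℝ) (P : ℝ × ℝ → ℝ) (ρ : ℝ → ℝ) : Prop :=
  ∀ z ∈ Icc 0 H, 0 < ρ z → P (ρ z, z) = boundaryValue r₀ Ω (ρ z)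

/-- Weak solutions: `∇Ψ` pushes `σ` forward to `e(s) χ_{D_ρ} ℒ²`, and the free boundary
condition holds. -/
def IsWeakSolution (r₀ H Ω : ℝ) (σ : Measure (ℝ × ℝ)) (Ψ P : ℝ × ℝ → ℝ) (ρ : ℝ → ℝ) : Prop :=
  σ.map (grad Ψ) = regionMeasure r₀ H ρ ∧ FreeBoundaryCondition r₀ H Ω P ρ

/-- Dual weak solutions: `∇P` pushes `e(s) χ_{D_ρ} ℒ²` forward to `σ`, and the free boundary
condition holds. -/
def IsDualWeakSolution (r₀ H Ω : ℝ) (σ : Measure (ℝ × ℝ)) (P : ℝ × ℝ → ℝ) (ρ : ℝ → ℝ) : Prop :=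
  (regionMeasure r₀ H ρ).map (grad P) = σ ∧ FreeBoundaryCondition r₀ H Ω P ρ

/-- A set in the plane is the graph, over one of the two coordinate axes, of a Lipschitz
function on a compact interval. -/
def IsLipschitzGraph (G : Set (ℝ × ℝ)) : Prop :=
  ∃ (a b : ℝ) (f : ℝ → ℝ) (K : ℝ≥0), a ≤ b ∧ LipschitzOnWith K f (Icc a b) ∧
    (G = (fun t => (t, f t)) '' Icc a b ∨ G = (fun t => (f t, t)) '' Icc a b)

/-- A set in the plane is a finite union of graphs of Lipschitz functions. -/
def IsFiniteUnionOfLipschitzGraphs (S : Set (ℝ × ℝ)) : Prop :=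
  ∃ F : Set (Set (ℝ × ℝ)), F.Finite ∧ (∀ G ∈ F, IsLipschitzGraph G) ∧ S = ⋃₀ F

end MongeAmpere

end

noncomputable section

namespace MongeAmpere

open Filter Topology

/-! For fixed `P`, the infimum over heights in the dual functional decouples: at each `z` one
minimizes `ϱ ↦ ∫₀^ϱ (m - P(·,z)) e`. Since `m` blows up at the right end point, minimizers stay
below some `M` inside the interval, and a positive one satisfies `P = m`, which is the free boundary
condition. Subgradients of `P` lie in the quadrant, so `P` increases with `z`; these potentials are
submodular, so the largest minimizer `maxHeight` is nondecreasing in `z`.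

The central object is `IsTransportSolution`: a convex `P` on the whole plane with subgradients in
`Δ`, a monotone selection `ρ` of minimizers, and `∇P` pushing the measure of `D_ρ` to `σ`. Suppose
first that `Z ≥ δ > 0` on `Δ`. Then the minimizer is unique for almost every `z`. A maximizer of the
dual functional exists by coercivity in `P(0)` and Arzelà–Ascoli (`exists_isMaxOn_dualValue`), and
its first variation (`integral_grad_le`) is the push-forward identity. In general, `σ` is translated
upwards by `1/(n+1)`, and a limit is taken using Arzelà–Ascoli, Helly's theorem and
`tendsto_integral_grad` (`exists_isTransportSolution`).

Optimality of the limit comes from duality. For admissible `(ρ, γ)` with finite cost, the primal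
value is the integral of the gap `P + Ψ - ⟨p,q⟩`, plus a source term, plus the energy of `ρ`
(`admissible.primal_eq`). The gap is nonnegative, and it vanishes on the graph of `∇P`, so primal
and dual values agree and both are optimal.

For another dual maximizer, equality in this chain forces the same gradient on `D_ρ`. The boxes
`[0,ρ(z₀)] × [z₀,H]` all contain `(0,H)`, so the two potentials differ there by one constant, which
the free boundary condition makes zero; Legendre duality spreads the equality. If `σ` does not
charge `{Z = 0}`, then `P` is strictly increasing in `z` almost everywhere on the optimal regions,
so two optimal heights can differ at only countably many `z` outside a null set. If `Z ≥ 1/R₀`,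
comparing the growth of `P` in `z` with a Lipschitz bound for `m` shows that the generalized inverse
of `ρ` is Lipschitz. -/

/-- The right end point `1 / (2 r₀²)` of the range of `s`. -/
abbrev sTop (r₀ : ℝ) : ℝ := 1 / (2 * r₀ ^ 2)

/-- The one-dimensional potential `∫₀^ϱ (m(s) - f(s)) e(s) ds`. -/
def profile (r₀ Ω : ℝ) (f : ℝ → ℝ) (ϱ : ℝ) : ℝ :=
  ∫ s in (0 : ℝ)..ϱ, (boundaryValue r₀ Ω s - f s) * density r₀ s

/-- `r` minimizes the one-dimensional potential of `f` over `[0, 1 / (2 r₀²))`. -/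
def IsOptimalHeight (r₀ Ω : ℝ) (f : ℝ → ℝ) (r : ℝ) : Prop :=
  r ∈ Ico 0 (sTop r₀) ∧ ∀ y ∈ Ico 0 (sTop r₀), profile r₀ Ω f r ≤ profile r₀ Ω f y

/-! ### One-dimensional potentials and their minimizers. -/

section OneDim

variable {r₀ Ω : ℝ}

lemma sTop_pos (hr : 0 < r₀) : 0 < sTop r₀ := by
  unfold sTop; positivity

lemma denom_pos (hr : 0 < r₀) {s : ℝ} (hs : s < sTop r₀) : 0 < 1 - 2 * s * r₀ ^ 2 := by
  have h := (lt_div_iff₀ (by positivity : 0 < 2 * r₀ ^ 2)).1 hs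
  nlinarith

lemma density_pos (hr : 0 < r₀) {s : ℝ} (hs : s < sTop r₀) : 0 < density r₀ s := by
  have := denom_pos hr hs
  unfold density; positivity

lemma density_nonneg (r₀ s : ℝ) : 0 ≤ density r₀ s := by
  unfold density; positivity

lemma boundaryValue_eq (r₀ Ω s : ℝ) :
    boundaryValue r₀ Ω s = Ω ^ 2 * r₀ ^ 2 / 2 / (1 - 2 * s * r₀ ^ 2) := by
  unfold boundaryValue; rw [div_div]; ring_nf

lemma boundaryValue_pos (hr : 0 < r₀) (hΩ : 0 < Ω) {s : ℝ} (hs : s < sTop r₀) :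
    0 < boundaryValue r₀ Ω s := by
  have := denom_pos hr hs
  rw [boundaryValue_eq]; positivity

lemma continuousOn_density (hr : 0 < r₀) : ContinuousOn (density r₀) (Iio (sTop r₀)) := by
  unfold density
  refine ContinuousOn.div (by fun_prop) (by fun_prop) fun s hs => ?_
  have := denom_pos hr hs
  positivity

lemma continuousOn_boundaryValue (hr : 0 < r₀) :
    ContinuousOn (boundaryValue r₀ Ω) (Iio (sTop r₀)) := by
  have : boundaryValue r₀ Ω = fun s => Ω ^ 2 * r₀ ^ 2 / 2 / (1 - 2 * s * r₀ ^ 2) :=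
    funext (boundaryValue_eq r₀ Ω)
  rw [this]
  exact ContinuousOn.div (by fun_prop) (by fun_prop) fun s hs => (denom_pos hr hs).ne'

lemma boundaryValue_le_of_le (hr : 0 < r₀) {s t : ℝ} (hst : s ≤ t) (ht : t < sTop r₀) :
    boundaryValue r₀ Ω s ≤ boundaryValue r₀ Ω t := by
  have h1 := denom_pos hr ht
  rw [boundaryValue_eq, boundaryValue_eq]
  apply div_le_div_of_nonneg_left (by positivity) h1
  nlinarith [sq_nonneg r₀]

lemma exists_forall_lt_boundaryValue (hr : 0 < r₀) (hΩ : 0 < Ω) (C : ℝ) :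
    ∃ M, 0 < M ∧ M < sTop r₀ ∧ ∀ s, M ≤ s → s < sTop r₀ → C < boundaryValue r₀ Ω s := by
  have hA : 0 < Ω ^ 2 * r₀ ^ 2 / 2 := by positivity
  set A := Ω ^ 2 * r₀ ^ 2 / 2 with hAdef
  -- `M` is chosen so that `1 - 2 M r₀² = κ`, whence `m(M) = A / κ = |C| + 1 + A > C`. The summand
  -- `A` ensures `κ < 1`, that is `M > 0`.
  set κ := A / (|C| + 1 + A) with hκ
  have hC := abs_nonneg C
  have hκ0 : 0 < κ := by positivity
  have hκ1 : κ < 1 := by rw [hκ, div_lt_one (by positivity)]; linarith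
  have h2 : (0 : ℝ) < 2 * r₀ ^ 2 := by positivity
  have hM : (1 - κ) / (2 * r₀ ^ 2) < sTop r₀ :=
    div_lt_div_of_pos_right (by linarith) h2
  refine ⟨(1 - κ) / (2 * r₀ ^ 2), div_pos (by linarith) h2, hM, fun s hs hs' => ?_⟩
  refine lt_of_lt_of_le ?_ (boundaryValue_le_of_le hr hs hs')
  rw [boundaryValue_eq]
  have : 1 - 2 * ((1 - κ) / (2 * r₀ ^ 2)) * r₀ ^ 2 = κ := by field_simp; ring
  have h3 : A / κ = |C| + 1 + A := by rw [hκ]; field_simp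
  rw [this, ← hAdef, h3]
  linarith [le_abs_self C]

lemma exists_boundaryValue_lipschitz (hr : 0 < r₀) {M : ℝ} (hM : M < sTop r₀) :
    ∃ K, 0 ≤ K ∧ ∀ s t, 0 ≤ s → s ≤ t → t ≤ M →
      boundaryValue r₀ Ω t - boundaryValue r₀ Ω s ≤ K * (t - s) := by
  have hd := denom_pos hr hM
  refine ⟨Ω ^ 2 * r₀ ^ 2 / 2 * (2 * r₀ ^ 2) / (1 - 2 * M * r₀ ^ 2) ^ 2, by positivity,
    fun s t _ hst ht => ?_⟩
  have hdt : 1 - 2 * M * r₀ ^ 2 ≤ 1 - 2 * t * r₀ ^ 2 := by nlinarith [sq_nonneg r₀]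
  have hds : 1 - 2 * M * r₀ ^ 2 ≤ 1 - 2 * s * r₀ ^ 2 := by nlinarith [sq_nonneg r₀]
  have h1 : 0 < 1 - 2 * t * r₀ ^ 2 := hd.trans_le hdt
  have h2 : 0 < 1 - 2 * s * r₀ ^ 2 := hd.trans_le hds
  have key : boundaryValue r₀ Ω t - boundaryValue r₀ Ω s =
      Ω ^ 2 * r₀ ^ 2 / 2 * (2 * r₀ ^ 2) / ((1 - 2 * t * r₀ ^ 2) * (1 - 2 * s * r₀ ^ 2)) *
        (t - s) := by
    have h3 := h1.ne'
    have h4 := h2.ne'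
    rw [boundaryValue_eq, boundaryValue_eq, div_sub_div _ _ h3 h4, div_mul_eq_mul_div]
    ring
  rw [key]
  refine mul_le_mul_of_nonneg_right (div_le_div_of_nonneg_left (by positivity) (by positivity) ?_)
    (by linarith)
  rw [sq]; exact mul_le_mul hdt hds hd.le h1.le

lemma continuousOn_integrand (hr : 0 < r₀) {f : ℝ → ℝ} (hf : ContinuousOn f (Icc 0 (sTop r₀))) :
    ContinuousOn (fun s => (boundaryValue r₀ Ω s - f s) * density r₀ s) (Ico 0 (sTop r₀)) :=
  (((continuousOn_boundaryValue hr).mono fun _ h => h.2).sub (hf.mono Ico_subset_Icc_self)).mul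
    ((continuousOn_density hr).mono fun _ h => h.2)

lemma uIcc_subset_Ico {x y : ℝ} (hx : x ∈ Ico 0 (sTop r₀)) (hy : y ∈ Ico 0 (sTop r₀)) :
    uIcc x y ⊆ Ico 0 (sTop r₀) := ordConnected_Ico.uIcc_subset hx hy

lemma intervalIntegrable_integrand (hr : 0 < r₀) {f : ℝ → ℝ}
    (hf : ContinuousOn f (Icc 0 (sTop r₀))) {x y : ℝ} (hx : x ∈ Ico 0 (sTop r₀))
    (hy : y ∈ Ico 0 (sTop r₀)) :
    IntervalIntegrable (fun s => (boundaryValue r₀ Ω s - f s) * density r₀ s) volume x y :=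
  ((continuousOn_integrand hr hf).mono (uIcc_subset_Ico hx hy)).intervalIntegrable

lemma zero_mem_Ico (hr : 0 < r₀) : (0 : ℝ) ∈ Ico 0 (sTop r₀) := ⟨le_rfl, sTop_pos hr⟩

lemma profile_sub (hr : 0 < r₀) {f : ℝ → ℝ} (hf : ContinuousOn f (Icc 0 (sTop r₀))) {x y : ℝ}
    (hx : x ∈ Ico 0 (sTop r₀)) (hy : y ∈ Ico 0 (sTop r₀)) :
    profile r₀ Ω f y - profile r₀ Ω f x =
      ∫ s in x..y, (boundaryValue r₀ Ω s - f s) * density r₀ s :=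
  intervalIntegral.integral_interval_sub_left
    (intervalIntegrable_integrand hr hf (zero_mem_Ico hr) hy)
    (intervalIntegrable_integrand hr hf (zero_mem_Ico hr) hx)

lemma hasDerivAt_profile (hr : 0 < r₀) {f : ℝ → ℝ} (hf : ContinuousOn f (Icc 0 (sTop r₀)))
    {x : ℝ} (h0 : 0 < x) (hx : x < sTop r₀) :
    HasDerivAt (profile r₀ Ω f) ((boundaryValue r₀ Ω x - f x) * density r₀ x) x := by
  have hc := continuousOn_integrand (Ω := Ω) hr hf
  have hn : Ioo 0 (sTop r₀) ∈ 𝓝 x := Ioo_mem_nhds h0 hx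
  exact intervalIntegral.integral_hasDerivAt_right
    (intervalIntegrable_integrand hr hf (zero_mem_Ico hr) ⟨h0.le, hx⟩)
    ((hc.mono Ioo_subset_Ico_self).stronglyMeasurableAtFilter isOpen_Ioo x ⟨h0, hx⟩)
    (hc.continuousAt (mem_of_superset hn Ioo_subset_Ico_self))

/-- First-order condition at an interior minimum: the derivative is `(m - f) e` with `e > 0`. This
is the source of the free boundary condition. -/
lemma IsOptimalHeight.eq_boundaryValue (hr : 0 < r₀) {f : ℝ → ℝ}
    (hf : ContinuousOn f (Icc 0 (sTop r₀))) {r : ℝ} (h : IsOptimalHeight r₀ Ω f r)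
    (hpos : 0 < r) : f r = boundaryValue r₀ Ω r := by
  have hmin : IsLocalMin (profile r₀ Ω f) r :=
    mem_of_superset (Ioo_mem_nhds hpos h.1.2) fun y hy => h.2 y ⟨hy.1.le, hy.2⟩
  have h0 := hmin.hasDerivAt_eq_zero (hasDerivAt_profile hr hf hpos h.1.2)
  rcases mul_eq_zero.1 h0 with h0 | h0
  · linarith
  · exact absurd h0 (density_pos hr h.1.2).ne'

/-- A minimizer `r > M` would satisfy `f r = m(r) > C`. The bound depends on `f` only through `C`,
so it is uniform over families of potentials. -/
lemma IsOptimalHeight.le_of_lt_boundaryValue (hr : 0 < r₀) {f : ℝ → ℝ}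
    (hf : ContinuousOn f (Icc 0 (sTop r₀))) {C M : ℝ} (hfC : ∀ s ∈ Icc 0 (sTop r₀), f s ≤ C)
    (hM : 0 < M) (hM' : ∀ s, M ≤ s → s < sTop r₀ → C < boundaryValue r₀ Ω s) {r : ℝ}
    (h : IsOptimalHeight r₀ Ω f r) : r ≤ M := by
  by_contra! hlt
  have := h.eq_boundaryValue hr hf (hM.trans hlt)
  linarith [hfC r ⟨h.1.1, h.1.2.le⟩, hM' r hlt.le h.1.2]

lemma continuousOn_profile (hr : 0 < r₀) {f : ℝ → ℝ} (hf : ContinuousOn f (Icc 0 (sTop r₀)))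
    {M : ℝ} (hM0 : 0 ≤ M) (hM : M < sTop r₀) : ContinuousOn (profile r₀ Ω f) (Icc 0 M) := by
  have := intervalIntegral.continuousOn_primitive_interval
    (μ := volume) (f := fun s => (boundaryValue r₀ Ω s - f s) * density r₀ s) (a := 0) (b := M) ?_
  · rwa [uIcc_of_le hM0] at this
  · rw [uIcc_of_le hM0]
    exact ((continuousOn_integrand hr hf).mono
      fun s hs => ⟨hs.1, hs.2.trans_lt hM⟩).integrableOn_compact isCompact_Icc

lemma profile_le_of_le (hr : 0 < r₀) {f : ℝ → ℝ} (hf : ContinuousOn f (Icc 0 (sTop r₀))) {M : ℝ}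
    (hM0 : 0 ≤ M) (hM' : ∀ s, M ≤ s → s < sTop r₀ → f s ≤ boundaryValue r₀ Ω s) {y : ℝ}
    (hMy : M ≤ y) (hy : y < sTop r₀) : profile r₀ Ω f M ≤ profile r₀ Ω f y := by
  rw [← sub_nonneg, profile_sub hr hf ⟨hM0, hMy.trans_lt hy⟩ ⟨hM0.trans hMy, hy⟩]
  refine intervalIntegral.integral_nonneg hMy fun s hs => ?_
  exact mul_nonneg (sub_nonneg.2 (hM' s hs.1 (hs.2.trans_lt hy))) (density_nonneg _ _)

/-- Beyond `M` the potential increases, so minimizing over the compact interval `[0, M]` suffices,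
and the minimizers form a compact set. -/
lemma exists_isGreatest_optimalHeight (hr : 0 < r₀) (hΩ : 0 < Ω) {f : ℝ → ℝ}
    (hf : ContinuousOn f (Icc 0 (sTop r₀))) :
    ∃ r, IsGreatest {r | IsOptimalHeight r₀ Ω f r} r := by
  obtain ⟨C, hC⟩ := isCompact_Icc.bddAbove_image hf
  have hfC : ∀ s ∈ Icc 0 (sTop r₀), f s ≤ C := fun s hs => hC ⟨s, hs, rfl⟩
  obtain ⟨M, hM0, hM, hM'⟩ := exists_forall_lt_boundaryValue hr hΩ C
  have hcont := continuousOn_profile (Ω := Ω) hr hf hM0.le hM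
  obtain ⟨x, hx, hxmin⟩ := isCompact_Icc.exists_isMinOn ⟨0, left_mem_Icc.2 hM0.le⟩ hcont
  have hopt : ∀ r ∈ Icc 0 M, profile r₀ Ω f r ≤ profile r₀ Ω f x → IsOptimalHeight r₀ Ω f r := by
    refine fun r hr' hle => ⟨⟨hr'.1, hr'.2.trans_lt hM⟩, fun y hy => ?_⟩
    rcases le_total y M with h | h
    · exact hle.trans (hxmin ⟨hy.1, h⟩)
    · refine hle.trans ((hxmin (right_mem_Icc.2 hM0.le)).trans
        (profile_le_of_le hr hf hM0.le (fun s hs hs' => ?_) h hy.2))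
      exact (hfC s ⟨hM0.le.trans hs, hs'.le⟩).trans (hM' s hs hs').le
  have hset : {r | IsOptimalHeight r₀ Ω f r} =
      Icc 0 M ∩ profile r₀ Ω f ⁻¹' Iic (profile r₀ Ω f x) := by
    ext r
    refine ⟨fun h => ⟨⟨h.1.1, h.le_of_lt_boundaryValue hr hf hfC hM0 hM'⟩, ?_⟩,
      fun h => hopt r h.1 h.2⟩
    exact h.2 x ⟨hx.1, hx.2.trans_lt hM⟩
  rw [hset]
  exact (isCompact_Icc.of_isClosed_subset (hcont.preimage_isClosed_of_isClosed isClosed_Icc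
    isClosed_Iic) inter_subset_left).exists_isGreatest
      ⟨x, hx, le_refl (profile r₀ Ω f x)⟩

/-- Submodularity of the potentials: increasing `f` moves minimizers to the right. -/
lemma profile_sub_sub (hr : 0 < r₀) {f g : ℝ → ℝ} (hf : ContinuousOn f (Icc 0 (sTop r₀)))
    (hg : ContinuousOn g (Icc 0 (sTop r₀))) {x y : ℝ}
    (hx : x ∈ Ico 0 (sTop r₀)) (hy : y ∈ Ico 0 (sTop r₀)) :
    (profile r₀ Ω f y - profile r₀ Ω f x) - (profile r₀ Ω g y - profile r₀ Ω g x) =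
      ∫ s in x..y, (g s - f s) * density r₀ s := by
  rw [profile_sub hr hf hx hy, profile_sub hr hg hx hy, ← intervalIntegral.integral_sub
    (intervalIntegrable_integrand hr hf hx hy) (intervalIntegrable_integrand hr hg hx hy)]
  congr 1; ext s; ring

lemma intervalIntegrable_sub_mul_density (hr : 0 < r₀) {f g : ℝ → ℝ}
    (hf : ContinuousOn f (Icc 0 (sTop r₀)))
    (hg : ContinuousOn g (Icc 0 (sTop r₀))) {x y : ℝ}
    (hx : x ∈ Ico 0 (sTop r₀)) (hy : y ∈ Ico 0 (sTop r₀)) :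
    IntervalIntegrable (fun s => (g s - f s) * density r₀ s) volume x y :=
  ((((hg.sub hf).mono Ico_subset_Icc_self).mul
    ((continuousOn_density hr).mono fun _ h => h.2)).mono
      (uIcc_subset_Ico hx hy)).intervalIntegrable

/-- When `y ≤ x`, going from `y` to `x` costs no more for `g` than for `f`, and for `f` it costs
nothing. This makes the greatest minimizer monotone in the potential. -/
lemma IsOptimalHeight.isOptimalHeight_max (hr : 0 < r₀) {f g : ℝ → ℝ}
    (hf : ContinuousOn f (Icc 0 (sTop r₀))) (hg : ContinuousOn g (Icc 0 (sTop r₀)))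
    (hfg : ∀ s ∈ Icc 0 (sTop r₀), f s ≤ g s) {x y : ℝ} (hx : IsOptimalHeight r₀ Ω f x)
    (hy : IsOptimalHeight r₀ Ω g y) : IsOptimalHeight r₀ Ω g (max x y) := by
  rcases le_total x y with h | h
  · rwa [max_eq_right h]
  · rw [max_eq_left h]
    refine ⟨hx.1, fun w hw => le_trans ?_ (hy.2 w hw)⟩
    have h1 := profile_sub_sub (Ω := Ω) hr hf hg hy.1 hx.1
    have h2 : 0 ≤ ∫ s in y..x, (g s - f s) * density r₀ s :=
      intervalIntegral.integral_nonneg h fun s hs => mul_nonneg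
        (sub_nonneg.2 (hfg s ⟨hy.1.1.trans hs.1, hs.2.trans hx.1.2.le⟩)) (density_nonneg _ _)
    linarith [hx.2 y hy.1]

/-- If `y < x`, the two optimality inequalities contradict the positivity of `∫_y^x (g - f) e`.
Strictness is needed only almost everywhere below `x`, which is all that is available when gradients
are controlled only on `D_ρ`. -/
lemma IsOptimalHeight.le_of_ae_lt (hr : 0 < r₀) {f g : ℝ → ℝ}
    (hf : ContinuousOn f (Icc 0 (sTop r₀))) (hg : ContinuousOn g (Icc 0 (sTop r₀)))
    {x y : ℝ} (hx : IsOptimalHeight r₀ Ω f x)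
    (hfg : ∀ᵐ s, s ∈ Ioo 0 x → f s < g s)
    (hy : IsOptimalHeight r₀ Ω g y) : x ≤ y := by
  by_contra! h
  have h1 := profile_sub_sub (Ω := Ω) hr hf hg hy.1 hx.1
  have h2 : 0 < ∫ s in y..x, (g s - f s) * density r₀ s := by
    have key : ∀ᵐ s ∂volume.restrict (Ioc y x), 0 < (g s - f s) * density r₀ s := by
      rw [ae_restrict_iff' measurableSet_Ioc]
      filter_upwards [hfg, (measure_eq_zero_iff_ae_notMem.1 (measure_singleton (μ := volume) x))]
        with s hs hsx hsm
      have hlt : s < x := lt_of_le_of_ne hsm.2 hsx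
      exact mul_pos (sub_pos.2 (hs ⟨hy.1.1.trans_lt hsm.1, hlt⟩))
        (density_pos hr (hsm.2.trans_lt hx.1.2))
    rw [intervalIntegral.integral_pos_iff_support_of_nonneg_ae'
      (by rw [uIoc_of_le h.le]; exact key.mono fun s hs => hs.le)
      (intervalIntegrable_sub_mul_density hr hf hg hy.1 hx.1)]
    refine ⟨h, ?_⟩
    have : (volume.restrict (Ioc y x)) (Function.support fun s => (g s - f s) * density r₀ s) =
        (volume.restrict (Ioc y x)) univ :=
      measure_congr (eventuallyEq_set.2 (key.mono fun s hs => iff_of_true hs.ne' trivial))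
    rw [← Measure.restrict_apply' measurableSet_Ioc, this]
    simp [h]
  linarith [hx.2 y hy.1, hy.2 x hx.1]

/-- Minimizers pass to the limit. -/
lemma isOptimalHeight_of_tendsto (hr : 0 < r₀) {f : ℝ → ℝ} {F : ℕ → ℝ → ℝ} {C M : ℝ}
    (hF : ∀ n, ContinuousOn (F n) (Icc 0 (sTop r₀)))
    (hC : ∀ n, ∀ s ∈ Icc 0 (sTop r₀), |F n s| ≤ C) (hM : M < sTop r₀)
    (hlim : ∀ s ∈ Icc 0 (sTop r₀), Tendsto (fun n => F n s) atTop (𝓝 (f s)))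
    {r : ℝ} {ρ : ℕ → ℝ} (hρ : ∀ n, IsOptimalHeight r₀ Ω (F n) (ρ n)) (hρM : ∀ n, ρ n ≤ M)
    (hρlim : Tendsto ρ atTop (𝓝 r)) : IsOptimalHeight r₀ Ω f r := by
  have hr0 : 0 ≤ r := ge_of_tendsto' hρlim fun n => (hρ n).1.1
  have hrM : r ≤ M := le_of_tendsto' hρlim hρM
  have hrI : r ∈ Ico 0 (sTop r₀) := ⟨hr0, hrM.trans_lt hM⟩
  have hM0 : 0 ≤ M := hr0.trans hrM
  have hlt : ∀ N, N < sTop r₀ → 0 ≤ N → ∃ B, ∀ n, ∀ s ∈ Icc 0 N,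
      ‖(boundaryValue r₀ Ω s - F n s) * density r₀ s‖ ≤ B := by
    intro N hN hN0
    have hsub : Icc 0 N ⊆ Iio (sTop r₀) := fun s hs => hs.2.trans_lt hN
    obtain ⟨B1, hB1⟩ := isCompact_Icc.exists_bound_of_continuousOn
      ((continuousOn_boundaryValue (Ω := Ω) hr).mono hsub)
    obtain ⟨B2, hB2⟩ := isCompact_Icc.exists_bound_of_continuousOn
      ((continuousOn_density hr).mono hsub)
    refine ⟨(B1 + C) * B2, fun n s hs => ?_⟩
    rw [norm_mul]
    have h1 : ‖boundaryValue r₀ Ω s - F n s‖ ≤ B1 + C :=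
      (norm_sub_le _ _).trans (add_le_add (hB1 s hs) (hC n s ⟨hs.1, hs.2.trans hN.le⟩))
    exact mul_le_mul h1 (hB2 s hs) (norm_nonneg _) ((norm_nonneg _).trans h1)
  have hconv : ∀ y ∈ Ico 0 (sTop r₀),
      Tendsto (fun n => profile r₀ Ω (F n) y) atTop (𝓝 (profile r₀ Ω f y)) := by
    intro y hy
    obtain ⟨B, hB⟩ := hlt y hy.2 hy.1
    refine intervalIntegral.tendsto_integral_filter_of_dominated_convergence (fun _ => B) ?_ ?_ ?_ ?_
    · refine Eventually.of_forall fun n => ?_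
      exact (intervalIntegrable_iff.1
        (intervalIntegrable_integrand hr (hF n) (zero_mem_Ico hr) hy)).aestronglyMeasurable
    · refine Eventually.of_forall fun n => Eventually.of_forall fun s hs => ?_
      rw [uIoc_of_le hy.1] at hs
      exact hB n s ⟨hs.1.le, hs.2⟩
    · exact intervalIntegrable_const
    · refine Eventually.of_forall fun s hs => ?_
      rw [uIoc_of_le hy.1] at hs
      exact (tendsto_const_nhds.sub (hlim s ⟨hs.1.le, hs.2.trans hy.2.le⟩)).mul tendsto_const_nhds
  obtain ⟨B, hB⟩ := hlt M hM hM0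
  -- On `[0, M]` the integrands are bounded by one `B`, so moving the end point from `r` to `ρ n`
  -- changes the potential by at most `B |ρ n - r|`.
  have hdiff : Tendsto (fun n => profile r₀ Ω (F n) (ρ n) - profile r₀ Ω (F n) r) atTop (𝓝 0) := by
    refine squeeze_zero_norm (a := fun n => B * |ρ n - r|) (fun n => ?_) ?_
    · rw [profile_sub hr (hF n) hrI (hρ n).1]
      refine intervalIntegral.norm_integral_le_of_norm_le_const fun s hs => hB n s ?_
      have := uIoc_subset_uIcc hs
      exact ordConnected_Icc.uIcc_subset (⟨hr0, hrM⟩ : r ∈ Icc 0 M) ⟨(hρ n).1.1, hρM n⟩ this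
    · have : Tendsto (fun n => B * |ρ n - r|) atTop (𝓝 (B * |r - r|)) :=
        ((hρlim.sub_const r).abs).const_mul B
      simpa using this
  refine ⟨hrI, fun y hy => ?_⟩
  have h1 : Tendsto (fun n => profile r₀ Ω (F n) (ρ n)) atTop (𝓝 (profile r₀ Ω f r)) := by
    simpa using hdiff.add (hconv r hrI)
  exact le_of_tendsto_of_tendsto' h1 (hconv y hy) fun n => (hρ n).2 y hy

end OneDim

/-! ### Convex functions with subgradients in a prescribed set. -/

/-- Every point has a subgradient of `P` in `Δ`. -/
def HasSubgradientsIn (Δ : Set (ℝ × ℝ)) (P : ℝ × ℝ → ℝ) : Prop :=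
  ∀ p, ∃ q ∈ Δ, ∀ p', P p + (pairing p' q - pairing p q) ≤ P p'

/-- The conjugate `p ↦ sup_{q ∈ Δ} (⟨p, q⟩ - ψ(q))`. -/
def conjugate (Δ : Set (ℝ × ℝ)) (ψ : ℝ × ℝ → ℝ) (p : ℝ × ℝ) : ℝ :=
  sSup ((fun q => pairing p q - ψ q) '' Δ)

lemma pairing_comm (p q : ℝ × ℝ) : pairing p q = pairing q p := by
  unfold pairing; ring

@[fun_prop]
lemma continuous_pairing : Continuous fun x : (ℝ × ℝ) × (ℝ × ℝ) => pairing x.1 x.2 := by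
  unfold pairing; fun_prop

@[fun_prop]
lemma continuous_pairing_left (q : ℝ × ℝ) : Continuous fun p => pairing p q := by
  unfold pairing; fun_prop

@[fun_prop]
lemma continuous_pairing_right (p : ℝ × ℝ) : Continuous fun q => pairing p q := by
  unfold pairing; fun_prop

lemma abs_pairing_sub_le {R : ℝ} {q : ℝ × ℝ} (h1 : |q.1| ≤ R) (h2 : |q.2| ≤ R) (p' p : ℝ × ℝ) :
    |pairing p' q - pairing p q| ≤ 2 * R * dist p' p := by
  have e : pairing p' q - pairing p q = (p'.1 - p.1) * q.1 + (p'.2 - p.2) * q.2 := by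
    unfold pairing; ring
  have d1 : |p'.1 - p.1| ≤ dist p' p := by
    rw [← Real.dist_eq, Prod.dist_eq]; exact le_max_left _ _
  have d2 : |p'.2 - p.2| ≤ dist p' p := by
    rw [← Real.dist_eq, Prod.dist_eq]; exact le_max_right _ _
  have hd : 0 ≤ dist p' p := dist_nonneg
  rw [e]
  calc _ ≤ |p'.1 - p.1| * |q.1| + |p'.2 - p.2| * |q.2| := by
        rw [← abs_mul, ← abs_mul]; exact abs_add_le _ _
    _ ≤ dist p' p * R + dist p' p * R := by gcongr
    _ = _ := by ring

lemma abs_le_of_mem_box {R x : ℝ} (h : x ∈ Icc 0 R) : |x| ≤ R := by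
  rw [abs_of_nonneg h.1]; exact h.2

lemma HasSubgradientsIn.mono {Δ Δ' : Set (ℝ × ℝ)} {P : ℝ × ℝ → ℝ} (h : HasSubgradientsIn Δ P)
    (hΔ : Δ ⊆ Δ') : HasSubgradientsIn Δ' P := fun p =>
  let ⟨q, hq, hq'⟩ := h p
  ⟨q, hΔ hq, hq'⟩

lemma lipschitzWith_conjugate_aux {R : ℝ} (hR : 0 ≤ R) {f : ℝ × ℝ → ℝ}
    (h : ∀ x y, f x ≤ f y + 2 * R * dist x y) : LipschitzWith (2 * R).toNNReal f := by
  refine LipschitzWith.of_le_add_mul _ fun x y => ?_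
  rw [Real.coe_toNNReal _ (by positivity)]
  exact h x y

lemma HasSubgradientsIn.lipschitzWith {R : ℝ} (hR : 0 ≤ R) {P : ℝ × ℝ → ℝ}
    (h : HasSubgradientsIn (Icc 0 R ×ˢ Icc 0 R) P) : LipschitzWith (2 * R).toNNReal P := by
  refine lipschitzWith_conjugate_aux hR fun x y => ?_
  obtain ⟨q, hq, hq'⟩ := h x
  have h1 := hq' y
  have h2 := abs_pairing_sub_le (abs_le_of_mem_box hq.1) (abs_le_of_mem_box hq.2) x y
  linarith [le_abs_self (pairing x q - pairing y q)]

lemma HasSubgradientsIn.mono_of_le {R : ℝ} {P : ℝ × ℝ → ℝ}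
    (h : HasSubgradientsIn (Icc 0 R ×ˢ Icc 0 R) P) {p p' : ℝ × ℝ} (h1 : p.1 ≤ p'.1)
    (h2 : p.2 ≤ p'.2) : P p ≤ P p' := by
  obtain ⟨q, hq, hq'⟩ := h p
  have := hq' p'
  have e : pairing p' q - pairing p q = (p'.1 - p.1) * q.1 + (p'.2 - p.2) * q.2 := by
    unfold pairing; ring
  have h3 := mul_nonneg (sub_nonneg.2 h1) hq.1.1
  have h4 := mul_nonneg (sub_nonneg.2 h2) hq.2.1
  linarith

/-- This quantitative growth in `z` gives both the almost everywhere uniqueness of the heights and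
the Lipschitz bound on the free boundary. -/
lemma HasSubgradientsIn.add_le {δ : ℝ} {Δ : Set (ℝ × ℝ)} (hΔ : ∀ q ∈ Δ, δ ≤ q.2) {P : ℝ × ℝ → ℝ}
    (h : HasSubgradientsIn Δ P) {s z z' : ℝ} (hz : z ≤ z') :
    P (s, z) + δ * (z' - z) ≤ P (s, z') := by
  obtain ⟨q, hq, hq'⟩ := h (s, z)
  have := hq' (s, z')
  simp only [pairing] at this
  nlinarith [hΔ q hq]

/-- `P - ⟨·, q⟩` has a local minimum at `p`, so its derivative vanishes there. -/
lemma grad_eq_of_eventually_le {P : ℝ × ℝ → ℝ} {p q : ℝ × ℝ} (hd : DifferentiableAt ℝ P p)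
    (h : ∀ᶠ p' in 𝓝 p, P p + (pairing p' q - pairing p q) ≤ P p') : grad P p = q := by
  have hmin : IsLocalMin (fun p' => P p' - pairing p' q) p := by
    filter_upwards [h] with p' hp'
    linarith
  set ℓ : ℝ × ℝ →L[ℝ] ℝ :=
    q.1 • ContinuousLinearMap.fst ℝ ℝ ℝ + q.2 • ContinuousLinearMap.snd ℝ ℝ ℝ with hℓ
  have hpair : (fun p' => pairing p' q) = ℓ := by
    ext p'; simp [hℓ, pairing]; ring
  have hder : HasFDerivAt (fun p' => P p' - pairing p' q) (fderiv ℝ P p - ℓ) p := by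
    have : HasFDerivAt (fun p' => pairing p' q) ℓ p := by
      rw [hpair]; exact ℓ.hasFDerivAt
    exact hd.hasFDerivAt.sub this
  have h0 := hmin.hasFDerivAt_eq_zero hder
  rw [sub_eq_zero] at h0
  simp [grad, h0, hℓ]

lemma HasSubgradientsIn.grad_spec {Δ : Set (ℝ × ℝ)} {P : ℝ × ℝ → ℝ} (h : HasSubgradientsIn Δ P)
    {p : ℝ × ℝ} (hd : DifferentiableAt ℝ P p) :
    grad P p ∈ Δ ∧ ∀ p', P p + (pairing p' (grad P p) - pairing p (grad P p)) ≤ P p' := by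
  obtain ⟨q, hq, hq'⟩ := h p
  rw [grad_eq_of_eventually_le hd (Eventually.of_forall hq')]
  exact ⟨hq, hq'⟩

lemma measurable_grad (P : ℝ × ℝ → ℝ) : Measurable (grad P) :=
  (measurable_fderiv_apply_const ℝ P (1, 0)).prodMk (measurable_fderiv_apply_const ℝ P (0, 1))

lemma HasSubgradientsIn.ae_differentiableAt {R : ℝ} (hR : 0 ≤ R) {P : ℝ × ℝ → ℝ}
    (h : HasSubgradientsIn (Icc 0 R ×ˢ Icc 0 R) P) : ∀ᵐ p, DifferentiableAt ℝ P p :=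
  (h.lipschitzWith hR).ae_differentiableAt

lemma isCompact_box (R : ℝ) : IsCompact (Icc 0 R ×ˢ Icc 0 R : Set (ℝ × ℝ)) :=
  isCompact_Icc.prod isCompact_Icc

/-- The gradients stay in a compact box, and each of their cluster points is a local subgradient of
`P` at `p`, hence equals `grad P p`. -/
lemma tendsto_grad {R : ℝ} {P : ℝ × ℝ → ℝ} {F : ℕ → ℝ × ℝ → ℝ} {p : ℝ × ℝ} {U : Set (ℝ × ℝ)}
    (hU : U ∈ 𝓝 p) (hlim : ∀ x ∈ U, Tendsto (fun n => F n x) atTop (𝓝 (P x)))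
    (hF : ∀ n, HasSubgradientsIn (Icc 0 R ×ˢ Icc 0 R) (F n))
    (hd : DifferentiableAt ℝ P p) (hdF : ∀ n, DifferentiableAt ℝ (F n) p) :
    Tendsto (fun n => grad (F n) p) atTop (𝓝 (grad P p)) := by
  refine (isCompact_box R).tendsto_nhds_of_unique_mapClusterPt
    (Eventually.of_forall fun n => ((hF n).grad_spec (hdF n)).1) fun q _ hq => ?_
  obtain ⟨φ, hφ, hφq⟩ := hq.tendsto_subseq
  refine (grad_eq_of_eventually_le hd ?_).symm
  filter_upwards [hU] with x hx
  have h1 : Tendsto (fun n => F (φ n) p + (pairing x (grad (F (φ n)) p) -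
      pairing p (grad (F (φ n)) p))) atTop (𝓝 (P p + (pairing x q - pairing p q))) :=
    ((hlim p (mem_of_mem_nhds hU)).comp hφ.tendsto_atTop).add
      ((((continuous_pairing_right x).tendsto q).comp hφq).sub
        (((continuous_pairing_right p).tendsto q).comp hφq))
  exact le_of_tendsto_of_tendsto' h1 ((hlim x hx).comp hφ.tendsto_atTop)
    fun n => ((hF (φ n)).grad_spec (hdF (φ n))).2 x

lemma isGreatest_conjugate {Δ : Set (ℝ × ℝ)} (hΔ : IsCompact Δ) (hne : Δ.Nonempty)
    {ψ : ℝ × ℝ → ℝ} (hψ : ContinuousOn ψ Δ) (p : ℝ × ℝ) :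
    IsGreatest ((fun q => pairing p q - ψ q) '' Δ) (conjugate Δ ψ p) :=
  (hΔ.image_of_continuousOn ((continuous_pairing_right p).continuousOn.sub hψ)).isGreatest_sSup
    (hne.image _)

lemma exists_conjugate_eq {Δ : Set (ℝ × ℝ)} (hΔ : IsCompact Δ) (hne : Δ.Nonempty)
    {ψ : ℝ × ℝ → ℝ} (hψ : ContinuousOn ψ Δ) (p : ℝ × ℝ) :
    ∃ q ∈ Δ, conjugate Δ ψ p = pairing p q - ψ q := by
  obtain ⟨q, hq, h⟩ := (isGreatest_conjugate hΔ hne hψ p).1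
  exact ⟨q, hq, h.symm⟩

lemma le_conjugate {Δ : Set (ℝ × ℝ)} (hΔ : IsCompact Δ)
    {ψ : ℝ × ℝ → ℝ} (hψ : ContinuousOn ψ Δ) (p : ℝ × ℝ) {q : ℝ × ℝ} (hq : q ∈ Δ) :
    pairing p q - ψ q ≤ conjugate Δ ψ p :=
  (isGreatest_conjugate hΔ ⟨q, hq⟩ hψ p).2 ⟨q, hq, rfl⟩

lemma hasSubgradientsIn_conjugate {Δ : Set (ℝ × ℝ)} (hΔ : IsCompact Δ) (hne : Δ.Nonempty)
    {ψ : ℝ × ℝ → ℝ} (hψ : ContinuousOn ψ Δ) : HasSubgradientsIn Δ (conjugate Δ ψ) := by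
  intro p
  obtain ⟨q, hq, h⟩ := exists_conjugate_eq hΔ hne hψ p
  exact ⟨q, hq, fun p' => by linarith [le_conjugate hΔ hψ p' hq]⟩

/-- Subgradients converge along a subsequence by compactness of `Δ`. The sets `Δ' n` may vary
because the lemma is also applied to translated supports. -/
lemma hasSubgradientsIn_of_tendsto {Δ : Set (ℝ × ℝ)} (hΔ : IsCompact Δ) {Δ' : ℕ → Set (ℝ × ℝ)}
    {η : ℕ → ℝ} (hη : Tendsto η atTop (𝓝 0))
    (hΔ' : ∀ n, ∀ q ∈ Δ' n, ∃ q' ∈ Δ, dist q q' ≤ η n) {F : ℕ → ℝ × ℝ → ℝ} {P : ℝ × ℝ → ℝ}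
    (hF : ∀ n, HasSubgradientsIn (Δ' n) (F n))
    (hlim : ∀ x, Tendsto (fun n => F n x) atTop (𝓝 (P x))) : HasSubgradientsIn Δ P := by
  intro p
  choose q hq hq' using fun n => hF n p
  choose r hr hr' using fun n => hΔ' n (q n) (hq n)
  obtain ⟨x, hx, φ, hφ, hφx⟩ := hΔ.tendsto_subseq hr
  have hqx : Tendsto (fun n => q (φ n)) atTop (𝓝 x) := by
    refine hφx.congr_dist ?_
    refine squeeze_zero (fun _ => dist_nonneg) (fun n => ?_) (hη.comp hφ.tendsto_atTop)
    rw [dist_comm]; exact hr' (φ n)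
  refine ⟨x, hx, fun p' => ?_⟩
  refine le_of_tendsto_of_tendsto' (((hlim p).comp hφ.tendsto_atTop).add
      ((((continuous_pairing_right p').tendsto x).comp hqx).sub
        (((continuous_pairing_right p).tendsto x).comp hqx)))
    ((hlim p').comp hφ.tendsto_atTop) fun n => hq' (φ n) p'

/-! ### Compactness: Arzelà–Ascoli and Helly. -/

/-- Sequential compactness of Lipschitz functions on the plane. -/
lemma exists_subseq_tendsto_of_lipschitzWith {L : ℝ≥0} {C : ℝ} {F : ℕ → ℝ × ℝ → ℝ}
    (hF : ∀ n, LipschitzWith L (F n)) (hC : ∀ n, |F n 0| ≤ C) :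
    ∃ (φ : ℕ → ℕ) (P : ℝ × ℝ → ℝ), StrictMono φ ∧
      (∀ x, Tendsto (fun n => F (φ n) x) atTop (𝓝 (P x))) ∧
      ∀ K, IsCompact K → TendstoUniformlyOn (fun n => F (φ n)) P atTop K := by
  let S : Set C(ℝ × ℝ, ℝ) := {f | LipschitzWith L f ∧ |f 0| ≤ C}
  have himg : (fun f : C(ℝ × ℝ, ℝ) => (f : ℝ × ℝ → ℝ)) '' S =
      {f | LipschitzWith L f ∧ |f 0| ≤ C} := by
    ext f
    exact ⟨by rintro ⟨g, hg, rfl⟩; exact hg, fun hf => ⟨⟨f, hf.1.continuous⟩, hf, rfl⟩⟩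
  -- Pointwise compactness: a closed subset of a product of intervals. Together with equicontinuity
  -- it gives compactness for locally uniform convergence.
  have hS1 : IsCompact ((fun f : C(ℝ × ℝ, ℝ) => (f : ℝ × ℝ → ℝ)) '' S) := by
    rw [himg]
    refine (isCompact_univ_pi fun x : ℝ × ℝ =>
      isCompact_Icc (a := -(C + L * dist x 0)) (b := C + L * dist x 0)).of_isClosed_subset ?_ ?_
    · have hL : {f : ℝ × ℝ → ℝ | LipschitzWith L f} =
          ⋂ x, ⋂ y, {f | dist (f x) (f y) ≤ L * dist x y} := by
        ext f; simp only [lipschitzWith_iff_dist_le_mul, mem_iInter, mem_ofPred_eq]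
      refine IsClosed.inter (s₁ := {f : ℝ × ℝ → ℝ | LipschitzWith L f}) ?_
        (isClosed_le (continuous_apply _).abs continuous_const)
      rw [hL]
      exact isClosed_iInter fun x => isClosed_iInter fun y =>
        isClosed_le ((continuous_apply x).dist (continuous_apply y)) continuous_const
    · rintro f ⟨hf, h0⟩ x -
      have := hf.dist_le_mul x 0
      rw [Real.dist_eq] at this
      refine abs_le.1 ?_
      linarith [abs_sub_abs_le_abs_sub (f x) (f 0)]
  have hS2 : Equicontinuous (fun f : S => ((f : C(ℝ × ℝ, ℝ)) : ℝ × ℝ → ℝ)) :=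
    (LipschitzWith.uniformEquicontinuous _ L fun f => f.2.1).equicontinuous
  have hS : IsCompact S := ArzelaAscoli.isCompact_of_equicontinuous S hS1 hS2
  obtain ⟨f, hf, φ, hφ, hlim⟩ := hS.tendsto_subseq (x := fun n => ⟨F n, (hF n).continuous⟩)
    fun n => ⟨hF n, hC n⟩
  rw [ContinuousMap.tendsto_iff_forall_isCompact_tendstoUniformlyOn] at hlim
  refine ⟨φ, f, hφ, fun x => ?_, hlim⟩
  exact (hlim {x} isCompact_singleton).tendsto_at (mem_singleton x)

/-- Helly's selection theorem. -/
lemma exists_subseq_tendsto_of_monotone {a b : ℝ} {ρ : ℕ → ℝ → ℝ} (hρ : ∀ n, Monotone (ρ n))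
    (hab : ∀ n x, ρ n x ∈ Icc a b) :
    ∃ (φ : ℕ → ℕ) (F : ℚ → ℝ) (g : ℝ → ℝ), StrictMono φ ∧
      (∀ q : ℚ, Tendsto (fun n => ρ (φ n) q) atTop (𝓝 (F q))) ∧ Monotone g ∧
      (∀ x, ∃ q : ℕ → ℚ, Tendsto (fun n => (q n : ℝ)) atTop (𝓝 x) ∧
        Tendsto (fun n => F (q n)) atTop (𝓝 (g x))) ∧
      ∀ x, ContinuousAt g x → Tendsto (fun n => ρ (φ n) x) atTop (𝓝 (g x)) := by
  have hcomp : IsCompact (Set.pi univ fun _ : ℚ => Icc a b) :=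
    isCompact_univ_pi fun _ => isCompact_Icc
  obtain ⟨F, hF, φ, hφ, hlim⟩ := hcomp.tendsto_subseq (x := fun n (q : ℚ) => ρ n q)
    fun n q _ => hab n q
  rw [tendsto_pi_nhds] at hlim
  have hFm : ∀ q q' : ℚ, q ≤ q' → F q ≤ F q' := fun q q' h =>
    le_of_tendsto_of_tendsto' (hlim q) (hlim q') fun n => hρ _ (by exact_mod_cast h)
  have hFab : ∀ q, F q ∈ Icc a b := fun q => hF q (mem_univ q)
  -- The right-continuous regularization of the limit on the rationals. Each `g x` is a limit of
  -- values `F (q n)` with `q n → x`, so closed conditions such as optimality pass to every `x`,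
  -- including discontinuities of `g`.
  set g : ℝ → ℝ := fun x => sInf (F '' {q : ℚ | x < (q : ℝ)}) with hg
  have hne : ∀ x, (F '' {q : ℚ | x < (q : ℝ)}).Nonempty := fun x =>
    let ⟨q, hq⟩ := exists_rat_gt x
    ⟨_, q, hq, rfl⟩
  have hbdd : ∀ x, BddBelow (F '' {q : ℚ | x < (q : ℝ)}) := fun x =>
    ⟨a, by rintro _ ⟨q, -, rfl⟩; exact (hFab q).1⟩
  have hgle : ∀ (x : ℝ) (q : ℚ), x < q → g x ≤ F q := fun x q h => csInf_le (hbdd x) ⟨q, h, rfl⟩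
  have hleg : ∀ (x : ℝ) (q : ℚ), (q : ℝ) ≤ x → F q ≤ g x := fun x q h =>
    le_csInf (hne x) (by
      rintro _ ⟨q', hq', rfl⟩
      exact hFm q q' (by exact_mod_cast (h.trans_lt hq').le))
  have hgm : Monotone g := fun x y hxy => csInf_le_csInf (hbdd x) (hne y)
    (image_mono fun q (hq : y < q) => hxy.trans_lt hq)
  have happrox : ∀ (x ε : ℝ), 0 < ε → ∃ q : ℚ, x < q ∧ (q : ℝ) < x + ε ∧ F q < g x + ε := by
    intro x ε hε
    obtain ⟨_, ⟨q, hq, rfl⟩, hq'⟩ := exists_lt_of_csInf_lt (hne x) (lt_add_of_pos_right (g x) hε)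
    obtain ⟨r, hr, hr'⟩ := exists_rat_btwn (lt_min (hq : x < q) (lt_add_of_pos_right x hε))
    refine ⟨r, hr, hr'.trans_le (min_le_right _ _), (hFm r q ?_).trans_lt hq'⟩
    exact_mod_cast (hr'.trans_le (min_le_left _ _)).le
  refine ⟨φ, F, g, hφ, hlim, hgm, fun x => ?_, fun x hx => ?_⟩
  · choose q hq1 hq2 hq3 using fun n : ℕ => happrox x (1 / ((n : ℝ) + 1)) (by positivity)
    have h1 : ∀ c : ℝ, Tendsto (fun n : ℕ => c + 1 / ((n : ℝ) + 1)) atTop (𝓝 c) := fun c => by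
      simpa using tendsto_one_div_add_atTop_nhds_zero_nat.const_add c
    exact ⟨q, tendsto_of_tendsto_of_tendsto_of_le_of_le tendsto_const_nhds (h1 x)
      (fun n => (hq1 n).le) fun n => (hq2 n).le,
      tendsto_of_tendsto_of_tendsto_of_le_of_le tendsto_const_nhds (h1 _)
      (fun n => hgle _ _ (hq1 n)) fun n => (hq3 n).le⟩
  · rw [Metric.tendsto_atTop]
    intro ε hε
    obtain ⟨δ, hδ, hδ'⟩ := Metric.continuousAt_iff.1 hx (ε / 2) (by linarith)
    obtain ⟨q, hq1, hq2⟩ := exists_rat_btwn (show x - δ / 2 < x by linarith)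
    have h1 : g x - ε / 2 < F q := by
      have := hδ' (x := x - δ / 2) (by rw [Real.dist_eq, abs_lt]; constructor <;> linarith)
      rw [Real.dist_eq, abs_lt] at this
      linarith [hgle _ _ hq1]
    obtain ⟨q', hq1', -, hq3'⟩ := happrox x (ε / 2) (by linarith)
    obtain ⟨N, hN⟩ := Metric.tendsto_atTop.1 (hlim q) (ε / 2) (by linarith)
    obtain ⟨N', hN'⟩ := Metric.tendsto_atTop.1 (hlim q') (ε / 2) (by linarith)
    refine ⟨max N N', fun n hn => ?_⟩
    have h2 := hN n (le_of_max_le_left hn)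
    have h3 := hN' n (le_of_max_le_right hn)
    simp only [Function.comp_apply] at h2 h3
    rw [Real.dist_eq, abs_lt] at h2 h3 ⊢
    have h4 := hρ (φ n) hq2.le
    have h5 := hρ (φ n) hq1'.le
    constructor <;> linarith

/-! ### The regions `D_ρ` and their measures. -/

/-- The closed box `[0, 1 / (2 r₀²)] × [0, H]`. -/
def physBox (r₀ H : ℝ) : Set (ℝ × ℝ) := Icc 0 (sTop r₀) ×ˢ Icc 0 H

section Region

variable {r₀ Ω H : ℝ} {ρ : ℝ → ℝ}

lemma isCompact_physBox : IsCompact (physBox r₀ H) := isCompact_Icc.prod isCompact_Icc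

lemma exists_measurable_of_mem_heights (hρ : ρ ∈ heights r₀ H) :
    ∃ ρ' : ℝ → ℝ, Measurable ρ' ∧ EqOn ρ ρ' (Icc 0 H) := by
  refine ⟨(Icc 0 H).indicator ρ, ?_, fun z hz => (indicator_of_mem hz ρ).symm⟩
  refine measurable_of_restrict_of_restrict_compl
    (measurableSet_Icc (a := (0 : ℝ)) (b := H)) ?_ ?_
  · convert hρ.1 using 1
    ext z; exact indicator_of_mem z.2 ρ
  · convert measurable_const (a := (0 : ℝ)) using 1
    ext z; exact indicator_of_notMem z.2 ρ

lemma mem_heights_of_measurable (hρ : Measurable ρ)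
    (h : ∀ z ∈ Icc 0 H, ρ z ∈ Ico 0 (sTop r₀)) : ρ ∈ heights r₀ H :=
  ⟨hρ.comp measurable_subtype_coe, h⟩

lemma region_congr {ρ' : ℝ → ℝ} (h : EqOn ρ ρ' (Icc 0 H)) : region H ρ = region H ρ' := by
  ext p
  refine and_congr_right fun hp => ?_
  rw [h hp]

lemma measurableSet_region (hρ : Measurable ρ) : MeasurableSet (region H ρ) := by
  have h1 : MeasurableSet {p : ℝ × ℝ | p.2 ∈ Icc 0 H} := measurable_snd measurableSet_Icc
  have h2 : MeasurableSet {p : ℝ × ℝ | 0 ≤ p.1} := measurableSet_le measurable_const measurable_fst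
  have h3 : MeasurableSet {p : ℝ × ℝ | p.1 ≤ ρ p.2} :=
    measurableSet_le measurable_fst (hρ.comp measurable_snd)
  exact h1.inter (h2.inter h3)

lemma measurableSet_region_of_mem_heights (hρ : ρ ∈ heights r₀ H) :
    MeasurableSet (region H ρ) := by
  obtain ⟨ρ', h1, h2⟩ := exists_measurable_of_mem_heights hρ
  rw [region_congr h2]
  exact measurableSet_region h1

@[fun_prop]
lemma measurable_density (r₀ : ℝ) : Measurable (density r₀) := by
  unfold density; fun_prop

lemma regionMeasure_absolutelyContinuous : regionMeasure r₀ H ρ ≪ volume :=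
  (withDensity_absolutelyContinuous _ _).trans Measure.restrict_le_self.absolutelyContinuous

lemma ae_mem_region (hρ : ρ ∈ heights r₀ H) : ∀ᵐ p ∂regionMeasure r₀ H ρ, p ∈ region H ρ :=
  (withDensity_absolutelyContinuous _ _).ae_le
    (ae_restrict_mem (measurableSet_region_of_mem_heights hρ))

lemma region_subset_physDomain (hρ : ρ ∈ heights r₀ H) : region H ρ ⊆ physDomain r₀ H :=
  fun _ hp => ⟨⟨hp.2.1, hp.2.2.trans_lt (hρ.2 _ hp.1).2⟩, hp.1⟩

lemma physDomain_subset_physBox : physDomain r₀ H ⊆ physBox r₀ H :=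
  prod_mono Ico_subset_Icc_self subset_rfl

lemma ae_fst_ne (c : ℝ) : ∀ᵐ p : ℝ × ℝ, p.1 ≠ c :=
  Measure.quasiMeasurePreserving_fst.ae (measure_eq_zero_iff_ae_notMem.1 (measure_singleton c))

lemma ae_snd_ne (c : ℝ) : ∀ᵐ p : ℝ × ℝ, p.2 ≠ c :=
  Measure.quasiMeasurePreserving_snd.ae (measure_eq_zero_iff_ae_notMem.1 (measure_singleton c))

lemma ae_mem_interior (hρ : ρ ∈ heights r₀ H) :
    ∀ᵐ p ∂regionMeasure r₀ H ρ, p ∈ Ioo 0 (sTop r₀) ×ˢ Ioo 0 H := by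
  have hac := regionMeasure_absolutelyContinuous (r₀ := r₀) (H := H) (ρ := ρ)
  filter_upwards [ae_mem_region hρ, hac.ae_le (ae_fst_ne 0), hac.ae_le (ae_snd_ne 0),
    hac.ae_le (ae_snd_ne H)] with p hp h1 h2 h3
  have := region_subset_physDomain hρ hp
  exact ⟨⟨lt_of_le_of_ne this.1.1 h1.symm, this.1.2⟩, lt_of_le_of_ne this.2.1 h2.symm,
    lt_of_le_of_ne this.2.2 h3⟩

lemma physBox_mem_nhds {p : ℝ × ℝ} (hp : p ∈ Ioo 0 (sTop r₀) ×ˢ Ioo 0 H) :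
    physBox r₀ H ∈ 𝓝 p :=
  prod_mem_nhds (Icc_mem_nhds hp.1.1 hp.1.2) (Icc_mem_nhds hp.2.1 hp.2.2)

lemma integrable_regionMeasure_iff {f : ℝ × ℝ → ℝ} :
    Integrable f (regionMeasure r₀ H ρ) ↔
      IntegrableOn (fun p => f p * density r₀ p.1) (region H ρ) := by
  unfold regionMeasure
  rw [integrable_withDensity_iff (by fun_prop) (Eventually.of_forall fun _ => by simp)]
  simp only [ENNReal.toReal_ofReal (density_nonneg _ _)]
  rfl

lemma integral_regionMeasure (f : ℝ × ℝ → ℝ) :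
    ∫ p, f p ∂regionMeasure r₀ H ρ = ∫ p in region H ρ, f p * density r₀ p.1 := by
  unfold regionMeasure
  rw [integral_withDensity_eq_integral_toReal_smul (by fun_prop)
    (Eventually.of_forall fun _ => by simp)]
  simp only [ENNReal.toReal_ofReal (density_nonneg _ _), smul_eq_mul, mul_comm]

/-- Fubini's theorem on the region `D_ρ`. -/
lemma integral_regionMeasure_eq_iterated (hρ : ρ ∈ heights r₀ H) {f : ℝ × ℝ → ℝ}
    (hf : Integrable f (regionMeasure r₀ H ρ)) :
    Integrable (fun z => ∫ s in (0 : ℝ)..ρ z, f (s, z) * density r₀ s)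
        (volume.restrict (Icc 0 H)) ∧
      ∫ p, f p ∂regionMeasure r₀ H ρ =
        ∫ z in Icc 0 H, ∫ s in (0 : ℝ)..ρ z, f (s, z) * density r₀ s := by
  have hm := measurableSet_region_of_mem_heights hρ
  set g : ℝ × ℝ → ℝ := (region H ρ).indicator fun p => f p * density r₀ p.1 with hg
  have hgi : Integrable g (volume.prod volume) :=
    (integrable_indicator_iff hm).2 (integrable_regionMeasure_iff.1 hf)
  have hin : ∀ z, ∫ s, g (s, z) =
      (Icc 0 H).indicator (fun z => ∫ s in (0 : ℝ)..ρ z, f (s, z) * density r₀ s) z := by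
    intro z
    by_cases hz : z ∈ Icc 0 H
    · rw [indicator_of_mem hz, intervalIntegral.integral_of_le (hρ.2 z hz).1,
        ← integral_Icc_eq_integral_Ioc, ← integral_indicator measurableSet_Icc]
      congr 1; ext s
      simp only [hg, indicator]
      congr 1
      simp only [region, mem_ofPred_eq, mem_Icc, eq_iff_iff]
      exact ⟨fun h => h.2, fun h => ⟨hz, h⟩⟩
    · rw [indicator_of_notMem hz]
      have : ∀ s, g (s, z) = 0 := fun s => indicator_of_notMem (fun h => hz h.1) _
      simp [this]
  constructor
  · have := hgi.integral_prod_right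
    simp only [hin] at this
    exact (integrable_indicator_iff measurableSet_Icc).1 this
  · rw [integral_regionMeasure, ← integral_indicator hm, ← hg, Measure.volume_eq_prod,
      integral_prod_symm g hgi]
    simp only [hin]
    rw [integral_indicator measurableSet_Icc]

/-- All regions below `M` become restrictions of one finite measure, so that varying regions turn
into varying indicators under dominated convergence. -/
lemma regionMeasure_eq_restrict {M : ℝ} (hρ : Measurable ρ) (hρM : ∀ z ∈ Icc 0 H, ρ z ≤ M) :
    regionMeasure r₀ H ρ = (regionMeasure r₀ H fun _ => M).restrict (region H ρ) := by
  unfold regionMeasure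
  rw [restrict_withDensity (measurableSet_region hρ), Measure.restrict_restrict
    (measurableSet_region hρ)]
  congr 2
  exact (inter_eq_left.2 fun p (hp : p ∈ region H ρ) =>
    (⟨hp.1, hp.2.1, hp.2.2.trans (hρM _ hp.1)⟩ : p ∈ region H fun _ => M)).symm

lemma isFiniteMeasure_regionMeasure_const (hr : 0 < r₀) {M : ℝ} (hM : M < sTop r₀) :
    IsFiniteMeasure (regionMeasure r₀ H fun _ => M) := by
  have hm : MeasurableSet (region H fun _ => M) := measurableSet_region measurable_const
  have hsub : region H (fun _ => M) ⊆ Icc 0 M ×ˢ Icc 0 H := fun p hp => ⟨hp.2, hp.1⟩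
  have hfin : volume (Icc (0:ℝ) M ×ˢ Icc 0 H) < ⊤ := (isCompact_Icc.prod isCompact_Icc).measure_lt_top
  obtain ⟨B, hB⟩ := isCompact_Icc.exists_bound_of_continuousOn
    ((continuousOn_density hr).mono fun s (hs : s ∈ Icc 0 M) => hs.2.trans_lt hM)
  constructor
  rw [regionMeasure, withDensity_apply _ MeasurableSet.univ, Measure.restrict_univ]
  calc _ ≤ ∫⁻ p in region H (fun _ => M), ENNReal.ofReal B := by
        refine setLIntegral_mono' hm fun p hp => ENNReal.ofReal_le_ofReal ?_
        exact (le_abs_self _).trans (hB p.1 hp.2)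
    _ = ENNReal.ofReal B * volume (region H fun _ => M) := by rw [setLIntegral_const]
    _ < ⊤ := ENNReal.mul_lt_top ENNReal.ofReal_lt_top ((measure_mono hsub).trans_lt hfin)

lemma isFiniteMeasure_regionMeasure (hr : 0 < r₀) {M : ℝ} (hM : M < sTop r₀) (hρ : Measurable ρ)
    (hρM : ∀ z ∈ Icc 0 H, ρ z ≤ M) : IsFiniteMeasure (regionMeasure r₀ H ρ) := by
  have := isFiniteMeasure_regionMeasure_const (H := H) hr hM
  rw [regionMeasure_eq_restrict hρ hρM]
  infer_instance

lemma aestronglyMeasurable_of_continuousOn (hρ : ρ ∈ heights r₀ H) {P : ℝ × ℝ → ℝ}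
    (hP : ContinuousOn P (physBox r₀ H)) : AEStronglyMeasurable P (regionMeasure r₀ H ρ) := by
  have hm := measurableSet_region_of_mem_heights hρ
  have h1 : AEStronglyMeasurable P (volume.restrict (region H ρ)) :=
    (hP.mono ((region_subset_physDomain hρ).trans
      physDomain_subset_physBox)).aestronglyMeasurable hm
  exact h1.mono_ac (withDensity_absolutelyContinuous _ _)

lemma exists_abs_le_of_continuousOn {P : ℝ × ℝ → ℝ} (hP : ContinuousOn P (physBox r₀ H)) :
    ∃ C, ∀ p ∈ physBox r₀ H, |P p| ≤ C :=
  isCompact_physBox.exists_bound_of_continuousOn hP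

lemma integrable_of_continuousOn (hρ : ρ ∈ heights r₀ H) [IsFiniteMeasure (regionMeasure r₀ H ρ)]
    {P : ℝ × ℝ → ℝ} (hP : ContinuousOn P (physBox r₀ H)) :
    Integrable P (regionMeasure r₀ H ρ) := by
  obtain ⟨C, hC⟩ := exists_abs_le_of_continuousOn hP
  refine Integrable.of_bound (aestronglyMeasurable_of_continuousOn hρ hP) C ?_
  filter_upwards [ae_mem_region hρ] with p hp
  exact hC p (physDomain_subset_physBox (region_subset_physDomain hρ hp))

@[fun_prop]
lemma measurable_boundaryValue (r₀ Ω : ℝ) : Measurable (boundaryValue r₀ Ω) := by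
  unfold boundaryValue; fun_prop

lemma integrable_boundaryValue (hr : 0 < r₀) (hΩ : 0 < Ω) (hρ : ρ ∈ heights r₀ H)
    [IsFiniteMeasure (regionMeasure r₀ H ρ)] {M : ℝ} (hM : M < sTop r₀)
    (hρM : ∀ z ∈ Icc 0 H, ρ z ≤ M) :
    Integrable (fun p : ℝ × ℝ => boundaryValue r₀ Ω p.1) (regionMeasure r₀ H ρ) := by
  refine Integrable.of_bound
    ((measurable_boundaryValue r₀ Ω).comp measurable_fst).aestronglyMeasurable (boundaryValue r₀ Ω M) ?_
  filter_upwards [ae_mem_region hρ] with p hp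
  have h1 : p.1 ≤ M := hp.2.2.trans (hρM _ hp.1)
  rw [Real.norm_eq_abs, abs_of_pos (boundaryValue_pos hr hΩ (h1.trans_lt hM))]
  exact boundaryValue_le_of_le hr h1 hM

/-- For `Ω = 1` this makes `boundaryValue` a primitive of `density`, from which masses of regions
are computed. -/
lemma hasDerivAt_boundaryValue (hr : 0 < r₀) {s : ℝ} (hs : s < sTop r₀) :
    HasDerivAt (boundaryValue r₀ Ω) (Ω ^ 2 * density r₀ s) s := by
  have hd := (denom_pos hr hs).ne'
  have h1 : HasDerivAt (fun s : ℝ => 1 - 2 * s * r₀ ^ 2) (-(2 * r₀ ^ 2)) s := by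
    have := (((hasDerivAt_id s).const_mul 2).mul_const (r₀ ^ 2)).const_sub 1
    simpa using this
  have h2 := (hasDerivAt_const s (Ω ^ 2 * r₀ ^ 2 / 2)).div h1 hd
  have : boundaryValue r₀ Ω = fun s => Ω ^ 2 * r₀ ^ 2 / 2 / (1 - 2 * s * r₀ ^ 2) :=
    funext (boundaryValue_eq r₀ Ω)
  rw [this]
  refine h2.congr_deriv ?_
  unfold density
  field_simp; ring

/-- There are constant heights of arbitrarily large mass. -/
lemma exists_const_mass_gt (hr : 0 < r₀) (hH : 0 < H) (C : ℝ) :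
    ∃ M, 0 < M ∧ M < sTop r₀ ∧ C < (regionMeasure r₀ H fun _ => M).real univ := by
  -- The constant height `M` has mass `H (m(M) - m(0))`, with `m` taken for `Ω = 1`; the threshold
  -- is what this mass must exceed.
  obtain ⟨M, hM0, hM, h⟩ := exists_forall_lt_boundaryValue hr one_pos
    (C / H + boundaryValue r₀ 1 0)
  refine ⟨M, hM0, hM, ?_⟩
  have hfin := isFiniteMeasure_regionMeasure_const (H := H) hr hM
  have hρ : (fun _ => M) ∈ heights r₀ H :=
    mem_heights_of_measurable measurable_const fun _ _ => ⟨hM0.le, hM⟩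
  have h1 := (integral_regionMeasure_eq_iterated hρ (f := fun _ => 1) (integrable_const _)).2
  have h2 : ∫ s in (0:ℝ)..M, 1 * density r₀ s = boundaryValue r₀ 1 M - boundaryValue r₀ 1 0 := by
    have hsub : uIcc 0 M ⊆ Iio (sTop r₀) := by
      rw [uIcc_of_le hM0.le]; exact fun s hs => hs.2.trans_lt hM
    refine intervalIntegral.integral_eq_sub_of_hasDerivAt (fun s hs => ?_) ?_
    · simpa using hasDerivAt_boundaryValue (Ω := 1) hr (hsub hs)
    · simpa using ((continuousOn_density hr).mono hsub).intervalIntegrable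
  simp only [integral_const, smul_eq_mul, mul_one, h2] at h1
  rw [h1]
  simp only [measureReal_restrict_apply_univ, Real.volume_real_Icc_of_le hH.le, sub_zero]
  have := h M le_rfl hM
  rw [← lt_sub_iff_add_lt, div_lt_iff₀ hH] at this
  linarith

lemma ae_fst_ne_graph (hρ : Measurable ρ) : ∀ᵐ p : ℝ × ℝ, p.1 ≠ ρ p.2 := by
  have hs : MeasurableSet {p : ℝ × ℝ | p.1 = ρ p.2} :=
    measurableSet_eq_fun measurable_fst (hρ.comp measurable_snd)
  have : (volume.prod volume) {p : ℝ × ℝ | p.1 = ρ p.2} = 0 := by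
    rw [Measure.prod_apply_symm hs]
    simp [preimage]
  exact measure_eq_zero_iff_ae_notMem.1 this

/-- Stability of the push-forwards under convergence of potentials and heights. -/
lemma tendsto_integral_grad (hr : 0 < r₀) {R M : ℝ} (hR : 0 ≤ R) (hM0 : 0 ≤ M) (hM : M < sTop r₀)
    {P : ℝ × ℝ → ℝ} {F : ℕ → ℝ × ℝ → ℝ} (hP : HasSubgradientsIn (Icc 0 R ×ˢ Icc 0 R) P)
    (hF : ∀ n, HasSubgradientsIn (Icc 0 R ×ˢ Icc 0 R) (F n))
    (hlim : ∀ x ∈ physBox r₀ H, Tendsto (fun n => F n x) atTop (𝓝 (P x)))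
    {ρn : ℕ → ℝ → ℝ} (hρ : Measurable ρ) (hρn : ∀ n, Measurable (ρn n))
    (hρM : ∀ z ∈ Icc 0 H, ρ z ≤ M) (hρnM : ∀ n, ∀ z ∈ Icc 0 H, ρn n z ≤ M)
    (hρlim : ∀ᵐ z, z ∈ Icc 0 H → Tendsto (fun n => ρn n z) atTop (𝓝 (ρ z)))
    (φ : BoundedContinuousFunction (ℝ × ℝ) ℝ) :
    Tendsto (fun n => ∫ p, φ (grad (F n) p) ∂regionMeasure r₀ H (ρn n)) atTop
      (𝓝 (∫ p, φ (grad P p) ∂regionMeasure r₀ H ρ)) := by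
  set μ := regionMeasure r₀ H fun _ => M with hμ
  have hfin : IsFiniteMeasure μ := isFiniteMeasure_regionMeasure_const hr hM
  have hMh : (fun _ => M) ∈ heights r₀ H :=
    mem_heights_of_measurable measurable_const fun _ _ => ⟨hM0, hM⟩
  have hφm : ∀ Q : ℝ × ℝ → ℝ, Measurable fun p => φ (grad Q p) := fun Q =>
    φ.continuous.measurable.comp (measurable_grad Q)
  have hac : μ ≪ volume := regionMeasure_absolutelyContinuous
  rw [regionMeasure_eq_restrict hρ hρM, ← integral_indicator (measurableSet_region hρ)]
  have : ∀ n, ∫ p, φ (grad (F n) p) ∂regionMeasure r₀ H (ρn n) =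
      ∫ p, (region H (ρn n)).indicator (fun p => φ (grad (F n) p)) p ∂μ := fun n => by
    rw [regionMeasure_eq_restrict (hρn n) (hρnM n), ← integral_indicator
      (measurableSet_region (hρn n))]
  simp only [this]
  refine tendsto_integral_of_dominated_convergence (fun _ => ‖φ‖)
    (fun n => ((hφm _).indicator (measurableSet_region (hρn n))).aestronglyMeasurable)
    (integrable_const _) (fun n => Eventually.of_forall fun p => ?_) ?_
  · exact (norm_indicator_le_norm_self _ _).trans (φ.norm_coe_le_norm _)
  · have hd : ∀ᵐ p ∂μ, ∀ n, DifferentiableAt ℝ (F n) p :=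
      ae_all_iff.2 fun n => hac.ae_le ((hF n).ae_differentiableAt hR)
    have hz : ∀ᵐ p : ℝ × ℝ, p.2 ∈ Icc 0 H → Tendsto (fun n => ρn n p.2) atTop (𝓝 (ρ p.2)) :=
      Measure.quasiMeasurePreserving_snd.ae hρlim
    filter_upwards [hd, hac.ae_le (hP.ae_differentiableAt hR), ae_mem_interior hMh,
      hac.ae_le hz, hac.ae_le (ae_fst_ne_graph hρ)] with p h1 h2 h3 h4 h5
    have hg := tendsto_grad (physBox_mem_nhds h3) hlim hF h2 h1
    have hp2 : p.2 ∈ Icc 0 H := ⟨h3.2.1.le, h3.2.2.le⟩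
    have h4 := h4 hp2
    -- Off the graph of `ρ`, a null set, the indicators of the regions are eventually constant.
    rcases lt_or_gt_of_ne h5 with h | h
    · have hev : ∀ᶠ n in atTop, φ (grad (F n) p) =
          (region H (ρn n)).indicator (fun p => φ (grad (F n) p)) p := by
        filter_upwards [h4.eventually (lt_mem_nhds h)] with n hn
        have hp : p ∈ region H (ρn n) := ⟨hp2, h3.1.1.le, hn.le⟩
        exact (indicator_of_mem hp fun p => φ (grad (F n) p)).symm
      have hp : p ∈ region H ρ := ⟨hp2, h3.1.1.le, h.le⟩
      rw [indicator_of_mem hp]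
      exact ((φ.continuous.tendsto _).comp hg).congr' hev
    · have hev : ∀ᶠ n in atTop, (0:ℝ) =
          (region H (ρn n)).indicator (fun p => φ (grad (F n) p)) p := by
        filter_upwards [h4.eventually (gt_mem_nhds h)] with n hn
        exact (indicator_of_notMem (fun hp : p ∈ region H (ρn n) => hn.not_ge hp.2.2)
          fun p => φ (grad (F n) p)).symm
      rw [indicator_of_notMem (fun hp : p ∈ region H ρ => h.not_ge hp.2.2)]
      exact tendsto_const_nhds.congr' hev

end Region

/-! ### Optimal selections of heights and their energy. -/

/-- The projection of the line onto `[0, H]`. -/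
def clamp (H z : ℝ) : ℝ := max 0 (min z H)

lemma clamp_mem {H : ℝ} (hH : 0 ≤ H) (z : ℝ) : clamp H z ∈ Icc 0 H :=
  ⟨le_max_left _ _, max_le hH (min_le_right _ _)⟩

lemma clamp_of_mem {H z : ℝ} (hz : z ∈ Icc 0 H) : clamp H z = z := by
  unfold clamp; rw [min_eq_left hz.2, max_eq_right hz.1]

lemma monotone_clamp (H : ℝ) : Monotone (clamp H) := fun _ _ h =>
  max_le_max le_rfl (min_le_min h le_rfl)

lemma continuous_clamp (H : ℝ) : Continuous (clamp H) := by
  unfold clamp; fun_prop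

/-- The largest minimizer of the potential at height `z`. -/
def maxHeight (r₀ Ω H : ℝ) (P : ℝ × ℝ → ℝ) (z : ℝ) : ℝ :=
  sSup {r | IsOptimalHeight r₀ Ω (fun s => P (s, clamp H z)) r}

/-- `ρ(z)` minimizes the potential at every height `z`. -/
def IsOptimalSelection (r₀ Ω H : ℝ) (P : ℝ × ℝ → ℝ) (ρ : ℝ → ℝ) : Prop :=
  ∀ z, IsOptimalHeight r₀ Ω (fun s => P (s, clamp H z)) (ρ z)

/-- The energy `∫_{D_ρ} (m(s) - P(s, z)) e(s) ds dz`. -/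
def energy (r₀ Ω H : ℝ) (P : ℝ × ℝ → ℝ) (ρ : ℝ → ℝ) : ℝ :=
  ∫ p, (boundaryValue r₀ Ω p.1 - P p) ∂regionMeasure r₀ H ρ

section Selection

variable {r₀ Ω H : ℝ} {ρ : ℝ → ℝ} {P : ℝ × ℝ → ℝ}

lemma continuousOn_slice (hP : ContinuousOn P (physBox r₀ H)) {z : ℝ} (hz : z ∈ Icc 0 H) :
    ContinuousOn (fun s => P (s, z)) (Icc 0 (sTop r₀)) :=
  hP.comp (by fun_prop) fun _ hs => ⟨hs, hz⟩

lemma isGreatest_maxHeight (hr : 0 < r₀) (hΩ : 0 < Ω) (hH : 0 < H)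
    (hP : ContinuousOn P (physBox r₀ H)) (z : ℝ) :
    IsGreatest {r | IsOptimalHeight r₀ Ω (fun s => P (s, clamp H z)) r}
      (maxHeight r₀ Ω H P z) := by
  obtain ⟨r, hr'⟩ := exists_isGreatest_optimalHeight hr hΩ
    (continuousOn_slice hP (clamp_mem hH.le z))
  rw [maxHeight, hr'.csSup_eq]
  exact hr'

lemma isOptimalSelection_maxHeight (hr : 0 < r₀) (hΩ : 0 < Ω) (hH : 0 < H)
    (hP : ContinuousOn P (physBox r₀ H)) :
    IsOptimalSelection r₀ Ω H P (maxHeight r₀ Ω H P) :=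
  fun z => (isGreatest_maxHeight hr hΩ hH hP z).1

/-- The maximum of the largest minimizers at `z ≤ z'` is still a minimizer at `z'`. Clamping extends
monotonicity to the whole line, which gives measurability. -/
lemma monotone_maxHeight (hr : 0 < r₀) (hΩ : 0 < Ω) (hH : 0 < H)
    (hP : ContinuousOn P (physBox r₀ H))
    (hmono : ∀ s z z', z ≤ z' → P (s, z) ≤ P (s, z')) : Monotone (maxHeight r₀ Ω H P) := by
  intro z z' hz
  have h := isGreatest_maxHeight hr hΩ hH hP
  exact (le_max_left _ _).trans ((h z').2 ((h z).1.isOptimalHeight_max hr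
    (continuousOn_slice hP (clamp_mem hH.le z)) (continuousOn_slice hP (clamp_mem hH.le z'))
    (fun s _ => hmono s _ _ (monotone_clamp H hz)) (h z').1))

lemma IsOptimalSelection.le (hr : 0 < r₀) (hH : 0 < H) (hP : ContinuousOn P (physBox r₀ H))
    (h : IsOptimalSelection r₀ Ω H P ρ) {C M : ℝ} (hC : ∀ p ∈ physBox r₀ H, P p ≤ C) (hM0 : 0 < M)
    (hM' : ∀ s, M ≤ s → s < sTop r₀ → C < boundaryValue r₀ Ω s) (z : ℝ) : ρ z ≤ M :=
  (h z).le_of_lt_boundaryValue hr (continuousOn_slice hP (clamp_mem hH.le z))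
    (fun _ hs => hC _ ⟨hs, clamp_mem hH.le z⟩) hM0 hM'

lemma IsOptimalSelection.exists_le (hr : 0 < r₀) (hΩ : 0 < Ω) (hH : 0 < H)
    (hP : ContinuousOn P (physBox r₀ H)) (h : IsOptimalSelection r₀ Ω H P ρ) :
    ∃ M, 0 < M ∧ M < sTop r₀ ∧ ∀ z, ρ z ≤ M := by
  obtain ⟨C, hC⟩ := exists_abs_le_of_continuousOn hP
  obtain ⟨M, hM0, hM, hM'⟩ := exists_forall_lt_boundaryValue hr hΩ C
  exact ⟨M, hM0, hM, h.le hr hH hP (fun p hp => (le_abs_self _).trans (hC p hp)) hM0 hM'⟩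

lemma IsOptimalSelection.mem_heights (h : IsOptimalSelection r₀ Ω H P ρ) (hρ : Measurable ρ) :
    ρ ∈ heights r₀ H :=
  mem_heights_of_measurable hρ fun z _ => (h z).1

lemma IsOptimalSelection.isOptimalHeight (h : IsOptimalSelection r₀ Ω H P ρ) {z : ℝ}
    (hz : z ∈ Icc 0 H) : IsOptimalHeight r₀ Ω (fun s => P (s, z)) (ρ z) := by
  simpa only [clamp_of_mem hz] using h z

lemma integrable_boundaryValue_sub (hr : 0 < r₀) (hΩ : 0 < Ω) (hP : ContinuousOn P (physBox r₀ H))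
    (hρ : Measurable ρ) (hρ0 : ∀ z ∈ Icc 0 H, 0 ≤ ρ z) {M : ℝ} (hM : M < sTop r₀)
    (hρM : ∀ z ∈ Icc 0 H, ρ z ≤ M) :
    Integrable (fun p => boundaryValue r₀ Ω p.1 - P p) (regionMeasure r₀ H ρ) := by
  have hh : ρ ∈ heights r₀ H :=
    mem_heights_of_measurable hρ fun z hz => ⟨hρ0 z hz, (hρM z hz).trans_lt hM⟩
  have := isFiniteMeasure_regionMeasure hr hM hρ hρM
  exact (integrable_boundaryValue hr hΩ hh hM hρM).sub (integrable_of_continuousOn hh hP)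

lemma energy_eq (hh : ρ ∈ heights r₀ H)
    (hi : Integrable (fun p => boundaryValue r₀ Ω p.1 - P p) (regionMeasure r₀ H ρ)) :
    Integrable (fun z => heightPotential r₀ Ω P (ρ z) z) (volume.restrict (Icc 0 H)) ∧
      energy r₀ Ω H P ρ = ∫ z in Icc 0 H, heightPotential r₀ Ω P (ρ z) z :=
  integral_regionMeasure_eq_iterated hh hi

lemma IsOptimalSelection.integrable (hr : 0 < r₀) (hΩ : 0 < Ω) (hH : 0 < H)
    (hP : ContinuousOn P (physBox r₀ H)) (h : IsOptimalSelection r₀ Ω H P ρ) (hρ : Measurable ρ) :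
    Integrable (fun p => boundaryValue r₀ Ω p.1 - P p) (regionMeasure r₀ H ρ) := by
  obtain ⟨M, -, hM, hρM⟩ := h.exists_le hr hΩ hH hP
  exact integrable_boundaryValue_sub hr hΩ hP hρ (fun z _ => (h z).1.1) hM fun z _ => hρM z

/-- By Fubini the energy integrates the one-dimensional potentials over `z`, and the selection
minimizes each of them. -/
lemma IsOptimalSelection.energy_le (hr : 0 < r₀) (hΩ : 0 < Ω) (hH : 0 < H)
    (hP : ContinuousOn P (physBox r₀ H)) (h : IsOptimalSelection r₀ Ω H P ρ) (hρ : Measurable ρ)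
    {ρ' : ℝ → ℝ} (hh : ρ' ∈ heights r₀ H)
    (hi : Integrable (fun p => boundaryValue r₀ Ω p.1 - P p) (regionMeasure r₀ H ρ')) :
    energy r₀ Ω H P ρ ≤ energy r₀ Ω H P ρ' := by
  obtain ⟨h1, h2⟩ := energy_eq (h.mem_heights hρ) (h.integrable hr hΩ hH hP hρ)
  obtain ⟨h3, h4⟩ := energy_eq hh hi
  rw [h2, h4]
  refine setIntegral_mono_on h1 h3 measurableSet_Icc fun z hz => ?_
  exact (h.isOptimalHeight hz).2 _ (hh.2 z hz)

lemma abs_energy_sub_le {P' : ℝ × ℝ → ℝ} (hh : ρ ∈ heights r₀ H)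
    [IsFiniteMeasure (regionMeasure r₀ H ρ)]
    (hi : Integrable (fun p => boundaryValue r₀ Ω p.1 - P p) (regionMeasure r₀ H ρ))
    (hi' : Integrable (fun p => boundaryValue r₀ Ω p.1 - P' p) (regionMeasure r₀ H ρ)) {η : ℝ}
    (hη : ∀ p ∈ physBox r₀ H, |P p - P' p| ≤ η) :
    |energy r₀ Ω H P ρ - energy r₀ Ω H P' ρ| ≤ η * (regionMeasure r₀ H ρ).real univ := by
  unfold energy
  rw [← integral_sub hi hi']
  rw [← Real.norm_eq_abs]
  refine norm_integral_le_of_norm_le_const (C := η) ?_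
  filter_upwards [ae_mem_region hh] with p hp
  have := hη p (physDomain_subset_physBox (region_subset_physDomain hh hp))
  rw [Real.norm_eq_abs, ← abs_neg]
  rwa [show -(boundaryValue r₀ Ω p.1 - P p - (boundaryValue r₀ Ω p.1 - P' p)) = P p - P' p by ring]

end Selection

/-! ### Legendre duality on the closed box. -/

section Conjugate

variable {r₀ Ω H R : ℝ} {Δ : Set (ℝ × ℝ)} {P : ℝ × ℝ → ℝ}

lemma physBox_nonempty (hr : 0 < r₀) (hH : 0 < H) : (physBox r₀ H).Nonempty :=
  ⟨(0, 0), ⟨le_rfl, (sTop_pos hr).le⟩, ⟨le_rfl, hH.le⟩⟩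

lemma zero_mem_physBox (hr : 0 < r₀) (hH : 0 < H) : (0 : ℝ × ℝ) ∈ physBox r₀ H :=
  ⟨⟨le_rfl, (sTop_pos hr).le⟩, ⟨le_rfl, hH.le⟩⟩

lemma physBox_subset_box : physBox r₀ H ⊆
    Icc 0 (max (sTop r₀) H) ×ˢ Icc 0 (max (sTop r₀) H) :=
  prod_mono (Icc_subset_Icc_right (le_max_left _ _)) (Icc_subset_Icc_right (le_max_right _ _))

lemma lipschitzWith_conjugate_physBox (hr : 0 < r₀) (hH : 0 < H)
    (hP : ContinuousOn P (physBox r₀ H)) :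
    LipschitzWith (2 * max (sTop r₀) H).toNNReal (conjugate (physBox r₀ H) P) :=
  ((hasSubgradientsIn_conjugate isCompact_physBox (physBox_nonempty hr hH) hP).mono
    physBox_subset_box).lipschitzWith (hH.le.trans (le_max_right _ _))

/-- One inequality is Fenchel–Young. For the other, a subgradient `q ∈ Δ` at `p` makes `p` a
maximizer in the conjugate at `q`. -/
lemma conjugate_conjugate (hr : 0 < r₀) (hH : 0 < H) (hΔ : IsCompact Δ)
    (hP : ContinuousOn P (physBox r₀ H)) (hS : HasSubgradientsIn Δ P) {p : ℝ × ℝ}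
    (hp : p ∈ physBox r₀ H) : conjugate Δ (conjugate (physBox r₀ H) P) p = P p := by
  have hc : ContinuousOn (conjugate (physBox r₀ H) P) Δ :=
    (lipschitzWith_conjugate_physBox hr hH hP).continuous.continuousOn
  obtain ⟨q, hq, hq'⟩ := hS p
  apply le_antisymm
  · obtain ⟨q, -, h⟩ := exists_conjugate_eq hΔ ⟨q, hq⟩ hc p
    rw [h, pairing_comm]
    linarith [le_conjugate isCompact_physBox hP q hp]
  · refine le_trans ?_ (le_conjugate hΔ hc p hq)
    obtain ⟨p', -, h⟩ := exists_conjugate_eq isCompact_physBox (physBox_nonempty hr hH) hP q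
    rw [h, pairing_comm q p']
    linarith [hq' p']

lemma abs_conjugate_sub_le (hΔ : IsCompact Δ) (hne : Δ.Nonempty) {ψ ψ' : ℝ × ℝ → ℝ}
    (hψ : ContinuousOn ψ Δ) (hψ' : ContinuousOn ψ' Δ) {η : ℝ} (hη : ∀ q ∈ Δ, |ψ q - ψ' q| ≤ η)
    (p : ℝ × ℝ) : |conjugate Δ ψ p - conjugate Δ ψ' p| ≤ η := by
  obtain ⟨q, hq, h⟩ := exists_conjugate_eq hΔ hne hψ p
  obtain ⟨q', hq', h'⟩ := exists_conjugate_eq hΔ hne hψ' p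
  have h1 := le_conjugate hΔ hψ' p hq
  have h2 := le_conjugate hΔ hψ p hq'
  have h3 := abs_le.1 (hη q hq)
  have h4 := abs_le.1 (hη q' hq')
  rw [abs_le]
  constructor <;> linarith

/-- Envelope principle: any maximizing `q` is a subgradient at `p`, hence the gradient. -/
lemma conjugate_eq_of_differentiableAt (hΔ : IsCompact Δ) (hne : Δ.Nonempty) {ψ : ℝ × ℝ → ℝ}
    (hψ : ContinuousOn ψ Δ) {p : ℝ × ℝ} (hd : DifferentiableAt ℝ (conjugate Δ ψ) p) :
    grad (conjugate Δ ψ) p ∈ Δ ∧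
      conjugate Δ ψ p = pairing p (grad (conjugate Δ ψ) p) - ψ (grad (conjugate Δ ψ) p) := by
  obtain ⟨q, hq, h⟩ := exists_conjugate_eq hΔ hne hψ p
  have : grad (conjugate Δ ψ) p = q := by
    refine grad_eq_of_eventually_le hd (Eventually.of_forall fun p' => ?_)
    linarith [le_conjugate hΔ hψ p' hq]
  rw [this]
  exact ⟨hq, h⟩

end Conjugate

/-! ### Existence of a dual maximizer. -/

/-- The dual functional in terms of `P`, up to a constant. -/
def dualValue (r₀ Ω H : ℝ) (σ : Measure (ℝ × ℝ)) (P : ℝ × ℝ → ℝ) : ℝ :=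
  energy r₀ Ω H P (maxHeight r₀ Ω H P) - ∫ q, conjugate (physBox r₀ H) P q ∂σ

section DualValue

variable {r₀ Ω H R : ℝ} {Δ : Set (ℝ × ℝ)} {P : ℝ × ℝ → ℝ} {σ : Measure (ℝ × ℝ)}

lemma integrable_of_continuous_of_compact [IsFiniteMeasure σ] (hΔ : IsCompact Δ)
    (hσ : ∀ᵐ q ∂σ, q ∈ Δ) {f : ℝ × ℝ → ℝ} (hf : ContinuousOn f Δ) : Integrable f σ := by
  obtain ⟨C, hC⟩ := hΔ.exists_bound_of_continuousOn hf
  have hr : σ.restrict Δ = σ := Measure.restrict_eq_self_of_ae_mem hσ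
  refine Integrable.of_bound ?_ C (hσ.mono fun q hq => hC q hq)
  rw [← hr]
  exact hf.aestronglyMeasurable hΔ.measurableSet

lemma abs_sub_zero_le (hR : 0 ≤ R) (hS : HasSubgradientsIn (Icc 0 R ×ˢ Icc 0 R) P)
    {p : ℝ × ℝ} (hp : p ∈ physBox r₀ H) : |P p - P 0| ≤ 2 * R * max (sTop r₀) H := by
  have h1 := (hS.lipschitzWith hR).dist_le_mul p 0
  rw [Real.dist_eq, Real.coe_toNNReal _ (by positivity)] at h1
  refine h1.trans (mul_le_mul_of_nonneg_left ?_ (by positivity))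
  rw [dist_zero_right, Prod.norm_def, Real.norm_eq_abs, Real.norm_eq_abs,
    abs_of_nonneg hp.1.1, abs_of_nonneg hp.2.1]
  exact max_le_max hp.1.2 hp.2.2

lemma HasSubgradientsIn.continuousOn (hR : 0 ≤ R)
    (hS : HasSubgradientsIn (Icc 0 R ×ˢ Icc 0 R) P) (s : Set (ℝ × ℝ)) : ContinuousOn P s :=
  (hS.lipschitzWith hR).continuous.continuousOn

lemma HasSubgradientsIn.measurable_maxHeight (hr : 0 < r₀) (hΩ : 0 < Ω) (hH : 0 < H) (hR : 0 ≤ R)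
    (hS : HasSubgradientsIn (Icc 0 R ×ˢ Icc 0 R) P) :
    Monotone (maxHeight r₀ Ω H P) ∧ Measurable (maxHeight r₀ Ω H P) := by
  have := monotone_maxHeight hr hΩ hH (hS.continuousOn hR _)
    fun s z z' hz => hS.mono_of_le (p := (s, z)) (p' := (s, z')) le_rfl hz
  exact ⟨this, this.measurable⟩

/-- Optimal heights have bounded energy, in terms of a test height of mass greater than `2`. -/
lemma exists_energy_le (hr : 0 < r₀) (hΩ : 0 < Ω) (hH : 0 < H) (hR : 0 ≤ R) :
    ∃ A, 0 ≤ A ∧ ∀ P ρ, HasSubgradientsIn (Icc 0 R ×ˢ Icc 0 R) P → Measurable ρ →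
      IsOptimalSelection r₀ Ω H P ρ → energy r₀ Ω H P ρ ≤ 0 ∧
      (2 * R * max (sTop r₀) H ≤ P 0 →
        energy r₀ Ω H P ρ ≤ A - 2 * (P 0 - 2 * R * max (sTop r₀) H)) := by
  -- The dual value is at most the energy plus `P 0`. A test height of mass above `2` makes the
  -- energy fall at least like `-2 P 0`, which beats `+P 0` and gives coercivity; the zero height
  -- gives `energy ≤ 0`.
  obtain ⟨M, hM0, hM, hmass⟩ := exists_const_mass_gt (H := H) hr hH 2
  have hMh : (fun _ => M) ∈ heights r₀ H :=
    mem_heights_of_measurable measurable_const fun _ _ => ⟨hM0.le, hM⟩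
  have hfin := isFiniteMeasure_regionMeasure_const (H := H) hr hM
  have him := integrable_boundaryValue (Ω := Ω) hr hΩ hMh hM fun _ _ => le_rfl
  refine ⟨∫ p, boundaryValue r₀ Ω p.1 ∂regionMeasure r₀ H fun _ => M,
    integral_nonneg_of_ae ?_, fun P ρ hS hρ hopt => ⟨?_, fun hP0 => ?_⟩⟩
  · filter_upwards [ae_mem_region hMh] with p hp
    exact (boundaryValue_pos hr hΩ (region_subset_physDomain hMh hp).1.2).le
  · have h0 : (fun _ => (0:ℝ)) ∈ heights r₀ H :=
      mem_heights_of_measurable measurable_const fun _ _ => ⟨le_rfl, sTop_pos hr⟩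
    have hi := integrable_boundaryValue_sub (Ω := Ω) hr hΩ (hS.continuousOn hR (physBox r₀ H))
      measurable_const (fun _ _ => le_rfl) (sTop_pos hr) fun _ _ => le_rfl
    refine (hopt.energy_le hr hΩ hH (hS.continuousOn hR _) hρ h0 hi).trans ?_
    rw [(energy_eq h0 hi).2]
    simp [heightPotential]
  · have hi := integrable_boundaryValue_sub (Ω := Ω) hr hΩ (hS.continuousOn hR (physBox r₀ H))
      measurable_const (fun _ _ => hM0.le) hM fun _ _ => le_rfl
    refine (hopt.energy_le hr hΩ hH (hS.continuousOn hR _) hρ hMh hi).trans ?_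
    unfold energy
    have hiP := integrable_of_continuousOn hMh (hS.continuousOn hR (physBox r₀ H))
    rw [integral_sub him hiP]
    have h1 : ∫ p, (P 0 - 2 * R * max (sTop r₀) H) ∂(regionMeasure r₀ H fun _ => M) ≤
        ∫ p, P p ∂(regionMeasure r₀ H fun _ => M) := by
      refine integral_mono_ae (integrable_const _) hiP ?_
      filter_upwards [ae_mem_region hMh] with p hp
      have := abs_sub_zero_le hR hS
        (physDomain_subset_physBox (region_subset_physDomain hMh hp))
      linarith [(abs_le.1 this).1]
    rw [integral_const, smul_eq_mul] at h1
    nlinarith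

lemma integrable_conjugate [IsFiniteMeasure σ] (hr : 0 < r₀) (hH : 0 < H) (hΔ : IsCompact Δ)
    (hσ : ∀ᵐ q ∂σ, q ∈ Δ) (hP : ContinuousOn P (physBox r₀ H)) :
    Integrable (conjugate (physBox r₀ H) P) σ :=
  integrable_of_continuous_of_compact hΔ hσ
    (lipschitzWith_conjugate_physBox hr hH hP).continuous.continuousOn

/-- Testing the conjugate at `p = 0` bounds it below by `-P 0`. -/
lemma dualValue_le [IsProbabilityMeasure σ] (hr : 0 < r₀) (hH : 0 < H)
    (hΔ : IsCompact Δ) (hσ : ∀ᵐ q ∂σ, q ∈ Δ) (hP : ContinuousOn P (physBox r₀ H)) :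
    dualValue r₀ Ω H σ P ≤ energy r₀ Ω H P (maxHeight r₀ Ω H P) + P 0 := by
  have h1 : ∫ q, -P 0 ∂σ ≤ ∫ q, conjugate (physBox r₀ H) P q ∂σ := by
    refine integral_mono (integrable_const _) (integrable_conjugate hr hH hΔ hσ hP) fun q => ?_
    have := le_conjugate isCompact_physBox hP q (zero_mem_physBox hr hH)
    simpa [pairing] using this
  simp only [integral_const, probReal_univ, one_smul] at h1
  unfold dualValue
  linarith

/-- Existence of a maximizer of the dual problem. -/
lemma exists_isMaxOn_dualValue [IsProbabilityMeasure σ] (hr : 0 < r₀) (hΩ : 0 < Ω) (hH : 0 < H)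
    (hR : 0 ≤ R) (hΔ : IsCompact Δ) (hne : Δ.Nonempty) (hΔR : Δ ⊆ Icc 0 R ×ˢ Icc 0 R)
    (hσ : ∀ᵐ q ∂σ, q ∈ Δ) :
    ∃ P, HasSubgradientsIn Δ P ∧
      ∀ P', HasSubgradientsIn Δ P' → dualValue r₀ Ω H σ P' ≤ dualValue r₀ Ω H σ P := by
  obtain ⟨A, hA0, hA⟩ := exists_energy_le (R := R) hr hΩ hH hR
  set c := 2 * R * max (sTop r₀) H with hc
  have hc0 : 0 ≤ c := by
    have := hH.le.trans (le_max_right (sTop r₀) H)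
    positivity
  have hsel : ∀ P, HasSubgradientsIn Δ P → IsOptimalSelection r₀ Ω H P (maxHeight r₀ Ω H P) :=
    fun P hP => isOptimalSelection_maxHeight hr hΩ hH ((hP.mono hΔR).continuousOn hR _)
  have hbd : ∀ P, HasSubgradientsIn Δ P → dualValue r₀ Ω H σ P ≤ P 0 ∧
      (c ≤ P 0 → dualValue r₀ Ω H σ P ≤ A + 2 * c - P 0) := by
    intro P hP
    have h1 := dualValue_le (Ω := Ω) hr hH hΔ hσ ((hP.mono hΔR).continuousOn hR (physBox r₀ H))
    obtain ⟨h2, h3⟩ := hA P _ (hP.mono hΔR)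
      ((hP.mono hΔR).measurable_maxHeight hr hΩ hH hR).2 (hsel P hP)
    exact ⟨by linarith, fun h => by linarith [h3 h]⟩
  set S := dualValue r₀ Ω H σ '' {P | HasSubgradientsIn Δ P} with hS
  have hSne : S.Nonempty :=
    ⟨_, _, hasSubgradientsIn_conjugate hΔ hne (ψ := fun _ => 0) continuousOn_const, rfl⟩
  have hSb : BddAbove S := by
    refine ⟨A + c, ?_⟩
    rintro _ ⟨P, hP, rfl⟩
    obtain ⟨h1, h2⟩ := hbd P hP
    rcases le_total c (P 0) with h | h
    · linarith [h2 h]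
    · linarith
  obtain ⟨u, -, hu, huS⟩ := exists_seq_tendsto_sSup hSne hSb
  choose F hF hFu using huS
  obtain ⟨g, hg⟩ : BddBelow (range u) := hu.bddBelow_range
  have hg' : ∀ n, g ≤ dualValue r₀ Ω H σ (F n) := fun n => by
    rw [hFu]; exact hg ⟨n, rfl⟩
  have hF0 : ∀ n, |F n 0| ≤ |g| + A + 2 * c := by
    intro n
    obtain ⟨h1, h2⟩ := hbd (F n) (hF n)
    have h3 := abs_le.1 (le_refl |g|)
    have h4 := hg' n
    rw [abs_le]
    constructor
    · linarith
    · rcases le_total c (F n 0) with h | h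
      · linarith [h2 h]
      · linarith [abs_nonneg g]
  obtain ⟨φ, P, hφ, hlim, hunif⟩ := exists_subseq_tendsto_of_lipschitzWith
    (fun n => ((hF n).mono hΔR).lipschitzWith hR) hF0
  have hP : HasSubgradientsIn Δ P := hasSubgradientsIn_of_tendsto hΔ (Δ' := fun _ => Δ)
    (η := fun _ => 0) tendsto_const_nhds (fun n q hq => ⟨q, hq, by simp⟩)
    (fun n => hF (φ n)) hlim
  refine ⟨P, hP, fun P' hP' => (le_csSup hSb ⟨P', hP', rfl⟩).trans ?_⟩
  have hPc := (hP.mono hΔR).continuousOn hR (physBox r₀ H)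
  have hρ := ((hP.mono hΔR).measurable_maxHeight hr hΩ hH hR).2
  set ρ := maxHeight r₀ Ω H P with hρdef
  obtain ⟨M, hM0, hM, hρM⟩ := (hsel P hP).exists_le hr hΩ hH hPc
  have hfin := isFiniteMeasure_regionMeasure hr hM hρ (H := H) fun z _ => hρM z
  have hh := (hsel P hP).mem_heights hρ
  have hi : ∀ Q, HasSubgradientsIn Δ Q →
      Integrable (fun p => boundaryValue r₀ Ω p.1 - Q p) (regionMeasure r₀ H ρ) := fun Q hQ =>
    integrable_boundaryValue_sub hr hΩ ((hQ.mono hΔR).continuousOn hR _) hρ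
      (fun z _ => (hsel P hP z).1.1) hM fun z _ => hρM z
  refine le_of_forall_pos_le_add fun ε hε => ?_
  set κ := (regionMeasure r₀ H ρ).real univ with hκ
  have hκ0 : 0 ≤ κ := measureReal_nonneg
  refine le_of_tendsto (hu.comp hφ.tendsto_atTop) ?_
  -- Upper semicontinuity: with the height `ρ` of the limit as competitor, the energy error is at
  -- most `κ` times the uniform distance, and the conjugate error at most that distance; together
  -- they amount to `ε`.
  have hη : 0 < ε / (κ + 1) := by positivity
  filter_upwards [Metric.tendstoUniformlyOn_iff.1 (hunif _ isCompact_physBox) _ hη] with n hn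
  have hQ := hF (φ n)
  have hQc := (hQ.mono hΔR).continuousOn hR (physBox r₀ H)
  have hdist : ∀ p ∈ physBox r₀ H, |F (φ n) p - P p| ≤ ε / (κ + 1) := fun p hp => by
    have := (hn p hp).le
    rwa [dist_comm, Real.dist_eq] at this
  have h1 := (hsel _ hQ).energy_le hr hΩ hH hQc
    ((hQ.mono hΔR).measurable_maxHeight hr hΩ hH hR).2 hh (hi _ hQ)
  have h2 := abs_energy_sub_le hh (hi _ hQ) (hi _ hP) hdist
  have h3 : ∫ q, conjugate (physBox r₀ H) P q ∂σ ≤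
      ∫ q, (conjugate (physBox r₀ H) (F (φ n)) q + ε / (κ + 1)) ∂σ := by
    refine integral_mono (integrable_conjugate hr hH hΔ hσ hPc)
      ((integrable_conjugate hr hH hΔ hσ hQc).add (integrable_const _)) fun q => ?_
    have := abs_le.1 (abs_conjugate_sub_le isCompact_physBox (physBox_nonempty hr hH) hQc hPc
      hdist q)
    linarith [this.1]
  rw [integral_add (integrable_conjugate hr hH hΔ hσ hQc) (integrable_const _)] at h3
  simp only [integral_const, probReal_univ, one_smul] at h3
  have h4 : ε / (κ + 1) * κ + ε / (κ + 1) = ε := by field_simp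
  have h5 := (abs_le.1 h2).2
  have h6 : (u ∘ φ) n = dualValue r₀ Ω H σ (F (φ n)) := (hFu (φ n)).symm
  rw [h6]
  unfold dualValue
  linarith

end DualValue

/-! ### First variation of the dual functional when `Z` is bounded below. -/

/-- A convex potential with gradients in `Δ` and a monotone selection of optimal heights such that
the gradient transports the region measure to `σ`. -/
structure IsTransportSolution (r₀ Ω H : ℝ) (Δ : Set (ℝ × ℝ)) (σ : Measure (ℝ × ℝ))
    (P : ℝ × ℝ → ℝ) (ρ : ℝ → ℝ) : Prop where
  hasSubgradientsIn : HasSubgradientsIn Δ P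
  monotone : Monotone ρ
  isOptimalSelection : IsOptimalSelection r₀ Ω H P ρ
  map_grad : (regionMeasure r₀ H ρ).map (grad P) = σ

section Variation

variable {r₀ Ω H R δ : ℝ} {Δ : Set (ℝ × ℝ)} {P : ℝ × ℝ → ℝ} {σ : Measure (ℝ × ℝ)}

/-- By strict growth in `z`, every minimizer at `z` lies to the right of the greatest minimizers at
all `y < z`, hence of their left limit, which is `maxHeight` at `z` by continuity. -/
lemma eq_maxHeight_of_continuousAt (hr : 0 < r₀) (hΩ : 0 < Ω) (hH : 0 < H) (hδ : 0 < δ)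
    (hΔ : ∀ q ∈ Δ, δ ≤ q.2) (hS : HasSubgradientsIn Δ P) (hP : ContinuousOn P (physBox r₀ H))
    {z : ℝ} (hz : z ∈ Ioo 0 H) (hc : ContinuousAt (maxHeight r₀ Ω H P) z) {r : ℝ}
    (h : IsOptimalHeight r₀ Ω (fun s => P (s, z)) r) : r = maxHeight r₀ Ω H P z := by
  have hzI : z ∈ Icc 0 H := ⟨hz.1.le, hz.2.le⟩
  have hg := isGreatest_maxHeight hr hΩ hH hP
  apply le_antisymm
  · apply (hg z).2
    simpa only [mem_ofPred_eq, clamp_of_mem hzI] using h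
  · have hleft : Tendsto (maxHeight r₀ Ω H P) (𝓝[<] z) (𝓝 (maxHeight r₀ Ω H P z)) :=
      hc.mono_left nhdsWithin_le_nhds
    refine le_of_tendsto hleft ?_
    filter_upwards [Ioo_mem_nhdsLT hz.1] with y hy
    have hyI : y ∈ Icc 0 H := ⟨hy.1.le, hy.2.le.trans hz.2.le⟩
    refine ((isOptimalSelection_maxHeight hr hΩ hH hP).isOptimalHeight hyI).le_of_ae_lt hr
      (continuousOn_slice hP hyI) (continuousOn_slice hP hzI)
      (Eventually.of_forall fun s _ => ?_) h
    have h1 := hS.add_le hΔ (s := s) hy.2.le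
    have h2 : 0 < δ * (z - y) := mul_pos hδ (sub_pos.2 hy.2)
    linarith

lemma ae_eq_maxHeight (hr : 0 < r₀) (hΩ : 0 < Ω) (hH : 0 < H) (hδ : 0 < δ)
    (hΔ : ∀ q ∈ Δ, δ ≤ q.2) (hS : HasSubgradientsIn Δ P) (hP : ContinuousOn P (physBox r₀ H))
    (hmono : Monotone (maxHeight r₀ Ω H P)) :
    ∀ᵐ z, z ∈ Icc 0 H → ∀ r, IsOptimalHeight r₀ Ω (fun s => P (s, z)) r →
      r = maxHeight r₀ Ω H P z := by
  filter_upwards [hmono.countable_not_continuousAt.ae_notMem volume,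
    measure_eq_zero_iff_ae_notMem.1 (measure_singleton (μ := volume) (0:ℝ)),
    measure_eq_zero_iff_ae_notMem.1 (measure_singleton (μ := volume) H)] with z h1 h2 h3 hz r h
  exact eq_maxHeight_of_continuousAt hr hΩ hH hδ hΔ hS hP
    ⟨lt_of_le_of_ne hz.1 fun h => h2 h.symm, lt_of_le_of_ne hz.2 h3⟩ (not_not.1 h1) h

/-- First variation of the dual functional at a maximizer. -/
lemma integral_grad_le [IsProbabilityMeasure σ] (hr : 0 < r₀) (hΩ : 0 < Ω) (hH : 0 < H)
    (hR : 0 ≤ R) (hδ : 0 < δ) (hΔ : IsCompact Δ) (hne : Δ.Nonempty)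
    (hΔR : Δ ⊆ Icc 0 R ×ˢ Icc 0 R) (hΔδ : ∀ q ∈ Δ, δ ≤ q.2) (hσ : ∀ᵐ q ∂σ, q ∈ Δ)
    (hS : HasSubgradientsIn Δ P)
    (hmax : ∀ P', HasSubgradientsIn Δ P' → dualValue r₀ Ω H σ P' ≤ dualValue r₀ Ω H σ P)
    (φ : BoundedContinuousFunction (ℝ × ℝ) ℝ) :
    ∫ p, φ (grad P p) ∂regionMeasure r₀ H (maxHeight r₀ Ω H P) ≤ ∫ q, φ q ∂σ := by
  have hcont : ∀ Q, HasSubgradientsIn Δ Q → ContinuousOn Q (physBox r₀ H) := fun Q hQ =>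
    (hQ.mono hΔR).continuousOn hR _
  have hmeas : ∀ Q, HasSubgradientsIn Δ Q → Measurable (maxHeight r₀ Ω H Q) := fun Q hQ =>
    ((hQ.mono hΔR).measurable_maxHeight hr hΩ hH hR).2
  have hsel : ∀ Q, HasSubgradientsIn Δ Q → IsOptimalSelection r₀ Ω H Q (maxHeight r₀ Ω H Q) :=
    fun Q hQ => isOptimalSelection_maxHeight hr hΩ hH (hcont Q hQ)
  set ψ := conjugate (physBox r₀ H) P with hψ
  have hψc : Continuous ψ := (lipschitzWith_conjugate_physBox hr hH (hcont P hS)).continuous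
  set ε : ℕ → ℝ := fun n => 1 / ((n : ℝ) + 1) with hε
  have hε0 : ∀ n, 0 < ε n := fun n => by positivity
  have hε1 : ∀ n, ε n ≤ 1 := fun n => by
    rw [hε]; simp only; rw [div_le_one (by positivity)]; linarith [(Nat.cast_nonneg n : (0:ℝ) ≤ n)]
  -- The dual variable is perturbed by `ε φ` and conjugated back over `Δ`, so that the competitors
  -- `F n` keep their subgradients in `Δ`.
  set ψn : ℕ → ℝ × ℝ → ℝ := fun n q => ψ q + ε n * φ q with hψn
  have hψnc : ∀ n, ContinuousOn (ψn n) Δ := fun n =>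
    (hψc.add (continuous_const.mul φ.continuous)).continuousOn
  set F : ℕ → ℝ × ℝ → ℝ := fun n => conjugate Δ (ψn n) with hF
  have hFS : ∀ n, HasSubgradientsIn Δ (F n) := fun n => hasSubgradientsIn_conjugate hΔ hne (hψnc n)
  have hFP : ∀ n, ∀ p ∈ physBox r₀ H, |F n p - P p| ≤ ε n * ‖φ‖ := by
    intro n p hp
    rw [← conjugate_conjugate hr hH hΔ (hcont P hS) hS hp]
    refine abs_conjugate_sub_le hΔ hne (hψnc n) hψc.continuousOn (fun q _ => ?_) p
    rw [hψn]
    simp only [add_sub_cancel_left]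
    rw [abs_mul, abs_of_pos (hε0 n)]
    exact mul_le_mul_of_nonneg_left (φ.norm_coe_le_norm q) (hε0 n).le
  have hεlim : Tendsto ε atTop (𝓝 0) := tendsto_one_div_add_atTop_nhds_zero_nat
  have hlim : ∀ p ∈ physBox r₀ H, Tendsto (fun n => F n p) atTop (𝓝 (P p)) := by
    intro p hp
    rw [tendsto_iff_dist_tendsto_zero]
    refine squeeze_zero (fun _ => dist_nonneg) (fun n => hFP n p hp) ?_
    simpa using hεlim.mul_const ‖φ‖
  obtain ⟨C, hC⟩ := exists_abs_le_of_continuousOn (hcont P hS)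
  have hFC : ∀ n, ∀ p ∈ physBox r₀ H, |F n p| ≤ C + ‖φ‖ := by
    intro n p hp
    have h1 : ε n * ‖φ‖ ≤ ‖φ‖ := mul_le_of_le_one_left (norm_nonneg _) (hε1 n)
    have h2 := abs_sub_abs_le_abs_sub (F n p) (P p)
    linarith [hFP n p hp, hC p hp]
  obtain ⟨M, hM0, hM, hM'⟩ := exists_forall_lt_boundaryValue (Ω := Ω) hr hΩ (C + ‖φ‖)
  have hρnM : ∀ n z, maxHeight r₀ Ω H (F n) z ≤ M := fun n =>
    (hsel _ (hFS n)).le hr hH (hcont _ (hFS n)) (fun p hp => (le_abs_self _).trans (hFC n p hp))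
      hM0 hM'
  have hρM : ∀ z, maxHeight r₀ Ω H P z ≤ M :=
    (hsel _ hS).le hr hH (hcont _ hS) (fun p hp => (le_abs_self _).trans
      ((hC p hp).trans (le_add_of_nonneg_right (norm_nonneg _)))) hM0 hM'
  have hρlim : ∀ᵐ z, z ∈ Icc 0 H → Tendsto (fun n => maxHeight r₀ Ω H (F n) z) atTop
      (𝓝 (maxHeight r₀ Ω H P z)) := by
    filter_upwards [ae_eq_maxHeight hr hΩ hH hδ hΔδ hS (hcont P hS)
      ((hS.mono hΔR).measurable_maxHeight hr hΩ hH hR).1] with z hz hzI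
    -- Every cluster point of the perturbed heights is a minimizer for `P`, and at almost every `z`
    -- there is only one.
    refine (isCompact_Icc (a := (0:ℝ)) (b := M)).tendsto_nhds_of_unique_mapClusterPt
      (Eventually.of_forall fun n => ⟨(hsel _ (hFS n) z).1.1, hρnM n z⟩) fun r _ hcl => ?_
    obtain ⟨θ, hθ, hθr⟩ := hcl.tendsto_subseq
    refine hz hzI r (isOptimalHeight_of_tendsto (F := fun n s => F (θ n) (s, z))
      (C := C + ‖φ‖) (M := M) hr (fun n => continuousOn_slice (hcont _ (hFS _)) hzI)
      (fun n s hs => hFC _ _ ⟨hs, hzI⟩) hM (fun s hs => (hlim (s, z) ⟨hs, hzI⟩).comp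
        hθ.tendsto_atTop) (fun n => (hsel _ (hFS (θ n))).isOptimalHeight hzI)
      (fun n => hρnM _ z) hθr)
  refine le_of_tendsto (tendsto_integral_grad hr hR hM0.le hM (hS.mono hΔR)
    (fun n => (hFS n).mono hΔR) hlim (hmeas _ hS) (fun n => hmeas _ (hFS n)) (fun z _ => hρM z)
    (fun n z _ => hρnM n z) hρlim φ) (Eventually.of_forall fun n => ?_)
  set ρn := maxHeight r₀ Ω H (F n) with hρn
  have hhn : ρn ∈ heights r₀ H := (hsel _ (hFS n)).mem_heights (hmeas _ (hFS n))
  have hfin := isFiniteMeasure_regionMeasure (H := H) hr hM (hmeas _ (hFS n)) fun z _ => hρnM n z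
  have hi : ∀ Q, HasSubgradientsIn Δ Q →
      Integrable (fun p => boundaryValue r₀ Ω p.1 - Q p) (regionMeasure r₀ H ρn) := fun Q hQ =>
    integrable_boundaryValue_sub hr hΩ (hcont Q hQ) (hmeas _ (hFS n))
      (fun z _ => (hsel _ (hFS n) z).1.1) hM fun z _ => hρnM n z
  have h1 := (hsel _ hS).energy_le hr hΩ hH (hcont P hS) (hmeas _ hS) hhn (hi P hS)
  have h2 := hmax (F n) (hFS n)
  unfold dualValue at h2
  have hφi : Integrable (fun q => φ q) σ := φ.integrable σ
  have hψi : Integrable ψ σ := integrable_conjugate hr hH hΔ hσ (hcont P hS)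
  -- Conjugating twice does not increase a function: on `Δ` the conjugate of `F n` is at most `ψn
  -- n`.
  have h3 : ∫ q, conjugate (physBox r₀ H) (F n) q ∂σ ≤ ∫ q, (ψ q + ε n * φ q) ∂σ := by
    refine integral_mono_ae (integrable_conjugate hr hH hΔ hσ (hcont _ (hFS n)))
      (hψi.add (hφi.const_mul _)) ?_
    filter_upwards [hσ] with q hq
    obtain ⟨p, -, h⟩ := exists_conjugate_eq isCompact_physBox (physBox_nonempty hr hH)
      (hcont _ (hFS n)) q
    rw [h, pairing_comm]
    have := le_conjugate hΔ (hψnc n) p hq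
    simp only [hψn, hF] at this ⊢
    linarith
  rw [integral_add hψi (hφi.const_mul _), integral_const_mul] at h3
  have h4 : energy r₀ Ω H (F n) ρn - energy r₀ Ω H P ρn ≤ ε n * ∫ q, φ q ∂σ := by linarith
  unfold energy at h4
  rw [← integral_sub (hi _ (hFS n)) (hi _ hS)] at h4
  -- At `q = grad (F n) p` the perturbed supremum is attained, whereas `P p ≥ ⟨p, q⟩ - ψ q`;
  -- subtracting gives `P - F n ≥ ε φ(∇F n)`. Maximality bounds the integral of `P - F n` by `ε ∫ φ
  -- dσ`.
  have h5 : ∫ p, ε n * φ (grad (F n) p) ∂regionMeasure r₀ H ρn ≤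
      ∫ p, (boundaryValue r₀ Ω p.1 - F n p - (boundaryValue r₀ Ω p.1 - P p))
        ∂regionMeasure r₀ H ρn := by
    have hm : Measurable fun p => φ (grad (F n) p) := φ.continuous.measurable.comp
      (measurable_grad _)
    refine integral_mono_ae ((Integrable.of_bound hm.aestronglyMeasurable ‖φ‖
      (Eventually.of_forall fun p => φ.norm_coe_le_norm _)).const_mul _)
      ((hi _ (hFS n)).sub (hi _ hS)) ?_
    filter_upwards [ae_mem_region hhn, regionMeasure_absolutelyContinuous.ae_le
      (((hFS n).mono hΔR).ae_differentiableAt hR)] with p hp hd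
    obtain ⟨hq, hFq⟩ := conjugate_eq_of_differentiableAt hΔ hne (hψnc n) hd
    have h6 := le_conjugate isCompact_physBox (hcont P hS) (grad (F n) p)
      (physDomain_subset_physBox (region_subset_physDomain hhn hp))
    rw [pairing_comm] at h6
    simp only [hψn] at hFq
    change F n p = _ at hFq
    linarith
  rw [integral_const_mul] at h5
  exact le_of_mul_le_mul_left (h5.trans h4) (hε0 n)

/-- The first variation inequality for both `φ` and `-φ` is an equality of integrals, which
identifies the push-forward. -/
lemma exists_isTransportSolution_of_pos [IsProbabilityMeasure σ] (hr : 0 < r₀) (hΩ : 0 < Ω)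
    (hH : 0 < H) (hR : 0 ≤ R) (hδ : 0 < δ) (hΔ : IsCompact Δ)
    (hΔR : Δ ⊆ Icc 0 R ×ˢ Icc 0 R) (hΔδ : ∀ q ∈ Δ, δ ≤ q.2) (hσ : ∀ᵐ q ∂σ, q ∈ Δ) :
    ∃ P ρ, IsTransportSolution r₀ Ω H Δ σ P ρ := by
  have hne : Δ.Nonempty := hσ.exists
  obtain ⟨P, hS, hmax⟩ := exists_isMaxOn_dualValue hr hΩ hH hR hΔ hne hΔR hσ
  have hP := (hS.mono hΔR).continuousOn hR (physBox r₀ H)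
  obtain ⟨hmono, hmeas⟩ := (hS.mono hΔR).measurable_maxHeight hr hΩ hH hR
  have hsel := isOptimalSelection_maxHeight hr hΩ hH hP
  obtain ⟨M, hM0, hM, hρM⟩ := hsel.exists_le hr hΩ hH hP
  have hfin := isFiniteMeasure_regionMeasure (H := H) hr hM hmeas fun z _ => hρM z
  refine ⟨P, _, hS, hmono, hsel, ?_⟩
  have := Measure.isFiniteMeasure_map (regionMeasure r₀ H (maxHeight r₀ Ω H P)) (grad P)
  refine ext_of_forall_integral_eq_of_IsFiniteMeasure fun φ => ?_
  rw [integral_map (measurable_grad P).aemeasurable φ.continuous.aestronglyMeasurable]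
  refine le_antisymm (integral_grad_le hr hΩ hH hR hδ hΔ hne hΔR hΔδ hσ hS hmax φ) ?_
  have := integral_grad_le hr hΩ hH hR hδ hΔ hne hΔR hΔδ hσ hS hmax (-φ)
  simp only [BoundedContinuousFunction.coe_neg, Pi.neg_apply, integral_neg] at this
  linarith

end Variation

/-! ### Transport solutions for general `σ`, by approximation. -/

section Limit

variable {r₀ Ω H R : ℝ} {Δ : Set (ℝ × ℝ)} {σ : Measure (ℝ × ℝ)}

lemma IsTransportSolution.regionMeasure_univ [IsProbabilityMeasure σ] {P : ℝ × ℝ → ℝ} {ρ : ℝ → ℝ}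
    (h : IsTransportSolution r₀ Ω H Δ σ P ρ) : regionMeasure r₀ H ρ univ = 1 := by
  rw [← measure_univ (μ := σ), ← h.map_grad, Measure.map_apply (measurable_grad P) .univ,
    preimage_univ]

/-- Unit mass and `m > 0` give energy at least `-(P 0 + c)`; compared with the upper bounds of
`exists_energy_le`, this confines `P 0`. The constant does not depend on `σ` or `Δ`, so the
approximating potentials are precompact. -/
lemma exists_abs_zero_le (hr : 0 < r₀) (hΩ : 0 < Ω) (hH : 0 < H) (hR : 0 ≤ R) :
    ∃ C, ∀ (Δ : Set (ℝ × ℝ)) (σ : Measure (ℝ × ℝ)) (P : ℝ × ℝ → ℝ) (ρ : ℝ → ℝ),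
      IsProbabilityMeasure σ → Δ ⊆ Icc 0 R ×ˢ Icc 0 R →
      IsTransportSolution r₀ Ω H Δ σ P ρ → |P 0| ≤ C := by
  obtain ⟨A, hA0, hA⟩ := exists_energy_le (R := R) hr hΩ hH hR
  set c := 2 * R * max (sTop r₀) H with hc
  have hc0 : 0 ≤ c := by
    have := hH.le.trans (le_max_right (sTop r₀) H)
    positivity
  refine ⟨A + 3 * c, fun Δ σ P ρ hσ hΔR h => ?_⟩
  have hS := h.hasSubgradientsIn.mono hΔR
  have hP := hS.continuousOn hR (physBox r₀ H)
  have hρ := h.monotone.measurable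
  obtain ⟨h1, h2⟩ := hA P ρ hS hρ h.isOptimalSelection
  have hh := h.isOptimalSelection.mem_heights hρ
  have hprob : IsProbabilityMeasure (regionMeasure r₀ H ρ) := ⟨h.regionMeasure_univ⟩
  have hi := h.isOptimalSelection.integrable hr hΩ hH hP hρ
  have h3 : ∫ _, -(P 0 + c) ∂regionMeasure r₀ H ρ ≤ energy r₀ Ω H P ρ := by
    refine integral_mono_ae (integrable_const _) hi ?_
    filter_upwards [ae_mem_region hh] with p hp
    have hp := region_subset_physDomain hh hp
    have h4 := abs_le.1 (abs_sub_zero_le hR hS (physDomain_subset_physBox hp))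
    have h5 := boundaryValue_pos hr hΩ hp.1.2
    linarith [h4.2]
  simp only [integral_const, probReal_univ, one_smul] at h3
  rw [abs_le]
  constructor
  · linarith
  · rcases le_total c (P 0) with h | h
    · linarith [h2 h]
    · linarith

/-- Existence of a transport solution for a general measure. -/
lemma exists_isTransportSolution [IsProbabilityMeasure σ] (hr : 0 < r₀) (hΩ : 0 < Ω)
    (hH : 0 < H) (hR : 0 ≤ R) (hΔ : IsCompact Δ)
    (hΔR : Δ ⊆ Icc 0 R ×ˢ Icc 0 R) (hσ : ∀ᵐ q ∂σ, q ∈ Δ) :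
    ∃ P ρ, IsTransportSolution r₀ Ω H Δ σ P ρ := by
  set ε : ℕ → ℝ := fun n => 1 / ((n : ℝ) + 1) with hε
  have hε0 : ∀ n, 0 < ε n := fun n => by positivity
  have hε1 : ∀ n, ε n ≤ 1 := fun n => by
    rw [hε]; simp only; rw [div_le_one (by positivity)]; linarith [(Nat.cast_nonneg n : (0:ℝ) ≤ n)]
  have hεlim : Tendsto ε atTop (𝓝 0) := tendsto_one_div_add_atTop_nhds_zero_nat
  -- The upward shift puts the support in `{Z ≥ ε n}`, where the case already solved applies.
  set T : ℕ → ℝ × ℝ → ℝ × ℝ := fun n q => (q.1, q.2 + ε n) with hT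
  have hTc : ∀ n, Continuous (T n) := fun n => by rw [hT]; fun_prop
  have hTΔ : ∀ n, T n '' Δ ⊆ Icc 0 (R + 1) ×ˢ Icc 0 (R + 1) := by
    rintro n _ ⟨q, hq, rfl⟩
    have h1 := hΔR hq
    exact ⟨⟨h1.1.1, by linarith [h1.1.2]⟩, ⟨by simp only [hT]; linarith [h1.2.1, hε0 n],
      by simp only [hT]; linarith [h1.2.2, hε1 n]⟩⟩
  have hprob : ∀ n, IsProbabilityMeasure (σ.map (T n)) := fun n =>
    Measure.isProbabilityMeasure_map (hTc n).aemeasurable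
  have hex : ∀ n, ∃ P ρ, IsTransportSolution r₀ Ω H (T n '' Δ) (σ.map (T n)) P ρ := by
    intro n
    refine exists_isTransportSolution_of_pos hr hΩ hH (by linarith) (hε0 n)
      (hΔ.image (hTc n)) (hTΔ n) ?_ ?_
    · rintro _ ⟨q, hq, rfl⟩
      have := (hΔR hq).2.1
      simp only [hT]; linarith
    · refine (ae_map_iff (p := fun q => q ∈ T n '' Δ) (hTc n).aemeasurable
        (hΔ.image (hTc n)).measurableSet).2 ?_
      filter_upwards [hσ] with q hq
      exact mem_image_of_mem _ hq
  choose F ρ' hsol using hex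
  have hFS : ∀ n, HasSubgradientsIn (Icc 0 (R + 1) ×ˢ Icc 0 (R + 1)) (F n) := fun n =>
    (hsol n).hasSubgradientsIn.mono (hTΔ n)
  have hR1 : 0 ≤ R + 1 := by linarith
  have hFc : ∀ n, ContinuousOn (F n) (physBox r₀ H) := fun n => (hFS n).continuousOn hR1 _
  obtain ⟨C, hC⟩ := exists_abs_zero_le (r₀ := r₀) (Ω := Ω) (H := H) hr hΩ hH hR1
  have hF0 : ∀ n, |F n 0| ≤ C := fun n => hC _ _ _ _ (hprob n) (hTΔ n) (hsol n)
  obtain ⟨φ, P, hφ, hlim, -⟩ := exists_subseq_tendsto_of_lipschitzWith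
    (fun n => (hFS n).lipschitzWith hR1) hF0
  have hS : HasSubgradientsIn Δ P := by
    refine hasSubgradientsIn_of_tendsto hΔ (η := fun n => ε (φ n)) (hεlim.comp hφ.tendsto_atTop)
      (Δ' := fun n => T (φ n) '' Δ) ?_ (fun n => (hsol (φ n)).hasSubgradientsIn) hlim
    rintro n _ ⟨q, hq, rfl⟩
    refine ⟨q, hq, ?_⟩
    rw [Prod.dist_eq, Real.dist_eq, Real.dist_eq]
    simp [hT, abs_of_pos (hε0 _), (hε0 _).le]
  have hSR := hS.mono hΔR
  have hPc := hSR.continuousOn hR (physBox r₀ H)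
  set B := C + 2 * (R + 1) * max (sTop r₀) H with hB
  have hFB : ∀ n, ∀ p ∈ physBox r₀ H, |F n p| ≤ B := fun n p hp => by
    have := abs_sub_zero_le hR1 (hFS n) hp
    have h2 := abs_sub_abs_le_abs_sub (F n p) (F n 0)
    linarith [hF0 n]
  obtain ⟨M, hM0, hM, hM'⟩ := exists_forall_lt_boundaryValue (Ω := Ω) hr hΩ B
  have hρM : ∀ n z, ρ' n z ≤ M := fun n => (hsol n).isOptimalSelection.le hr hH (hFc n)
    (fun p hp => (le_abs_self _).trans (hFB n p hp)) hM0 hM'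
  obtain ⟨θ, f, ρ, hθ, hf, hρm, hρf, hρlim⟩ := exists_subseq_tendsto_of_monotone
    (ρ := fun n => ρ' (φ n)) (a := 0) (b := M) (fun n => (hsol _).monotone)
    fun n z => ⟨((hsol _).isOptimalSelection z).1.1, hρM _ z⟩
  have hfopt : ∀ q : ℚ, IsOptimalHeight r₀ Ω (fun s => P (s, clamp H q)) (f q) := by
    intro q
    have hq := clamp_mem hH.le (q : ℝ)
    exact isOptimalHeight_of_tendsto (F := fun n s => F (φ (θ n)) (s, clamp H q))
      (C := B) (M := M) hr (fun n => continuousOn_slice (hFc _) hq)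
      (fun n s hs => hFB _ _ ⟨hs, hq⟩) hM (fun s hs => (hlim (s, clamp H q)).comp
        hθ.tendsto_atTop) (fun n => (hsol _).isOptimalSelection q)
      (fun n => hρM _ q) (hf q)
  have hfM : ∀ q, f q ≤ M := fun q => le_of_tendsto' (hf q) fun n => hρM _ _
  obtain ⟨B', hB'⟩ := exists_abs_le_of_continuousOn hPc
  -- Two limits: in `n` at rational heights, then along rationals tending to `z`. Thus `ρ z` is
  -- optimal for every `z`.
  have hopt : IsOptimalSelection r₀ Ω H P ρ := by
    intro z
    obtain ⟨q, hq, hfq⟩ := hρf z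
    refine isOptimalHeight_of_tendsto (F := fun n s => P (s, clamp H (q n)))
      (C := B') (M := M) hr (fun n => continuousOn_slice hPc (clamp_mem hH.le _))
      (fun n s hs => hB' _ ⟨hs, clamp_mem hH.le _⟩) hM (fun s hs => ?_)
      (fun n => hfopt (q n)) (fun n => hfM _) hfq
    have hc : Continuous fun z => P (s, clamp H z) :=
      (hSR.lipschitzWith hR).continuous.comp (continuous_const.prodMk (continuous_clamp H))
    exact (hc.tendsto z).comp hq
  have hρM' : ∀ z, ρ z ≤ M := fun z => by
    obtain ⟨q, -, hfq⟩ := hρf z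
    exact le_of_tendsto' hfq fun n => hfM _
  refine ⟨P, ρ, hS, hρm, hopt, ?_⟩
  have hfin := isFiniteMeasure_regionMeasure (H := H) hr hM hρm.measurable fun z _ => hρM' z
  have := Measure.isFiniteMeasure_map (regionMeasure r₀ H ρ) (grad P)
  refine ext_of_forall_integral_eq_of_IsFiniteMeasure fun g => ?_
  rw [integral_map (measurable_grad P).aemeasurable g.continuous.aestronglyMeasurable]
  have hlim1 := tendsto_integral_grad (H := H) hr hR1 hM0.le hM
    (hSR.mono (prod_mono (Icc_subset_Icc_right (by linarith)) (Icc_subset_Icc_right (by linarith))))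
    (F := fun n => F (φ (θ n))) (fun n => hFS _)
    (fun x _ => (hlim x).comp hθ.tendsto_atTop) (ρn := fun n => ρ' (φ (θ n))) hρm.measurable
    (fun n => (hsol _).monotone.measurable) (fun z _ => hρM' z) (fun n z _ => hρM _ z)
    (by
      filter_upwards [hρm.countable_not_continuousAt.ae_notMem volume] with z hz _
      exact hρlim z (not_not.1 hz)) g
  have heq : ∀ n, ∫ p, g (grad (F (φ (θ n))) p) ∂regionMeasure r₀ H (ρ' (φ (θ n))) =
      ∫ q, g (T (φ (θ n)) q) ∂σ := by
    intro n
    rw [← integral_map (measurable_grad _).aemeasurable g.continuous.aestronglyMeasurable,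
      (hsol _).map_grad, integral_map (hTc _).aemeasurable g.continuous.aestronglyMeasurable]
  simp only [heq] at hlim1
  -- The same integrals also converge to `∫ g dσ`, because the shifts tend to the identity.
  refine tendsto_nhds_unique hlim1 ?_
  refine tendsto_integral_of_dominated_convergence (fun _ => ‖g‖)
    (fun n => (g.continuous.comp (hTc _)).aestronglyMeasurable) (integrable_const _)
    (fun n => Eventually.of_forall fun q => g.norm_coe_le_norm _)
    (Eventually.of_forall fun q => ?_)
  have hTlim : Tendsto (fun n => T (φ (θ n)) q) atTop (𝓝 q) := by
    have h1 := (hεlim.comp (hφ.tendsto_atTop.comp hθ.tendsto_atTop)).const_add q.2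
    rw [add_zero] at h1
    exact (tendsto_const_nhds (x := q.1)).prodMk_nhds h1
  exact (g.continuous.tendsto q).comp hTlim

end Limit

/-! ### Weak duality and its equality cases. -/

/-- The integral `∫ (Υ / (2 r₀²) - Ω √Υ - Ψ) dσ`. -/
def sourceTerm (r₀ Ω : ℝ) (σ : Measure (ℝ × ℝ)) (Ψ : ℝ × ℝ → ℝ) : ℝ :=
  ∫ q, (q.1 / (2 * r₀ ^ 2) - Ω * √q.1 - Ψ q) ∂σ

/-- The duality gap `P(p) + Ψ(q) - ⟨p, q⟩`. -/
def gap (Ψ P : ℝ × ℝ → ℝ) (x : (ℝ × ℝ) × (ℝ × ℝ)) : ℝ := P x.1 + Ψ x.2 - pairing x.1 x.2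

section Duality

variable {r₀ Ω H : ℝ} {σ : Measure (ℝ × ℝ)} {Ψ P : ℝ × ℝ → ℝ} {ρ : ℝ → ℝ}
  {γ : Measure ((ℝ × ℝ) × (ℝ × ℝ))}

lemma closure_physDomain (hr : 0 < r₀) : closure (physDomain r₀ H) = physBox r₀ H := by
  rw [physDomain, closure_prod_eq, closure_Ico (sTop_pos hr).ne, closure_Icc]
  rfl

lemma admissible.isProbabilityMeasure (h : (ρ, γ) ∈ admissible r₀ H σ) :
    IsProbabilityMeasure γ := by
  constructor
  have h1 : γ.map Prod.fst univ = 1 := by rw [h.2.2.1]; exact h.2.1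
  rwa [Measure.map_apply measurable_fst .univ, preimage_univ] at h1

lemma admissible.ae_fst (h : (ρ, γ) ∈ admissible r₀ H σ) {p : ℝ × ℝ → Prop}
    (hp : ∀ᵐ x ∂regionMeasure r₀ H ρ, p x) : ∀ᵐ x ∂γ, p x.1 := by
  refine ae_of_ae_map measurable_fst.aemeasurable ?_
  rwa [h.2.2.1]

lemma admissible.ae_snd (h : (ρ, γ) ∈ admissible r₀ H σ) {p : ℝ × ℝ → Prop}
    (hp : ∀ᵐ x ∂σ, p x) : ∀ᵐ x ∂γ, p x.2 := by
  refine ae_of_ae_map measurable_snd.aemeasurable ?_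
  rwa [h.2.2.2]

lemma admissible.integral_fst (h : (ρ, γ) ∈ admissible r₀ H σ) {f : ℝ × ℝ → ℝ}
    (hf : Integrable f (regionMeasure r₀ H ρ)) :
    Integrable (fun x => f x.1) γ ∧ ∫ x, f x.1 ∂γ = ∫ p, f p ∂regionMeasure r₀ H ρ := by
  rw [← h.2.2.1] at hf ⊢
  exact ⟨hf.comp_measurable measurable_fst,
    (integral_map measurable_fst.aemeasurable hf.aestronglyMeasurable).symm⟩

lemma admissible.integral_snd (h : (ρ, γ) ∈ admissible r₀ H σ) {f : ℝ × ℝ → ℝ}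
    (hf : Integrable f σ) :
    Integrable (fun x => f x.2) γ ∧ ∫ x, f x.2 ∂γ = ∫ q, f q ∂σ := by
  have hs := h.2.2.2
  simp only at hs
  rw [← hs] at hf ⊢
  exact ⟨hf.comp_measurable measurable_snd,
    (integral_map measurable_snd.aemeasurable hf.aestronglyMeasurable).symm⟩

lemma admissible.primal_eq_extIntegral (h : (ρ, γ) ∈ admissible r₀ H σ) :
    primal r₀ H Ω σ ρ γ = extIntegral (cost r₀ Ω) γ := by
  unfold primal
  congr 1
  refine Measure.restrict_eq_self_of_ae_mem ?_
  filter_upwards [admissible.ae_fst h (ae_mem_region h.1),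
    admissible.ae_snd h Measure.support_mem_ae] with x h1 h2
  exact ⟨h1, h2⟩

lemma admissible.integrable_pairing (hσc : IsCompact σ.support)
    (h : (ρ, γ) ∈ admissible r₀ H σ) :
    Integrable (fun x : (ℝ × ℝ) × (ℝ × ℝ) => pairing x.1 x.2) γ := by
  have := admissible.isProbabilityMeasure h
  obtain ⟨C, hC⟩ := ((isCompact_physBox (r₀ := r₀) (H := H)).prod
    hσc).exists_bound_of_continuousOn continuous_pairing.continuousOn
  refine Integrable.of_bound continuous_pairing.aestronglyMeasurable C ?_
  filter_upwards [admissible.ae_fst h (ae_mem_region h.1),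
    admissible.ae_snd h Measure.support_mem_ae] with x h1 h2
  exact hC x ⟨physDomain_subset_physBox (region_subset_physDomain h.1 h1), h2⟩

lemma integrable_source [IsFiniteMeasure σ] (hσc : IsCompact σ.support)
    (hΨ : ContinuousOn Ψ σ.support) :
    Integrable (fun q : ℝ × ℝ => q.1 / (2 * r₀ ^ 2) - Ω * √q.1 - Ψ q) σ :=
  integrable_of_continuous_of_compact hσc Measure.support_mem_ae
    ((by fun_prop : Continuous fun q : ℝ × ℝ => q.1 / (2 * r₀ ^ 2) - Ω * √q.1).continuousOn.sub hΨ)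

/-- Pairing and source term are bounded on the relevant compact sets, so only `m` can make the cost
non-integrable, hence the primal value infinite. -/
lemma admissible.integrable_cost_iff [IsProbabilityMeasure σ] (hσc : IsCompact σ.support)
    (h : (ρ, γ) ∈ admissible r₀ H σ) :
    Integrable (cost r₀ Ω) γ ↔
      Integrable (fun p : ℝ × ℝ => boundaryValue r₀ Ω p.1) (regionMeasure r₀ H ρ) := by
  have hs := (admissible.integral_snd h (integrable_source (r₀ := r₀) (Ω := Ω) (Ψ := fun _ => 0)
    hσc continuousOn_const)).1
  have hp := admissible.integrable_pairing hσc h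
  constructor
  · intro hc
    have h1 : Integrable ((fun p : ℝ × ℝ => boundaryValue r₀ Ω p.1) ∘ Prod.fst) γ := by
      refine ((hc.add hp).sub hs).congr (Eventually.of_forall fun x => ?_)
      simp only [Pi.add_apply, Pi.sub_apply, cost, Function.comp_apply]; ring
    have hmeas : Measurable fun p : ℝ × ℝ => boundaryValue r₀ Ω p.1 :=
      (measurable_boundaryValue r₀ Ω).comp measurable_fst
    rw [← integrable_map_measure hmeas.aestronglyMeasurable measurable_fst.aemeasurable] at h1
    rwa [h.2.2.1] at h1
  · intro hm
    have h1 := (admissible.integral_fst h hm).1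
    refine ((h1.sub hp).add hs).congr (Eventually.of_forall fun x => ?_)
    simp only [Pi.add_apply, Pi.sub_apply, cost]; ring

lemma admissible.primal_eq_top [IsProbabilityMeasure σ] (hσc : IsCompact σ.support)
    (h : (ρ, γ) ∈ admissible r₀ H σ)
    (hm : ¬ Integrable (fun p : ℝ × ℝ => boundaryValue r₀ Ω p.1) (regionMeasure r₀ H ρ)) :
    primal r₀ H Ω σ ρ γ = ⊤ := by
  rw [admissible.primal_eq_extIntegral h, extIntegral,
    if_neg ((admissible.integrable_cost_iff hσc h).not.2 hm)]

lemma admissible.integrable_gap [IsProbabilityMeasure σ] (hσc : IsCompact σ.support)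
    (h : (ρ, γ) ∈ admissible r₀ H σ) (hΨ : ContinuousOn Ψ σ.support)
    (hP : ContinuousOn P (physBox r₀ H)) : Integrable (gap Ψ P) γ := by
  have : IsProbabilityMeasure (regionMeasure r₀ H ρ) := ⟨h.2.1⟩
  exact ((admissible.integral_fst h (integrable_of_continuousOn h.1 hP)).1.add
    (admissible.integral_snd h (integrable_of_continuous_of_compact hσc Measure.support_mem_ae
      hΨ)).1).sub (admissible.integrable_pairing hσc h)

lemma admissible.integrable_boundaryValue_sub (h : (ρ, γ) ∈ admissible r₀ H σ)
    (hP : ContinuousOn P (physBox r₀ H))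
    (hm : Integrable (fun p : ℝ × ℝ => boundaryValue r₀ Ω p.1) (regionMeasure r₀ H ρ)) :
    Integrable (fun p => boundaryValue r₀ Ω p.1 - P p) (regionMeasure r₀ H ρ) := by
  have : IsProbabilityMeasure (regionMeasure r₀ H ρ) := ⟨h.2.1⟩
  exact hm.sub (integrable_of_continuousOn h.1 hP)

/-- The primal functional is the sum of the duality gap and of the terms of the dual functional. -/
lemma admissible.primal_eq [IsProbabilityMeasure σ] (hσc : IsCompact σ.support)
    (h : (ρ, γ) ∈ admissible r₀ H σ) (hΨ : ContinuousOn Ψ σ.support)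
    (hP : ContinuousOn P (physBox r₀ H))
    (hm : Integrable (fun p : ℝ × ℝ => boundaryValue r₀ Ω p.1) (regionMeasure r₀ H ρ)) :
    primal r₀ H Ω σ ρ γ =
      ((∫ x, gap Ψ P x ∂γ + sourceTerm r₀ Ω σ Ψ + energy r₀ Ω H P ρ : ℝ) : EReal) := by
  rw [admissible.primal_eq_extIntegral h, extIntegral,
    if_pos ((admissible.integrable_cost_iff hσc h).2 hm)]
  congr 1
  have hg := admissible.integrable_gap hσc h hΨ hP
  obtain ⟨h1, h2⟩ := admissible.integral_snd h (integrable_source (r₀ := r₀) (Ω := Ω) hσc hΨ)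
  obtain ⟨h3, h4⟩ := admissible.integral_fst h (admissible.integrable_boundaryValue_sub h hP hm)
  unfold sourceTerm energy
  have hsum : ∫ x, (gap Ψ P x + (x.2.1 / (2 * r₀ ^ 2) - Ω * √x.2.1 - Ψ x.2) +
      (boundaryValue r₀ Ω x.1.1 - P x.1)) ∂γ = _ := integral_add (hg.add h1) h3
  rw [← h2, ← h4, ← integral_add hg h1, ← hsum]
  congr 1; ext x
  simp only [cost, gap]; ring

lemma dualHeight_le (hh : ρ ∈ heights r₀ H)
    (hi : Integrable (fun p => boundaryValue r₀ Ω p.1 - P p) (regionMeasure r₀ H ρ)) :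
    dualHeight r₀ H Ω P ≤ (energy r₀ Ω H P ρ : EReal) := by
  obtain ⟨h1, h2⟩ := energy_eq hh hi
  refine (iInf₂_le ρ hh).trans ?_
  rw [extIntegral, if_pos h1, h2]

lemma IsOptimalSelection.dualHeight_eq (hr : 0 < r₀) (hΩ : 0 < Ω) (hH : 0 < H)
    (hP : ContinuousOn P (physBox r₀ H)) (h : IsOptimalSelection r₀ Ω H P ρ) (hρ : Measurable ρ) :
    dualHeight r₀ H Ω P = (energy r₀ Ω H P ρ : EReal) := by
  have hh := h.mem_heights hρ
  have hi := h.integrable hr hΩ hH hP hρ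
  refine le_antisymm (dualHeight_le hh hi) (le_iInf₂ fun ρ' hρ' => ?_)
  obtain ⟨h1, h2⟩ := energy_eq hh hi
  unfold extIntegral
  split_ifs with h3
  · rw [h2, EReal.coe_le_coe_iff]
    refine setIntegral_mono_on h1 h3 measurableSet_Icc fun z hz => ?_
    exact (h.isOptimalHeight hz).2 _ (hρ'.2 z hz)
  · exact le_top

lemma ae_gap_nonneg (hσ : σ.support ⊆ quadrant) (hU : (Ψ, P) ∈ dualPairs r₀ H)
    (h : (ρ, γ) ∈ admissible r₀ H σ) : 0 ≤ᵐ[γ] gap Ψ P := by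
  filter_upwards [admissible.ae_fst h (ae_mem_region h.1),
    admissible.ae_snd h Measure.support_mem_ae] with x h1 h2
  have := hU.2.2 x.1 (region_subset_physDomain h.1 h1) x.2 (hσ h2)
  exact sub_nonneg.2 this

/-- In the decomposition of the primal value the gap is nonnegative, and `ρ` competes in the infimum
defining the dual. If `m` is not integrable, the primal value is `⊤`. -/
lemma dual_le_primal [IsProbabilityMeasure σ] (hr : 0 < r₀) (hσc : IsCompact σ.support)
    (hσ : σ.support ⊆ quadrant) (hU : (Ψ, P) ∈ dualPairs r₀ H)
    (h : (ρ, γ) ∈ admissible r₀ H σ) :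
    dual r₀ H Ω σ Ψ P ≤ primal r₀ H Ω σ ρ γ := by
  by_cases hm : Integrable (fun p : ℝ × ℝ => boundaryValue r₀ Ω p.1) (regionMeasure r₀ H ρ)
  · have hP : ContinuousOn P (physBox r₀ H) := by rw [← closure_physDomain hr]; exact hU.2.1
    rw [admissible.primal_eq hσc h (hU.1.mono hσ) hP hm]
    have h1 := dualHeight_le h.1 (admissible.integrable_boundaryValue_sub h hP hm)
    refine (add_le_add_right h1 _).trans ?_
    rw [← EReal.coe_add, EReal.coe_le_coe_iff]
    have := integral_nonneg_of_ae (ae_gap_nonneg hσ hU h)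
    unfold sourceTerm
    linarith
  · rw [admissible.primal_eq_top hσc h hm]
    exact le_top

/-- The difference of the one-dimensional potentials is nonnegative with integral at most zero, so
it vanishes almost everywhere. -/
lemma ae_isOptimalHeight_of_energy_le (hr : 0 < r₀) (hΩ : 0 < Ω) (hH : 0 < H)
    (hP : ContinuousOn P (physBox r₀ H)) {ρ' : ℝ → ℝ} (h : IsOptimalSelection r₀ Ω H P ρ)
    (hρ : Measurable ρ) (hh : ρ' ∈ heights r₀ H)
    (hi : Integrable (fun p => boundaryValue r₀ Ω p.1 - P p) (regionMeasure r₀ H ρ'))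
    (hle : energy r₀ Ω H P ρ' ≤ energy r₀ Ω H P ρ) :
    ∀ᵐ z, z ∈ Icc 0 H → IsOptimalHeight r₀ Ω (fun s => P (s, z)) (ρ' z) := by
  obtain ⟨h1, h2⟩ := energy_eq (h.mem_heights hρ) (h.integrable hr hΩ hH hP hρ)
  obtain ⟨h3, h4⟩ := energy_eq hh hi
  rw [h2, h4, ← sub_nonpos, ← integral_sub h3 h1] at hle
  have hnn : 0 ≤ᵐ[volume.restrict (Icc 0 H)] fun z =>
      heightPotential r₀ Ω P (ρ' z) z - heightPotential r₀ Ω P (ρ z) z := by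
    rw [EventuallyLE, ae_restrict_iff' measurableSet_Icc]
    exact Eventually.of_forall fun z hz =>
      sub_nonneg.2 ((h.isOptimalHeight hz).2 _ (hh.2 z hz))
  have h0 := (integral_eq_zero_iff_of_nonneg_ae hnn (h3.sub h1)).1
    (le_antisymm hle (integral_nonneg_of_ae hnn))
  rw [EventuallyEq, ae_restrict_iff' measurableSet_Icc] at h0
  filter_upwards [h0] with z hz hzI
  refine ⟨hh.2 z hzI, fun y hy => ?_⟩
  have h5 : profile r₀ Ω (fun s => P (s, z)) (ρ' z) - profile r₀ Ω (fun s => P (s, z)) (ρ z) = 0 :=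
    hz hzI
  linarith [(h.isOptimalHeight hzI).2 y hy]

end Duality

/-! ### Strong duality and optimality of transport solutions. -/

section Solution

variable {r₀ Ω H R : ℝ} {σ : Measure (ℝ × ℝ)} {P : ℝ × ℝ → ℝ} {ρ : ℝ → ℝ}

/-- The optimal plan of a transport solution. -/
def gradPlan (r₀ H : ℝ) (P : ℝ × ℝ → ℝ) (ρ : ℝ → ℝ) : Measure ((ℝ × ℝ) × (ℝ × ℝ)) :=
  (regionMeasure r₀ H ρ).map fun p => (p, grad P p)

lemma measurable_graph_grad (P : ℝ × ℝ → ℝ) : Measurable fun p => (p, grad P p) :=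
  measurable_id.prodMk (measurable_grad P)

lemma pairing_le_add_conjugate (hP : ContinuousOn P (physBox r₀ H)) {p : ℝ × ℝ}
    (hp : p ∈ physBox r₀ H) (q : ℝ × ℝ) :
    pairing p q ≤ P p + conjugate (physBox r₀ H) P q := by
  have := le_conjugate isCompact_physBox hP q hp
  rw [pairing_comm] at this
  linarith

/-- Equality case of Fenchel–Young. -/
lemma gap_eq_zero_of_subgradient (hr : 0 < r₀) (hH : 0 < H) (hP : ContinuousOn P (physBox r₀ H))
    {p q : ℝ × ℝ} (hp : p ∈ physBox r₀ H) (h : ∀ p', P p + (pairing p' q - pairing p q) ≤ P p') :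
    gap (conjugate (physBox r₀ H) P) P (p, q) = 0 := by
  obtain ⟨p', -, h'⟩ := exists_conjugate_eq isCompact_physBox (physBox_nonempty hr hH) hP q
  have h1 := pairing_le_add_conjugate hP hp q
  have h2 := h p'
  rw [pairing_comm] at h'
  simp only [gap]
  linarith

lemma IsTransportSolution.mem_admissible [IsProbabilityMeasure σ] {Δ : Set (ℝ × ℝ)}
    (h : IsTransportSolution r₀ Ω H Δ σ P ρ) : (ρ, gradPlan r₀ H P ρ) ∈ admissible r₀ H σ := by
  refine ⟨h.isOptimalSelection.mem_heights h.monotone.measurable, h.regionMeasure_univ, ?_, ?_⟩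
  · simp only [gradPlan]
    rw [Measure.map_map measurable_fst (measurable_graph_grad P)]
    exact Measure.map_id
  · simp only [gradPlan]
    rw [Measure.map_map measurable_snd (measurable_graph_grad P)]
    exact h.map_grad

lemma gradPlan_ae {p : (ℝ × ℝ) × (ℝ × ℝ) → Prop}
    (hm : MeasurableSet {x | p x}) (h : ∀ᵐ x ∂regionMeasure r₀ H ρ, p (x, grad P x)) :
    ∀ᵐ x ∂gradPlan r₀ H P ρ, p x :=
  (ae_map_iff (measurable_graph_grad P).aemeasurable hm).2 h

lemma continuous_conjugate_physBox (hr : 0 < r₀) (hH : 0 < H)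
    (hP : ContinuousOn P (physBox r₀ H)) : Continuous (conjugate (physBox r₀ H) P) :=
  (lipschitzWith_conjugate_physBox hr hH hP).continuous

lemma IsTransportSolution.integral_gap (hr : 0 < r₀) (hH : 0 < H)
    (hR : 0 ≤ R) {Δ : Set (ℝ × ℝ)} (hΔR : Δ ⊆ Icc 0 R ×ˢ Icc 0 R)
    (h : IsTransportSolution r₀ Ω H Δ σ P ρ) :
    ∫ x, gap (conjugate (physBox r₀ H) P) P x ∂gradPlan r₀ H P ρ = 0 := by
  have hS := h.hasSubgradientsIn.mono hΔR
  have hPc := (hS.lipschitzWith hR).continuous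
  have hgc : Continuous (gap (conjugate (physBox r₀ H) P) P) := by
    have := continuous_conjugate_physBox hr hH hPc.continuousOn
    unfold gap; fun_prop
  refine integral_eq_zero_of_ae ?_
  refine gradPlan_ae (p := fun x => gap (conjugate (physBox r₀ H) P) P x = 0)
    (measurableSet_eq_fun hgc.measurable measurable_const) ?_
  have hh := h.isOptimalSelection.mem_heights h.monotone.measurable
  filter_upwards [ae_mem_region hh, regionMeasure_absolutelyContinuous.ae_le
    (hS.ae_differentiableAt hR)] with p hp hd
  exact gap_eq_zero_of_subgradient hr hH hPc.continuousOn
    (physDomain_subset_physBox (region_subset_physDomain hh hp)) (hS.grad_spec hd).2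

lemma mem_dualPairs (hr : 0 < r₀) (hH : 0 < H) (hP : ContinuousOn P (physBox r₀ H)) :
    (conjugate (physBox r₀ H) P, P) ∈ dualPairs r₀ H := by
  refine ⟨(continuous_conjugate_physBox hr hH hP).continuousOn, ?_, fun p hp q _ =>
    pairing_le_add_conjugate hP (physDomain_subset_physBox hp) q⟩
  rwa [closure_physDomain hr]

lemma mem_legendrePairs (hr : 0 < r₀) (hH : 0 < H) {Δ : Set (ℝ × ℝ)} (hΔ : IsCompact Δ)
    (hne : Δ.Nonempty) (hP : Continuous P) (hS : HasSubgradientsIn Δ P) :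
    (conjugate (physBox r₀ H) P, P) ∈ legendrePairs r₀ H Δ := by
  refine ⟨mem_dualPairs hr hH hP.continuousOn, fun p hp => ?_, fun q _ => ?_⟩
  · simp only
    rw [← conjugate_conjugate hr hH hΔ hP.continuousOn hS (physDomain_subset_physBox hp)]
    exact (isGreatest_conjugate hΔ hne
      (continuous_conjugate_physBox hr hH hP.continuousOn).continuousOn p).isLUB
  · have h1 := (isGreatest_conjugate isCompact_physBox (physBox_nonempty hr hH)
      hP.continuousOn q).isLUB
    simp only [pairing_comm q] at h1
    refine ⟨fun _ hx => h1.1 (image_mono physDomain_subset_physBox hx), fun b hb => h1.2 ?_⟩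
    rintro _ ⟨p, hp, rfl⟩
    -- The Legendre condition takes the supremum over `𝒟`, the conjugate over its closure;
    -- continuity makes them equal.
    rw [← closure_physDomain hr] at hp
    have hcl : IsClosed {p | pairing p q - P p ≤ b} :=
      isClosed_le ((continuous_pairing_left q).sub hP) continuous_const
    exact closure_minimal (fun p hp => hb ⟨p, hp, rfl⟩) hcl hp

/-- Strong duality for transport solutions. -/
lemma IsTransportSolution.primal_eq_dual [IsProbabilityMeasure σ] (hr : 0 < r₀) (hΩ : 0 < Ω)
    (hH : 0 < H) (hR : 0 ≤ R) (hσc : IsCompact σ.support)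
    (hσR : σ.support ⊆ Icc 0 R ×ˢ Icc 0 R) (h : IsTransportSolution r₀ Ω H σ.support σ P ρ) :
    primal r₀ H Ω σ ρ (gradPlan r₀ H P ρ) = ((sourceTerm r₀ Ω σ (conjugate (physBox r₀ H) P) +
        energy r₀ Ω H P ρ : ℝ) : EReal) ∧
      dual r₀ H Ω σ (conjugate (physBox r₀ H) P) P =
        ((sourceTerm r₀ Ω σ (conjugate (physBox r₀ H) P) + energy r₀ Ω H P ρ : ℝ) : EReal) := by
  have hP := (h.hasSubgradientsIn.mono hσR).continuousOn hR (physBox r₀ H)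
  have hρ := h.monotone.measurable
  obtain ⟨M, -, hM, hρM⟩ := h.isOptimalSelection.exists_le hr hΩ hH hP
  have := isFiniteMeasure_regionMeasure (H := H) hr hM hρ fun z _ => hρM z
  have hm := integrable_boundaryValue hr hΩ (h.isOptimalSelection.mem_heights hρ) hM
    fun z _ => hρM z
  constructor
  · rw [admissible.primal_eq hσc h.mem_admissible
      (continuous_conjugate_physBox hr hH hP).continuousOn hP hm,
      h.integral_gap hr hH hR hσR, zero_add]
  · unfold dual
    rw [h.isOptimalSelection.dualHeight_eq hr hΩ hH hP hρ, ← EReal.coe_add]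
    rfl

lemma box_subset_quadrant : Icc 0 R ×ˢ Icc 0 R ⊆ quadrant :=
  prod_mono Icc_subset_Ici_self Icc_subset_Ici_self

lemma IsTransportSolution.isDualMaximizer [IsProbabilityMeasure σ] (hr : 0 < r₀) (hΩ : 0 < Ω)
    (hH : 0 < H) (hR : 0 ≤ R) (hσc : IsCompact σ.support)
    (hσR : σ.support ⊆ Icc 0 R ×ˢ Icc 0 R) (h : IsTransportSolution r₀ Ω H σ.support σ P ρ) :
    IsDualMaximizer r₀ H Ω σ (conjugate (physBox r₀ H) P) P := by
  have hS := h.hasSubgradientsIn.mono hσR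
  obtain ⟨h1, h2⟩ := h.primal_eq_dual hr hΩ hH hR hσc hσR
  have hne : σ.support.Nonempty := Measure.nonempty_support (NeZero.ne σ)
  refine ⟨mem_legendrePairs hr hH hσc hne (hS.lipschitzWith hR).continuous h.hasSubgradientsIn,
    fun Ψ' P' hU => ?_⟩
  rw [h2, ← h1]
  exact dual_le_primal hr hσc (hσR.trans box_subset_quadrant) hU h.mem_admissible

lemma IsTransportSolution.isPrimalMinimizer [IsProbabilityMeasure σ] (hr : 0 < r₀) (hΩ : 0 < Ω)
    (hH : 0 < H) (hR : 0 ≤ R) (hσc : IsCompact σ.support)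
    (hσR : σ.support ⊆ Icc 0 R ×ˢ Icc 0 R) (h : IsTransportSolution r₀ Ω H σ.support σ P ρ) :
    IsPrimalMinimizer r₀ H Ω σ ρ (gradPlan r₀ H P ρ) := by
  obtain ⟨h1, h2⟩ := h.primal_eq_dual hr hΩ hH hR hσc hσR
  refine ⟨h.mem_admissible, fun ρ' γ' hadm => ?_⟩
  rw [h1, ← h2]
  exact dual_le_primal hr hσc (hσR.trans box_subset_quadrant)
    (mem_dualPairs hr hH ((h.hasSubgradientsIn.mono hσR).continuousOn hR _)) hadm

end Solution

/-! ### Uniqueness of the dual maximizer. -/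

lemma eq_of_abs_sub_le {h G : ℝ → ℝ}
    (hG : ∀ t t', 0 ≤ t → t ≤ t' → t' ≤ 1 → |h t' - h t| ≤ (t' - t) * (G t' - G t)) :
    h 1 = h 0 := by
  -- On a partition into `N + 1` equal intervals the bounds telescope in `G`, leaving the factor `1
  -- / (N + 1)`; neither function need be regular.
  have key : ∀ N : ℕ, |h 1 - h 0| ≤ (G 1 - G 0) * (1 / ((N : ℝ) + 1)) := by
    intro N
    have hN : (0 : ℝ) < N + 1 := by positivity
    have e1 : h 1 - h 0 = ∑ i ∈ Finset.range (N + 1),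
        (h ((i + 1 : ℕ) / (N + 1)) - h ((i : ℕ) / (N + 1))) := by
      rw [Finset.sum_range_sub (fun i : ℕ => h (i / (N + 1)))]
      push_cast
      rw [div_self hN.ne', zero_div]
    have e2 : G 1 - G 0 = ∑ i ∈ Finset.range (N + 1),
        (G ((i + 1 : ℕ) / (N + 1)) - G ((i : ℕ) / (N + 1))) := by
      rw [Finset.sum_range_sub (fun i : ℕ => G (i / (N + 1)))]
      push_cast
      rw [div_self hN.ne', zero_div]
    rw [e1, e2, Finset.sum_mul]
    refine (Finset.abs_sum_le_sum_abs _ _).trans (Finset.sum_le_sum fun i hi => ?_)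
    have hi' : ((i + 1 : ℕ) : ℝ) ≤ N + 1 := by
      exact_mod_cast Finset.mem_range.1 hi
    have h1 := hG (i / (N + 1)) ((i + 1 : ℕ) / (N + 1)) (by positivity)
      (by gcongr; simp) ((div_le_one hN).2 hi')
    refine h1.trans (le_of_eq ?_)
    push_cast
    field_simp
    ring
  have hlim : Tendsto (fun N : ℕ => (G 1 - G 0) * (1 / ((N : ℝ) + 1))) atTop (𝓝 0) := by
    simpa using tendsto_one_div_add_atTop_nhds_zero_nat.const_mul (G 1 - G 0)
  have := ge_of_tendsto' hlim key
  exact sub_eq_zero.1 (abs_eq_zero.1 (le_antisymm this (abs_nonneg _)))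

/-- `P` and `Q` have a common subgradient in `Δ` at `p`. -/
def HasCommonSubgradient (Δ : Set (ℝ × ℝ)) (P Q : ℝ × ℝ → ℝ) (p : ℝ × ℝ) : Prop :=
  ∃ q ∈ Δ, ∀ p', P p + (pairing p' q - pairing p q) ≤ P p' ∧
    Q p + (pairing p' q - pairing p q) ≤ Q p'

section Uniqueness

variable {r₀ Ω H R : ℝ} {Δ : Set (ℝ × ℝ)} {σ : Measure (ℝ × ℝ)} {P Q : ℝ × ℝ → ℝ} {ρ : ℝ → ℝ}

/-- Compactness of `Δ` preserves common subgradients in the limit. Equality of gradients almost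
everywhere thereby extends to closed boxes. -/
lemma isClosed_hasCommonSubgradient (hΔ : IsCompact Δ) (hP : Continuous P) (hQ : Continuous Q) :
    IsClosed {p | HasCommonSubgradient Δ P Q p} := by
  refine IsSeqClosed.isClosed fun x p hx hxp => ?_
  choose q hq hq' using hx
  obtain ⟨r, hr, φ, hφ, hφr⟩ := hΔ.tendsto_subseq hq
  have hxφ := hxp.comp hφ.tendsto_atTop
  have h1 : ∀ p', Tendsto (fun n => pairing p' (q (φ n)) - pairing (x (φ n)) (q (φ n))) atTop
      (𝓝 (pairing p' r - pairing p r)) := fun p' =>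
    (((continuous_pairing_right p').tendsto r).comp hφr).sub
      ((continuous_pairing.tendsto (p, r)).comp (hxφ.prodMk_nhds hφr))
  refine ⟨r, hr, fun p' => ⟨?_, ?_⟩⟩
  · exact le_of_tendsto' (((hP.tendsto p).comp hxφ).add (h1 p')) fun n => (hq' (φ n) p').1
  · exact le_of_tendsto' (((hQ.tendsto p).comp hxφ).add (h1 p')) fun n => (hq' (φ n) p').2

/-- Along a segment, the increments of `P` and of `Q` from `t` to `t'` both lie between `(t' - t)
G(t)` and `(t' - t) G(t')`, where `G` is the component of the common subgradient along the segment.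
-/
lemma sub_eq_sub_of_convex {B : Set (ℝ × ℝ)} (hB : Convex ℝ B)
    (h : ∀ p ∈ B, HasCommonSubgradient Δ P Q p) {p p' : ℝ × ℝ} (hp : p ∈ B) (hp' : p' ∈ B) :
    P p' - Q p' = P p - Q p := by
  have hc : ∀ t : ℝ, t ∈ Icc (0:ℝ) 1 → HasCommonSubgradient Δ P Q (p + t • (p' - p)) :=
    fun t ht => h _ (hB.add_smul_sub_mem hp hp' ht)
  choose! q hq hq' using hc
  have := eq_of_abs_sub_le (h := fun t => P (p + t • (p' - p)) - Q (p + t • (p' - p)))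
    (G := fun t => pairing (p' - p) (q t)) fun t t' h0 htt' h1 => by
      have a1 := hq' t ⟨h0, htt'.trans h1⟩ (p + t' • (p' - p))
      have a2 := hq' t' ⟨h0.trans htt', h1⟩ (p + t • (p' - p))
      have e : ∀ q, pairing (p + t' • (p' - p)) q - pairing (p + t • (p' - p)) q =
          (t' - t) * pairing (p' - p) q := fun q => by
        simp only [pairing, Prod.fst_add, Prod.snd_add, Prod.smul_fst, Prod.smul_snd, smul_eq_mul]
        ring
      have e1 := e (q t)
      have e2 := e (q t')
      rw [abs_le, mul_sub]
      constructor <;> linarith [a1.1, a1.2, a2.1, a2.2]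
  simpa using this

lemma ae_volume_of_ae_regionMeasure (hr : 0 < r₀) (hh : ρ ∈ heights r₀ H) {p : ℝ × ℝ → Prop}
    (h : ∀ᵐ x ∂regionMeasure r₀ H ρ, p x) : ∀ᵐ x, x ∈ region H ρ → p x := by
  unfold regionMeasure at h
  rw [ae_withDensity_iff (by fun_prop),
    ae_restrict_iff' (measurableSet_region_of_mem_heights hh)] at h
  filter_upwards [h] with x hx hxr
  refine hx hxr ?_
  rw [Ne, ENNReal.ofReal_eq_zero, not_le]
  exact density_pos hr (region_subset_physDomain hh hxr).1.2

/-- Since `ρ` is monotone, the box lies in the region; points with a common subgradient are dense in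
it and form a closed set. -/
lemma hasCommonSubgradient_of_mem_box (hr : 0 < r₀) (hΔ : IsCompact Δ) (hP : Continuous P)
    (hQ : Continuous Q) (hh : ρ ∈ heights r₀ H) (hρ : Monotone ρ)
    (h : ∀ᵐ p ∂regionMeasure r₀ H ρ, HasCommonSubgradient Δ P Q p) {z₀ : ℝ} (hz0 : 0 ≤ z₀)
    (hzH : z₀ < H) (hpos : 0 < ρ z₀) {p : ℝ × ℝ} (hp : p ∈ Icc 0 (ρ z₀) ×ˢ Icc z₀ H) :
    HasCommonSubgradient Δ P Q p := by
  have hdense := Measure.dense_of_ae (ae_volume_of_ae_regionMeasure hr hh h)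
  have hopen : IsOpen (Ioo 0 (ρ z₀) ×ˢ Ioo z₀ H : Set (ℝ × ℝ)) := isOpen_Ioo.prod isOpen_Ioo
  have h1 := hdense.open_subset_closure_inter hopen
  have h2 : Icc 0 (ρ z₀) ×ˢ Icc z₀ H ⊆ closure (Ioo 0 (ρ z₀) ×ˢ Ioo z₀ H : Set (ℝ × ℝ)) := by
    rw [closure_prod_eq, closure_Ioo hpos.ne, closure_Ioo hzH.ne]
  have h3 := closure_minimal h1 isClosed_closure (h2 hp)
  refine closure_minimal ?_ (isClosed_hasCommonSubgradient hΔ hP hQ) h3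
  rintro x ⟨hx, hx'⟩
  exact hx' ⟨⟨hz0.trans hx.2.1.le, hx.2.2.le⟩, hx.1.1.le, hx.1.2.le.trans (hρ hx.2.1.le)⟩

/-- Two potentials with the same gradient on `D_ρ` that both satisfy the optimality condition
coincide on `D_ρ`. -/
lemma ae_eq_of_ae_hasCommonSubgradient (hr : 0 < r₀) (hΔ : IsCompact Δ)
    (hP : Continuous P) (hQ : Continuous Q) (hh : ρ ∈ heights r₀ H) (hρ : Monotone ρ)
    (hmass : regionMeasure r₀ H ρ univ = 1)
    (h : ∀ᵐ p ∂regionMeasure r₀ H ρ, HasCommonSubgradient Δ P Q p)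
    (hoP : ∀ᵐ z, z ∈ Icc 0 H → IsOptimalHeight r₀ Ω (fun s => P (s, z)) (ρ z))
    (hoQ : ∀ᵐ z, z ∈ Icc 0 H → IsOptimalHeight r₀ Ω (fun s => Q (s, z)) (ρ z)) :
    ∀ᵐ p ∂regionMeasure r₀ H ρ, P p = Q p := by
  -- Every such box contains `(0, H)`, so `P - Q` takes the same constant value on all of them.
  have hbox : ∀ z₀, 0 ≤ z₀ → z₀ < H → 0 < ρ z₀ → ∀ p ∈ Icc 0 (ρ z₀) ×ˢ Icc z₀ H,
      P p - Q p = P (0, H) - Q (0, H) := by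
    intro z₀ hz0 hzH hpos p hp
    exact sub_eq_sub_of_convex ((convex_Icc 0 (ρ z₀)).prod (convex_Icc z₀ H))
      (fun p hp => hasCommonSubgradient_of_mem_box hr hΔ hP hQ hh hρ h hz0 hzH hpos hp)
      ⟨⟨le_rfl, hpos.le⟩, ⟨hzH.le, le_rfl⟩⟩ hp
  have hprob : IsProbabilityMeasure (regionMeasure r₀ H ρ) := ⟨hmass⟩
  have hac := regionMeasure_absolutelyContinuous (r₀ := r₀) (H := H) (ρ := ρ)
  have hsnd : ∀ {p : ℝ → Prop}, (∀ᵐ z, p z) → ∀ᵐ x ∂regionMeasure r₀ H ρ, p x.2 := fun hp =>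
    hac.ae_le (Measure.quasiMeasurePreserving_snd.ae hp)
  -- The region has positive mass, so some `z` has `ρ z > 0` with `ρ z` optimal for both potentials;
  -- there both equal `m(ρ z)`.
  have hc : P (0, H) - Q (0, H) = 0 := by
    obtain ⟨p, h1, h2, h3, h4⟩ := ((ae_mem_interior hh).and ((ae_mem_region hh).and
      ((hsnd hoP).and (hsnd hoQ)))).exists
    have hpI : p.2 ∈ Icc 0 H := ⟨h1.2.1.le, h1.2.2.le⟩
    have hpos : 0 < ρ p.2 := h1.1.1.trans_le h2.2.2
    rw [← hbox p.2 hpI.1 h1.2.2 hpos (ρ p.2, p.2) ⟨⟨hpos.le, le_rfl⟩, ⟨le_rfl, h1.2.2.le⟩⟩,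
      (h3 hpI).eq_boundaryValue hr (continuousOn_slice hP.continuousOn hpI) hpos,
      (h4 hpI).eq_boundaryValue hr (continuousOn_slice hQ.continuousOn hpI) hpos, sub_self]
  filter_upwards [ae_mem_interior hh, ae_mem_region hh] with p h1 h2
  have hpos : 0 < ρ p.2 := h1.1.1.trans_le h2.2.2
  have := hbox p.2 h1.2.1.le h1.2.2 hpos p ⟨⟨h1.1.1.le, h2.2.2⟩, ⟨le_rfl, h1.2.2.le⟩⟩
  linarith

/-- A vanishing duality gap determines the gradient. -/
lemma grad_eq_of_gap_eq_zero {Ψ : ℝ × ℝ → ℝ}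
    (hle : ∀ p ∈ physDomain r₀ H, ∀ q ∈ quadrant, pairing p q ≤ P p + Ψ q) {p q : ℝ × ℝ}
    (hp : p ∈ Ioo 0 (sTop r₀) ×ˢ Ioo 0 H) (hq : q ∈ quadrant) (hd : DifferentiableAt ℝ P p)
    (h0 : gap Ψ P (p, q) = 0) : grad P p = q := by
  refine grad_eq_of_eventually_le hd ?_
  filter_upwards [prod_mem_nhds (Ioo_mem_nhds hp.1.1 hp.1.2) (Ioo_mem_nhds hp.2.1 hp.2.2)]
    with x hx
  have h1 := hle x ⟨Ioo_subset_Ico_self hx.1, Ioo_subset_Icc_self hx.2⟩ q hq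
  simp only [gap] at h0
  linarith

lemma ae_gap_eq_zero {Ψ : ℝ × ℝ → ℝ} {γ : Measure ((ℝ × ℝ) × (ℝ × ℝ))} [IsProbabilityMeasure σ]
    (hr : 0 < r₀) (hσc : IsCompact σ.support) (hσ : σ.support ⊆ quadrant)
    (hU : (Ψ, P) ∈ dualPairs r₀ H) (h : (ρ, γ) ∈ admissible r₀ H σ)
    (h0 : ∫ x, gap Ψ P x ∂γ ≤ 0) : ∀ᵐ x ∂γ, gap Ψ P x = 0 := by
  have hP : ContinuousOn P (physBox r₀ H) := by rw [← closure_physDomain hr]; exact hU.2.1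
  have hnn := ae_gap_nonneg hσ hU h
  exact (integral_eq_zero_iff_of_nonneg_ae hnn (admissible.integrable_gap hσc h (hU.1.mono hσ)
    hP)).1 (le_antisymm h0 (integral_nonneg_of_ae hnn))

/-- The maximizer of the dual problem is unique among the Legendre pairs. -/
lemma IsTransportSolution.eqOn_of_isDualMaximizer [IsProbabilityMeasure σ] (hr : 0 < r₀)
    (hΩ : 0 < Ω) (hH : 0 < H) (hR : 0 ≤ R) (hσc : IsCompact σ.support)
    (hσR : σ.support ⊆ Icc 0 R ×ˢ Icc 0 R) (h : IsTransportSolution r₀ Ω H σ.support σ P ρ)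
    {Ψ' P' : ℝ × ℝ → ℝ} (hmax : IsDualMaximizer r₀ H Ω σ Ψ' P') :
    EqOn Ψ' (conjugate (physBox r₀ H) P) quadrant ∧ EqOn P' P (closure (physDomain r₀ H)) := by
  have hσq := hσR.trans box_subset_quadrant
  have hne : σ.support.Nonempty := Measure.nonempty_support (NeZero.ne σ)
  set Ψ := conjugate (physBox r₀ H) P with hΨ
  have hPc : Continuous P := ((h.hasSubgradientsIn.mono hσR).lipschitzWith hR).continuous
  have hΨc : Continuous Ψ := continuous_conjugate_physBox hr hH hPc.continuousOn
  obtain ⟨⟨hU, hP'lub, hΨ'lub⟩, hmax⟩ := hmax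
  have hΨ'c : ContinuousOn Ψ' σ.support := hU.1.mono hσq
  -- `P'` is controlled only on `closure 𝒟`; `Q` extends it to the plane with subgradients in the
  -- support.
  set Q := conjugate σ.support Ψ' with hQ
  have hQS : HasSubgradientsIn σ.support Q := hasSubgradientsIn_conjugate hσc hne hΨ'c
  have hQc : Continuous Q := ((hQS.mono hσR).lipschitzWith hR).continuous
  have hP'Q : EqOn P' Q (physDomain r₀ H) := fun p hp =>
    (hP'lub p hp).unique (isGreatest_conjugate hσc hne hΨ'c p).isLUB
  have hP'Q2 : EqOn P' Q (closure (physDomain r₀ H)) :=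
    hP'Q.of_subset_closure hU.2.1 hQc.continuousOn subset_closure subset_rfl
  have hUQ : (Ψ', Q) ∈ dualPairs r₀ H := ⟨hU.1, hQc.continuousOn, fun p hp q hq => by
    have := hU.2.2 p hp q hq
    simp only at this ⊢
    rwa [hP'Q hp] at this⟩
  have hρ := h.monotone.measurable
  have hadm := h.mem_admissible
  have hQsel := isOptimalSelection_maxHeight (Ω := Ω) hr hΩ hH (hQc.continuousOn (s := physBox r₀ H))
  have hQm := ((hQS.mono hσR).measurable_maxHeight (Ω := Ω) hr hΩ hH hR).2
  have hQh := hQsel.mem_heights hQm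
  have hQi := hQsel.integrable hr hΩ hH hQc.continuousOn hQm
  obtain ⟨M, -, hM, hρM⟩ := h.isOptimalSelection.exists_le hr hΩ hH hPc.continuousOn
  have hprob : IsProbabilityMeasure (regionMeasure r₀ H ρ) := ⟨h.regionMeasure_univ⟩
  have hh := h.isOptimalSelection.mem_heights hρ
  have hm := integrable_boundaryValue hr hΩ hh hM fun z _ => hρM z
  have hQi2 := admissible.integrable_boundaryValue_sub hadm hQc.continuousOn hm
  have hdual : dual r₀ H Ω σ Ψ' P' ≤
      ((sourceTerm r₀ Ω σ Ψ' + energy r₀ Ω H Q (maxHeight r₀ Ω H Q) : ℝ) : EReal) := by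
    have hae : (fun p => boundaryValue r₀ Ω p.1 - P' p) =ᵐ[regionMeasure r₀ H
        (maxHeight r₀ Ω H Q)] fun p => boundaryValue r₀ Ω p.1 - Q p := by
      filter_upwards [ae_mem_region hQh] with p hp
      rw [hP'Q (region_subset_physDomain hQh hp)]
    have h1 := dualHeight_le (P := P') hQh (hQi.congr hae.symm)
    have h2 : energy r₀ Ω H P' (maxHeight r₀ Ω H Q) = energy r₀ Ω H Q (maxHeight r₀ Ω H Q) :=
      integral_congr_ae hae
    rw [h2] at h1
    rw [EReal.coe_add]
    exact add_le_add_right h1 _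
  obtain ⟨hs1, hs2⟩ := h.primal_eq_dual hr hΩ hH hR hσc hσR
  have hcmp := (hmax _ _ (mem_dualPairs hr hH hPc.continuousOn)).trans hdual
  rw [hs2, ← hs1, admissible.primal_eq hσc hadm hΨ'c hQc.continuousOn hm,
    EReal.coe_le_coe_iff] at hcmp
  -- Maximality, `hle` and `hnn` leave no slack: the gap of `(Ψ', Q)` vanishes along the plan, and
  -- `ρ` has minimal energy for `Q`.
  have hle := hQsel.energy_le hr hΩ hH hQc.continuousOn hQm hh hQi2
  have hnn := integral_nonneg_of_ae (ae_gap_nonneg hσq hUQ hadm)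
  have hgapQ := ae_gap_eq_zero hr hσc hσq hUQ hadm (by linarith)
  have hgapP := ae_gap_eq_zero hr hσc hσq (mem_dualPairs hr hH hPc.continuousOn) hadm
    (h.integral_gap hr hH hR hσR).le
  have hoQ := ae_isOptimalHeight_of_energy_le hr hΩ hH hQc.continuousOn hQsel hQm hh hQi2
    (by linarith)
  have hgapQ' : ∀ᵐ p ∂regionMeasure r₀ H ρ, gap Ψ' Q (p, grad P p) = 0 :=
    ae_of_ae_map (measurable_graph_grad P).aemeasurable hgapQ
  have hgapP' : ∀ᵐ p ∂regionMeasure r₀ H ρ, gap Ψ P (p, grad P p) = 0 :=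
    ae_of_ae_map (measurable_graph_grad P).aemeasurable hgapP
  have hac := regionMeasure_absolutelyContinuous (r₀ := r₀) (H := H) (ρ := ρ)
  have hcommon : ∀ᵐ p ∂regionMeasure r₀ H ρ, HasCommonSubgradient σ.support P Q p := by
    filter_upwards [hgapQ', ae_mem_interior hh,
      hac.ae_le ((h.hasSubgradientsIn.mono hσR).ae_differentiableAt hR),
      hac.ae_le ((hQS.mono hσR).ae_differentiableAt hR)] with p h1 h2 h3 h4
    obtain ⟨h5, h6⟩ := h.hasSubgradientsIn.grad_spec h3
    have h7 := grad_eq_of_gap_eq_zero hUQ.2.2 h2 (hσq h5) h4 h1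
    obtain ⟨-, h8⟩ := hQS.grad_spec h4
    rw [h7] at h8
    exact ⟨_, h5, fun p' => ⟨h6 p', h8 p'⟩⟩
  have hPQ := ae_eq_of_ae_hasCommonSubgradient hr hσc hPc hQc hh h.monotone
    h.regionMeasure_univ hcommon (Eventually.of_forall fun z hz =>
      h.isOptimalSelection.isOptimalHeight hz) hoQ
  -- the potentials `Ψ` and `Ψ'` agree on the support
  have hΨeq : EqOn Ψ' Ψ σ.support := by
    have hcl : IsClosed {q | q ∈ σ.support ∧ Ψ' q - Ψ q = 0} := by
      exact (hΨ'c.sub hΨc.continuousOn).preimage_isClosed_of_isClosed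
        Measure.isClosed_support isClosed_singleton
    intro q hq
    have hqc : q ∈ closure {q | q ∈ σ.support ∧ Ψ' q - Ψ q = 0} := by
      rw [mem_closure_iff_nhds]
      intro U hU
      obtain ⟨V, hVU, hVo, hqV⟩ := mem_nhds_iff.1 hU
      have hpos : 0 < σ V := (Measure.mem_support_iff_forall q).1 hq V (hVo.mem_nhds hqV)
      rw [← h.map_grad, Measure.map_apply (measurable_grad P) hVo.measurableSet] at hpos
      have hfreq : ∃ᵐ p ∂regionMeasure r₀ H ρ, grad P p ∈ V := frequently_ae_iff.2 hpos.ne'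
      obtain ⟨p, hpV, h1, h2, h3, h4⟩ := (hfreq.and_eventually (hgapQ'.and (hgapP'.and (hPQ.and
        (hac.ae_le ((h.hasSubgradientsIn.mono hσR).ae_differentiableAt hR)))))).exists
      refine ⟨grad P p, hVU hpV, (h.hasSubgradientsIn.grad_spec h4).1, ?_⟩
      simp only [gap] at h1 h2
      linarith
    have := (hcl.closure_eq ▸ hqc : q ∈ {q | q ∈ σ.support ∧ Ψ' q - Ψ q = 0}).2
    linarith
  have hQP : EqOn Q P (physBox r₀ H) := by
    intro p hp
    rw [← conjugate_conjugate hr hH hσc hPc.continuousOn h.hasSubgradientsIn hp, hQ, conjugate,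
      conjugate]
    congr 1
    exact image_congr fun q hq => by rw [hΨeq hq]
  have hP'P : EqOn P' P (closure (physDomain r₀ H)) := fun p hp => by
    rw [hP'Q2 hp]
    exact hQP (by rwa [closure_physDomain hr] at hp)
  refine ⟨fun q hq => ?_, hP'P⟩
  have h1 := hΨ'lub q hq
  have h2 := (mem_legendrePairs hr hH hσc hne hPc h.hasSubgradientsIn).2.2 q hq
  simp only at h1 h2
  rw [image_congr fun p hp => by rw [hP'P (subset_closure hp)]] at h1
  exact h1.unique h2

end Uniqueness

/-! ### Uniqueness of the primal minimizer. -/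

section PrimalUniqueness

variable {r₀ Ω H R : ℝ} {σ : Measure (ℝ × ℝ)} {P : ℝ × ℝ → ℝ} {ρ : ℝ → ℝ}

/-- Two selections of minimizers of a family of potentials that is strictly increasing below them
coincide almost everywhere. -/
lemma ae_eq_of_ae_isOptimalHeight (hr : 0 < r₀) (hP : Continuous P) {ρ' : ℝ → ℝ}
    (hρ : ∀ᵐ z, z ∈ Icc 0 H → IsOptimalHeight r₀ Ω (fun s => P (s, z)) (ρ z))
    (hρ' : ∀ᵐ z, z ∈ Icc 0 H → IsOptimalHeight r₀ Ω (fun s => P (s, z)) (ρ' z))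
    (hinc : ∀ᵐ z, z ∈ Icc 0 H → ∀ᵐ s, s ∈ Ioo 0 (max (ρ z) (ρ' z)) →
      ∀ z', z < z' → P (s, z) < P (s, z')) :
    ∀ᵐ z, z ∈ Icc 0 H → ρ z = ρ' z := by
  set A : Set ℝ := {z | z ∈ Icc 0 H ∧ IsOptimalHeight r₀ Ω (fun s => P (s, z)) (ρ z) ∧
    IsOptimalHeight r₀ Ω (fun s => P (s, z)) (ρ' z) ∧ (∀ᵐ s, s ∈ Ioo 0 (max (ρ z) (ρ' z)) →
      ∀ z', z < z' → P (s, z) < P (s, z')) ∧ ρ z ≠ ρ' z} with hA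
  have hslice : ∀ z, ContinuousOn (fun s => P (s, z)) (Icc 0 (sTop r₀)) := fun z =>
    (hP.comp (by fun_prop : Continuous fun s : ℝ => (s, z))).continuousOn
  -- All minimizers at `z` lie below all minimizers at `z' > z`, so the open intervals between `ρ`
  -- and `ρ'` at the exceptional points are disjoint; hence only countably many are nonempty.
  have hord : ∀ z ∈ A, ∀ z' ∈ A, z < z' → max (ρ z) (ρ' z) ≤ min (ρ z') (ρ' z') := by
    rintro z ⟨-, h1, h2, h3, -⟩ z' ⟨-, h1', h2', -, -⟩ hzz'
    have key : ∀ x y, x ≤ max (ρ z) (ρ' z) → IsOptimalHeight r₀ Ω (fun s => P (s, z)) x →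
        IsOptimalHeight r₀ Ω (fun s => P (s, z')) y → x ≤ y := by
      intro x y hx hox hoy
      refine hox.le_of_ae_lt hr (hslice z) (hslice z') ?_ hoy
      filter_upwards [h3] with s hs hsx
      exact hs ⟨hsx.1, hsx.2.trans_le hx⟩ z' hzz'
    exact max_le (le_min (key _ _ (le_max_left _ _) h1 h1') (key _ _ (le_max_left _ _) h1 h2'))
      (le_min (key _ _ (le_max_right _ _) h2 h1') (key _ _ (le_max_right _ _) h2 h2'))
  have hdisj : ∀ z ∈ A, ∀ z' ∈ A, z < z' →
      Disjoint (Ioo (min (ρ z) (ρ' z)) (max (ρ z) (ρ' z)))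
        (Ioo (min (ρ z') (ρ' z')) (max (ρ z') (ρ' z'))) := fun z hz z' hz' hlt =>
    disjoint_left.2 fun x hx hx' => (hx.2.trans_le (hord z hz z' hz' hlt)).not_gt hx'.1
  have hcount : A.Countable := by
    refine PairwiseDisjoint.countable_of_isOpen
      (s := fun z => Ioo (min (ρ z) (ρ' z)) (max (ρ z) (ρ' z))) ?_ (fun _ _ => isOpen_Ioo)
      fun z hz => nonempty_Ioo.2 (min_lt_max.2 hz.2.2.2.2)
    intro z hz z' hz' hne
    rcases lt_or_gt_of_ne hne with h | h
    · exact hdisj z hz z' hz' h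
    · exact (hdisj z' hz' z hz h).symm
  filter_upwards [hcount.ae_notMem volume, hρ, hρ', hinc] with z h1 h2 h3 h4 hz
  by_contra hne
  exact h1 ⟨hz, h2 hz, h3 hz, h4 hz, hne⟩

lemma ae_ae_swap_of_ae {p : ℝ × ℝ → Prop} (h : ∀ᵐ x, p x) : ∀ᵐ z : ℝ, ∀ᵐ s : ℝ, p (s, z) := by
  have h1 : ∀ᵐ x ∂(volume.prod volume : Measure (ℝ × ℝ)), p x.swap :=
    Measure.measurePreserving_swap.quasiMeasurePreserving.ae h
  exact Measure.ae_ae_of_ae_prod h1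

lemma regionMeasure_congr_ae {ρ' : ℝ → ℝ} (h : ∀ᵐ z, z ∈ Icc 0 H → ρ z = ρ' z) :
    regionMeasure r₀ H ρ = regionMeasure r₀ H ρ' := by
  unfold regionMeasure
  congr 1
  refine Measure.restrict_congr_set ?_
  rw [eventuallyEq_set]
  have h' : ∀ᵐ p : ℝ × ℝ, p.2 ∈ Icc 0 H → ρ p.2 = ρ' p.2 :=
    Measure.quasiMeasurePreserving_snd.ae h
  filter_upwards [h'] with p hp
  refine and_congr_right fun h2 => ?_
  rw [hp h2]

/-- A plan with vanishing duality gap is induced by the gradient. -/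
lemma eq_map_grad_of_ae_gap {Ψ : ℝ × ℝ → ℝ} {γ : Measure ((ℝ × ℝ) × (ℝ × ℝ))} (hR : 0 ≤ R)
    (hσ : σ.support ⊆ quadrant) (hU : (Ψ, P) ∈ dualPairs r₀ H)
    (hS : HasSubgradientsIn (Icc 0 R ×ˢ Icc 0 R) P) (h : (ρ, γ) ∈ admissible r₀ H σ)
    (h0 : ∀ᵐ x ∂γ, gap Ψ P x = 0) : γ = gradPlan r₀ H P ρ := by
  have hae : (fun x : (ℝ × ℝ) × (ℝ × ℝ) => (x.1, grad P x.1)) =ᵐ[γ] id := by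
    filter_upwards [h0, admissible.ae_fst h (ae_mem_interior h.1),
      admissible.ae_fst h (regionMeasure_absolutelyContinuous.ae_le (hS.ae_differentiableAt hR)),
      admissible.ae_snd h Measure.support_mem_ae] with x h1 h2 h3 h4
    rw [grad_eq_of_gap_eq_zero hU.2.2 h2 (hσ h4) h3 h1]
    rfl
  have hfst := h.2.2.1
  simp only at hfst
  rw [gradPlan, ← hfst, Measure.map_map (measurable_graph_grad P) measurable_fst]
  calc γ = γ.map id := Measure.map_id.symm
    _ = _ := (Measure.map_congr hae).symm

/-- The minimizer of the primal problem is unique if `σ` does not charge the axis `{Z = 0}`. -/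
lemma IsTransportSolution.eq_of_isPrimalMinimizer [IsProbabilityMeasure σ] (hr : 0 < r₀)
    (hΩ : 0 < Ω) (hH : 0 < H) (hR : 0 ≤ R) (hσc : IsCompact σ.support)
    (hσR : σ.support ⊆ Icc 0 R ×ˢ Icc 0 R) (h : IsTransportSolution r₀ Ω H σ.support σ P ρ)
    (hσ0 : σ {q | q.2 = 0} = 0) {ρ' : ℝ → ℝ} {γ' : Measure ((ℝ × ℝ) × (ℝ × ℝ))}
    (hmin : IsPrimalMinimizer r₀ H Ω σ ρ' γ') :
    ρ' =ᵐ[volume.restrict (Icc 0 H)] ρ ∧ γ' = gradPlan r₀ H P ρ := by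
  have hσq := hσR.trans box_subset_quadrant
  have hS := h.hasSubgradientsIn.mono hσR
  have hPc : Continuous P := (hS.lipschitzWith hR).continuous
  have hadm := hmin.1
  have hle := hmin.2 _ _ h.mem_admissible
  rw [(h.primal_eq_dual hr hΩ hH hR hσc hσR).1] at hle
  have hm : Integrable (fun p : ℝ × ℝ => boundaryValue r₀ Ω p.1) (regionMeasure r₀ H ρ') := by
    by_contra hm
    rw [admissible.primal_eq_top hσc hadm hm, top_le_iff] at hle
    exact EReal.coe_ne_top _ hle
  have hU := mem_dualPairs hr hH (hPc.continuousOn (s := physBox r₀ H))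
  rw [admissible.primal_eq hσc hadm (continuous_conjugate_physBox hr hH
    hPc.continuousOn).continuousOn hPc.continuousOn hm, EReal.coe_le_coe_iff] at hle
  have hi := admissible.integrable_boundaryValue_sub hadm hPc.continuousOn hm
  have hρ := h.monotone.measurable
  have hh := h.isOptimalSelection.mem_heights hρ
  have hen := h.isOptimalSelection.energy_le hr hΩ hH hPc.continuousOn hρ hadm.1 hi
  have hnn := integral_nonneg_of_ae (ae_gap_nonneg hσq hU hadm)
  have hgap := ae_gap_eq_zero hr hσc hσq hU hadm (by linarith)
  have hopt' := ae_isOptimalHeight_of_energy_le hr hΩ hH hPc.continuousOn h.isOptimalSelection hρ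
    hadm.1 hi (by linarith)
  have hγ' := eq_map_grad_of_ae_gap hR hσq hU hS hadm hgap
  have hmap' : (regionMeasure r₀ H ρ').map (grad P) = σ := by
    have hsnd := hadm.2.2.2
    simp only at hsnd
    rw [hγ', gradPlan, Measure.map_map measurable_snd (measurable_graph_grad P)] at hsnd
    exact hsnd
  -- As `σ` does not charge `{Z = 0}`, the second component of `grad P` is positive almost
  -- everywhere on the region. This gives strict growth in `z` without a lower bound `δ`.
  have hpos : ∀ ρ₁, (regionMeasure r₀ H ρ₁).map (grad P) = σ → ρ₁ ∈ heights r₀ H →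
      ∀ᵐ x, x ∈ region H ρ₁ → ∀ z', x.2 < z' → P x < P (x.1, z') := by
    intro ρ₁ hmap hh₁
    refine ae_volume_of_ae_regionMeasure hr hh₁ ?_
    have h1 : ∀ᵐ q ∂(regionMeasure r₀ H ρ₁).map (grad P), q.2 ≠ 0 := by
      rw [hmap]; exact measure_eq_zero_iff_ae_notMem.1 hσ0
    filter_upwards [ae_of_ae_map (measurable_grad P).aemeasurable h1,
      regionMeasure_absolutelyContinuous.ae_le (hS.ae_differentiableAt hR)] with x h2 h3 z' hz'
    obtain ⟨h4, h5⟩ := hS.grad_spec h3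
    have h6 : 0 < (grad P x).2 := lt_of_le_of_ne h4.2.1 (Ne.symm h2)
    have h7 := h5 (x.1, z')
    have h8 : 0 < (z' - x.2) * (grad P x).2 := mul_pos (sub_pos.2 hz') h6
    simp only [pairing] at h7
    linarith
  have heq : ∀ᵐ z, z ∈ Icc 0 H → ρ z = ρ' z := by
    refine ae_eq_of_ae_isOptimalHeight (Ω := Ω) hr hPc (Eventually.of_forall fun z hz =>
      h.isOptimalSelection.isOptimalHeight hz) hopt' ?_
    filter_upwards [ae_ae_swap_of_ae (hpos ρ h.map_grad hh),
      ae_ae_swap_of_ae (hpos ρ' hmap' hadm.1)] with z h1 h2 hz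
    filter_upwards [h1, h2] with s h3 h4 hs z' hz'
    rcases lt_max_iff.1 hs.2 with h5 | h5
    · exact h3 ⟨hz, hs.1.le, h5.le⟩ z' hz'
    · exact h4 ⟨hz, hs.1.le, h5.le⟩ z' hz'
  constructor
  · rw [EventuallyEq, ae_restrict_iff' measurableSet_Icc]
    filter_upwards [heq] with z hz hzI
    exact (hz hzI).symm
  · rw [hγ', gradPlan, gradPlan, regionMeasure_congr_ae heq]

end PrimalUniqueness

/-! ### Weak solutions of the Monge–Ampère system. -/

section WeakSolution

variable {r₀ Ω H R : ℝ} {σ : Measure (ℝ × ℝ)} {P : ℝ × ℝ → ℝ} {ρ : ℝ → ℝ} {Δ : Set (ℝ × ℝ)}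

lemma IsOptimalSelection.freeBoundaryCondition (hr : 0 < r₀) (hP : ContinuousOn P (physBox r₀ H))
    (h : IsOptimalSelection r₀ Ω H P ρ) : FreeBoundaryCondition r₀ H Ω P ρ := fun _ hz hpos =>
  (h.isOptimalHeight hz).eq_boundaryValue hr (continuousOn_slice hP hz) hpos

/-- The gradient of the conjugate potential is the inverse transport map. -/
lemma IsTransportSolution.map_grad_conjugate (hr : 0 < r₀) (hH : 0 < H) (hR : 0 ≤ R)
    (hΔR : Δ ⊆ Icc 0 R ×ˢ Icc 0 R) (h : IsTransportSolution r₀ Ω H Δ σ P ρ) (hσ : σ ≪ volume) :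
    σ.map (grad (conjugate (physBox r₀ H) P)) = regionMeasure r₀ H ρ := by
  have hS := h.hasSubgradientsIn.mono hΔR
  have hPc : ContinuousOn P (physBox r₀ H) := hS.continuousOn hR _
  have hlip := lipschitzWith_conjugate_physBox hr hH hPc
  set Ψ := conjugate (physBox r₀ H) P with hΨ
  have hd : ∀ᵐ q ∂σ, DifferentiableAt ℝ Ψ q := hσ.ae_le hlip.ae_differentiableAt
  rw [← h.map_grad] at hd
  have hh := h.isOptimalSelection.mem_heights h.monotone.measurable
  -- A vanishing gap at `(p, grad P p)` makes `p` a subgradient of `Ψ` at `grad P p`, and `Ψ` is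
  -- differentiable there for almost every `p` because `σ ≪ volume`.
  have hae : grad Ψ ∘ grad P =ᵐ[regionMeasure r₀ H ρ] id := by
    filter_upwards [ae_of_ae_map (measurable_grad P).aemeasurable hd, ae_mem_region hh,
      regionMeasure_absolutelyContinuous.ae_le (hS.ae_differentiableAt hR)] with p h1 h2 h3
    have hp := physDomain_subset_physBox (region_subset_physDomain hh h2)
    have h4 := gap_eq_zero_of_subgradient hr hH hPc hp (hS.grad_spec h3).2
    refine grad_eq_of_eventually_le h1 (Eventually.of_forall fun q' => ?_)
    have h5 := pairing_le_add_conjugate hPc hp q'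
    simp only [gap] at h4
    simp only [id]
    rw [pairing_comm q', pairing_comm (grad P p)]
    linarith
  rw [← h.map_grad, Measure.map_map (measurable_grad Ψ) (measurable_grad P),
    Measure.map_congr hae, Measure.map_id]

end WeakSolution

/-! ### Lipschitz regularity of the free boundary. -/

section FreeBoundary

variable {H L : ℝ} {ρ : ℝ → ℝ}

/-- The generalized inverse `s ↦ sup {z ∈ [0, H] : ρ(z) ≤ s}` of a height function. -/
def inverseHeight (H : ℝ) (ρ : ℝ → ℝ) (s : ℝ) : ℝ := sSup {z | z ∈ Icc 0 H ∧ ρ z ≤ s}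

lemma bddAbove_inverseHeight (s : ℝ) : BddAbove {z | z ∈ Icc 0 H ∧ ρ z ≤ s} :=
  ⟨H, fun _ hz => hz.1.2⟩

lemma inverseHeight_nonempty (hH : 0 < H) {s : ℝ} (hs : ρ 0 ≤ s) :
    {z | z ∈ Icc 0 H ∧ ρ z ≤ s}.Nonempty := ⟨0, ⟨le_rfl, hH.le⟩, hs⟩

lemma inverseHeight_mem (hH : 0 < H) {s : ℝ} (hs : ρ 0 ≤ s) : inverseHeight H ρ s ∈ Icc 0 H :=
  ⟨le_csSup (bddAbove_inverseHeight s) ⟨⟨le_rfl, hH.le⟩, hs⟩,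
    csSup_le (inverseHeight_nonempty hH hs) fun _ hz => hz.1.2⟩

lemma lt_of_inverseHeight_lt {s w : ℝ} (hw : w ∈ Icc 0 H) (h : inverseHeight H ρ s < w) :
    s < ρ w := by
  by_contra! hle
  exact h.not_ge (le_csSup (bddAbove_inverseHeight s) ⟨hw, hle⟩)

lemma le_of_lt_inverseHeight (hH : 0 < H) (hρ : Monotone ρ) {s w : ℝ} (hs : ρ 0 ≤ s)
    (h : w < inverseHeight H ρ s) : ρ w ≤ s := by
  obtain ⟨z, hz, hwz⟩ := exists_lt_of_lt_csSup (inverseHeight_nonempty hH hs) h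
  exact (hρ hwz.le).trans hz.2

lemma inverseHeight_mono (hH : 0 < H) {s s' : ℝ} (hs : ρ 0 ≤ s) (hss' : s ≤ s') :
    inverseHeight H ρ s ≤ inverseHeight H ρ s' :=
  csSup_le_csSup (bddAbove_inverseHeight s') (inverseHeight_nonempty hH hs)
    fun _ hz => ⟨hz.1, hz.2.trans hss'⟩

lemma inverseHeight_sub_le (hH : 0 < H) (hρ : Monotone ρ) (hρ0 : 0 ≤ ρ 0) (hL : 0 ≤ L)
    (hgrow : ∀ w w', 0 ≤ w → w < w' → w' ≤ H → 0 < ρ w → w' - w ≤ L * (ρ w' - ρ w))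
    {s s' : ℝ} (hs : ρ 0 ≤ s) (hss' : s ≤ s') :
    inverseHeight H ρ s' - inverseHeight H ρ s ≤ L * (s' - s) := by
  by_contra! hlt
  have h1 := inverseHeight_mem hH hs
  have h2 := inverseHeight_mem hH (hs.trans hss')
  set a := inverseHeight H ρ s with ha
  set b := inverseHeight H ρ s' with hb
  -- Moving both ends inwards by `ε` gives `ρ (a + ε) > s` and `ρ (b - ε) ≤ s'`. Growth then yields
  -- `b - a - 2 ε ≤ L (s' - s)`, against a total excess of `3 ε`.
  obtain ⟨ε, hε⟩ : ∃ ε, ε = (b - a - L * (s' - s)) / 3 := ⟨_, rfl⟩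
  have hL' : 0 ≤ L * (s' - s) := mul_nonneg hL (by linarith)
  have hε0 : 0 < ε := by rw [hε]; linarith
  have hw : s < ρ (a + ε) := lt_of_inverseHeight_lt
    ⟨by linarith [h1.1], by linarith [h2.2]⟩ (show a < a + ε by linarith)
  have hw' : ρ (b - ε) ≤ s' := le_of_lt_inverseHeight hH hρ (hs.trans hss')
    (show b - ε < b by linarith)
  have h3 := hgrow (a + ε) (b - ε) (by linarith [h1.1]) (by linarith) (by linarith [h2.2])
    (by linarith)
  have h4 : L * (ρ (b - ε) - ρ (a + ε)) ≤ L * (s' - s) :=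
    mul_le_mul_of_nonneg_left (by linarith) hL
  linarith

lemma lipschitzOnWith_inverseHeight (hH : 0 < H) (hρ : Monotone ρ) (hρ0 : 0 ≤ ρ 0) (hL : 0 ≤ L)
    (hgrow : ∀ w w', 0 ≤ w → w < w' → w' ≤ H → 0 < ρ w → w' - w ≤ L * (ρ w' - ρ w)) :
    LipschitzOnWith L.toNNReal (inverseHeight H ρ) (Icc (ρ 0) (ρ H)) := by
  refine LipschitzOnWith.of_le_add_mul _ fun x hx y hy => ?_
  rw [Real.coe_toNNReal _ hL]
  rcases le_total x y with h | h
  · have := inverseHeight_mono hH hx.1 h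
    have h2 : 0 ≤ L * dist x y := mul_nonneg hL dist_nonneg
    linarith
  · have := inverseHeight_sub_le hH hρ hρ0 hL hgrow hy.1 h
    rw [Real.dist_eq, abs_of_nonneg (sub_nonneg.2 h)]
    linarith

lemma mem_closure_of_forall_exists {S : Set (ℝ × ℝ)} {p : ℝ × ℝ}
    (h : ∀ ε, 0 < ε → ∃ x ∈ S, |p.1 - x.1| ≤ ε ∧ |p.2 - x.2| ≤ ε) : p ∈ closure S := by
  rw [Metric.mem_closure_iff]
  intro ε hε
  obtain ⟨x, hx, h1, h2⟩ := h (ε / 2) (by linarith)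
  refine ⟨x, hx, ?_⟩
  rw [Prod.dist_eq, Real.dist_eq, Real.dist_eq]
  exact max_lt (by linarith) (by linarith)

/-- Points just above the graph of the inverse belong to the region; points just below it, moved
slightly to the right, do not. At the ends of `[0, H]` the point itself, or one with negative `z`,
is used. -/
lemma mem_frontier_of_inverseHeight (hH : 0 < H) (hρ : Monotone ρ) (hρ0 : 0 ≤ ρ 0) {s : ℝ}
    (hs : s ∈ Icc (ρ 0) (ρ H)) : (s, inverseHeight H ρ s) ∈ frontier (region H ρ) := by
  have hs0 := hρ0.trans hs.1
  have hmem := inverseHeight_mem hH hs.1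
  rw [frontier_eq_closure_inter_closure]
  constructor
  · refine mem_closure_of_forall_exists fun ε hε => ?_
    rcases hmem.2.lt_or_eq with h | h
    · set w := min (inverseHeight H ρ s + ε) H with hw
      have h1 : inverseHeight H ρ s < w := lt_min (by linarith) h
      have hwI : w ∈ Icc 0 H := ⟨hmem.1.trans h1.le, min_le_right _ _⟩
      refine ⟨(s, w), ⟨hwI, hs0, (lt_of_inverseHeight_lt hwI h1).le⟩, by simpa using hε.le, ?_⟩
      simp only
      rw [abs_le]
      constructor <;> linarith [min_le_left (inverseHeight H ρ s + ε) H]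
    · refine ⟨(s, H), ⟨⟨hH.le, le_rfl⟩, hs0, hs.2⟩, by simpa using hε.le, ?_⟩
      simp only [h, sub_self, abs_zero]
      exact hε.le
  · refine mem_closure_of_forall_exists fun ε hε => ?_
    rcases hmem.1.lt_or_eq with h | h
    · set w := max (inverseHeight H ρ s - ε) 0 with hw
      have h1 : w < inverseHeight H ρ s := max_lt (by linarith) h
      have h2 := le_of_lt_inverseHeight hH hρ hs.1 h1
      refine ⟨(s + ε, w), fun hx => ?_, by simp [abs_of_pos hε], ?_⟩
      · have h3 : s + ε ≤ ρ w := hx.2.2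
        linarith
      · simp only
        rw [abs_le]
        constructor <;> linarith [le_max_left (inverseHeight H ρ s - ε) 0]
    · refine ⟨(s, -ε), fun hx => ?_, by simpa using hε.le, ?_⟩
      · have h3 : (0 : ℝ) ≤ -ε := hx.1.1
        linarith
      · simp only [← h]
        rw [zero_sub, neg_neg, abs_of_pos hε]

lemma frontier_region_subset (hH : 0 < H) (hρ : Monotone ρ) (hρ0 : 0 ≤ ρ 0) (hL : 0 ≤ L)
    (hgrow : ∀ w w', 0 ≤ w → w < w' → w' ≤ H → 0 < ρ w → w' - w ≤ L * (ρ w' - ρ w))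
    {s z : ℝ} (hx : (s, z) ∈ frontier (region H ρ)) :
    (s = 0 ∧ z ∈ Icc 0 H) ∨ (z = H ∧ s ∈ Icc 0 (ρ H)) ∨ (z = 0 ∧ s ∈ Icc 0 (ρ 0)) ∨
      (z = inverseHeight H ρ s ∧ s ∈ Icc (ρ 0) (ρ H)) := by
  have hbox : (s, z) ∈ Icc 0 (ρ H) ×ˢ Icc 0 H := by
    refine closure_minimal ?_ (isClosed_Icc.prod isClosed_Icc) hx.1
    exact fun p hp => ⟨⟨hp.2.1, hp.2.2.trans (hρ hp.1.2)⟩, hp.1⟩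
  obtain ⟨⟨hs0, hsH⟩, hz0, hzH⟩ := hbox
  have hnotint : ∀ U : Set (ℝ × ℝ), IsOpen U → (s, z) ∈ U → U ⊆ region H ρ → False :=
    fun U hU hxU hUS => hx.2 (mem_interior.2 ⟨U, hUS, hU, hxU⟩)
  rcases hs0.eq_or_lt' with h0 | hs0
  · exact Or.inl ⟨h0, hz0, hzH⟩
  rcases hzH.eq_or_lt with h0 | hzH
  · exact Or.inr (Or.inl ⟨h0, hs0.le, hsH⟩)
  rcases lt_or_ge s (ρ 0) with hsρ | hsρ
  · rcases hz0.eq_or_lt' with h0 | hz0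
    · exact Or.inr (Or.inr (Or.inl ⟨h0, hs0.le, hsρ.le⟩))
    · refine (hnotint (Ioo 0 (ρ 0) ×ˢ Ioo 0 H) (isOpen_Ioo.prod isOpen_Ioo)
        ⟨⟨hs0, hsρ⟩, hz0, hzH⟩ fun p hp => ?_).elim
      exact ⟨⟨hp.2.1.le, hp.2.2.le⟩, hp.1.1.le, hp.1.2.le.trans (hρ hp.2.1.le)⟩
  have hLip := fun {s s' : ℝ} => inverseHeight_sub_le (s := s) (s' := s') hH hρ hρ0 hL hgrow
  have hL1 : 0 < L + 1 := by linarith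
  rcases lt_trichotomy z (inverseHeight H ρ s) with hz | hz | hz
  · exfalso
    -- If `s = ρ 0`, then `ρ` would stay equal to `ρ 0 > 0` up to some `w > 0`, contradicting
    -- growth.
    rcases hsρ.eq_or_lt with h0 | hsρ
    · obtain ⟨w, hw1, hw2⟩ := exists_between hz
      have hw := le_of_lt_inverseHeight hH hρ h0.le hw2
      have h1 := hgrow 0 w le_rfl (hz0.trans_lt hw1)
        (hw2.le.trans (inverseHeight_mem hH h0.le).2) (h0 ▸ hs0)
      have h2 : L * (ρ w - ρ 0) ≤ 0 := mul_nonpos_of_nonneg_of_nonpos hL (by linarith)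
      linarith
    · set η := min (s - ρ 0) ((inverseHeight H ρ s - z) / (L + 1)) with hη
      have hη0 : 0 < η := lt_min (by linarith) (div_pos (by linarith) hL1)
      have hη1 : ρ 0 ≤ s - η := by
        have hm : η ≤ s - ρ 0 := min_le_left _ _
        linarith
      have hη2 : η * (L + 1) ≤ inverseHeight H ρ s - z :=
        (le_div_iff₀ hL1).1 (min_le_right _ _)
      have h1 := hLip hη1 (by linarith : s - η ≤ s)
      have h2 : z < inverseHeight H ρ (s - η) := by nlinarith
      obtain ⟨p, hpU, hpS⟩ := mem_closure_iff.1 hx.1 (Ioi (s - η) ×ˢ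
        Iio (inverseHeight H ρ (s - η))) (isOpen_Ioi.prod isOpen_Iio)
        ⟨by simpa using hη0, h2⟩
      have h3 := le_of_lt_inverseHeight hH hρ hη1 hpU.2
      have h4 : s - η < p.1 := hpU.1
      linarith [hpS.2.2]
  · exact Or.inr (Or.inr (Or.inr ⟨hz, hsρ, hsH⟩))
  · exfalso
    -- Symmetrically, the inverse at `s + η` stays below `z`, so an open box around the point lies
    -- in the region.
    obtain ⟨η, hη⟩ : ∃ η, η = (z - inverseHeight H ρ s) / (L + 1) := ⟨_, rfl⟩
    have hη0 : 0 < η := by rw [hη]; exact div_pos (by linarith) hL1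
    have hη2 : η * (L + 1) = z - inverseHeight H ρ s := by rw [hη]; field_simp
    have h1 := hLip hsρ (by linarith : s ≤ s + η)
    have h2 : inverseHeight H ρ (s + η) < z := by nlinarith
    have h3 := inverseHeight_mem hH (by linarith : ρ 0 ≤ s + η)
    refine hnotint (Ioo 0 (s + η) ×ˢ Ioo (inverseHeight H ρ (s + η)) H)
      (isOpen_Ioo.prod isOpen_Ioo) ⟨⟨hs0, by linarith⟩, h2, hzH⟩ fun p hp => ?_
    have hpI : p.2 ∈ Icc 0 H := ⟨h3.1.trans hp.2.1.le, hp.2.2.le⟩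
    exact ⟨hpI, hp.1.1.le, hp.1.2.le.trans (lt_of_inverseHeight_lt hpI hp.2.1).le⟩

/-- Regularity of the boundary of a region with a strictly increasing height function. -/
lemma isFiniteUnionOfLipschitzGraphs_frontier (hH : 0 < H) (hρ : Monotone ρ) (hρ0 : 0 ≤ ρ 0)
    (hL : 0 ≤ L)
    (hgrow : ∀ w w', 0 ≤ w → w < w' → w' ≤ H → 0 < ρ w → w' - w ≤ L * (ρ w' - ρ w)) :
    IsFiniteUnionOfLipschitzGraphs (frontier (region H ρ)) := by
  have h0H : ρ 0 ≤ ρ H := hρ hH.le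
  have hconst : ∀ c a b : ℝ, LipschitzOnWith 0 (fun _ : ℝ => c) (Icc a b) := fun c a b =>
    (LipschitzWith.const c).lipschitzOnWith
  refine ⟨{(fun t => ((0 : ℝ), t)) '' Icc 0 H, (fun t => (t, H)) '' Icc 0 (ρ H),
    (fun t => (t, (0 : ℝ))) '' Icc 0 (ρ 0),
    (fun t => (t, inverseHeight H ρ t)) '' Icc (ρ 0) (ρ H)}, by simp, ?_, ?_⟩
  · rintro G (rfl | rfl | rfl | rfl)
    · exact ⟨0, H, fun _ => 0, 0, hH.le, hconst _ _ _, Or.inr rfl⟩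
    · exact ⟨0, ρ H, fun _ => H, 0, hρ0.trans h0H, hconst _ _ _, Or.inl rfl⟩
    · exact ⟨0, ρ 0, fun _ => 0, 0, hρ0, hconst _ _ _, Or.inl rfl⟩
    · exact ⟨ρ 0, ρ H, _, _, h0H, lipschitzOnWith_inverseHeight hH hρ hρ0 hL hgrow, Or.inl rfl⟩
  · simp only [sUnion_insert, sUnion_singleton]
    apply Subset.antisymm
    · rintro ⟨s, z⟩ hx
      rcases frontier_region_subset hH hρ hρ0 hL hgrow hx with h | h | h | h
      · exact Or.inl ⟨z, h.2, by rw [h.1]⟩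
      · exact Or.inr (Or.inl ⟨s, h.2, by rw [h.1]⟩)
      · exact Or.inr (Or.inr (Or.inl ⟨s, h.2, by rw [h.1]⟩))
      · exact Or.inr (Or.inr (Or.inr ⟨s, h.2, by rw [h.1]⟩))
    · rintro p (⟨t, ht, rfl⟩ | ⟨t, ht, rfl⟩ | ⟨t, ht, rfl⟩ | ⟨t, ht, rfl⟩)
      · rw [frontier_eq_closure_inter_closure]
        refine ⟨subset_closure ⟨ht, le_rfl, hρ0.trans (hρ ht.1)⟩,
          mem_closure_of_forall_exists fun ε hε => ⟨(-ε, t), fun hx => ?_, ?_, ?_⟩⟩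
        · have : (0 : ℝ) ≤ -ε := hx.2.1
          linarith
        · simp [abs_of_pos hε]
        · simpa using hε.le
      · rw [frontier_eq_closure_inter_closure]
        refine ⟨subset_closure ⟨⟨hH.le, le_rfl⟩, ht.1, ht.2⟩,
          mem_closure_of_forall_exists fun ε hε => ⟨(t, H + ε), fun hx => ?_, ?_, ?_⟩⟩
        · have : H + ε ≤ H := hx.1.2
          linarith
        · simpa using hε.le
        · simp [abs_of_pos hε]
      · rw [frontier_eq_closure_inter_closure]
        refine ⟨subset_closure ⟨⟨le_rfl, hH.le⟩, ht.1, ht.2⟩,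
          mem_closure_of_forall_exists fun ε hε => ⟨(t, -ε), fun hx => ?_, ?_, ?_⟩⟩
        · have : (0 : ℝ) ≤ -ε := hx.1.1
          linarith
        · simpa using hε.le
        · simp [abs_of_pos hε]
      · exact mem_frontier_of_inverseHeight hH hρ hρ0 ht

/-- With `m` Lipschitz of constant `K` on `[0, M]`: `δ (w' - w) ≤ P(ρ w, w') - P(ρ w, w) ≤ P(ρ w',
w') - P(ρ w, w) = m(ρ w') - m(ρ w) ≤ K (ρ w' - ρ w)`. -/
lemma IsTransportSolution.exists_growth {r₀ Ω R δ : ℝ} {Δ : Set (ℝ × ℝ)} {σ : Measure (ℝ × ℝ)}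
    {P : ℝ × ℝ → ℝ} (hr : 0 < r₀) (hΩ : 0 < Ω) (hH : 0 < H) (hR : 0 ≤ R)
    (hΔR : Δ ⊆ Icc 0 R ×ˢ Icc 0 R) (hδ : 0 < δ) (hΔδ : ∀ q ∈ Δ, δ ≤ q.2)
    (h : IsTransportSolution r₀ Ω H Δ σ P ρ) :
    ∃ L, 0 ≤ L ∧ ∀ w w', 0 ≤ w → w < w' → w' ≤ H → 0 < ρ w → w' - w ≤ L * (ρ w' - ρ w) := by
  have hS := h.hasSubgradientsIn.mono hΔR
  have hP := hS.continuousOn hR (physBox r₀ H)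
  obtain ⟨M, -, hM, hρM⟩ := h.isOptimalSelection.exists_le hr hΩ hH hP
  obtain ⟨K, hK, hKm⟩ := exists_boundaryValue_lipschitz (Ω := Ω) hr hM
  refine ⟨K / δ, by positivity, fun w w' hw hww' hw' hpos => ?_⟩
  have hfb := h.isOptimalSelection.freeBoundaryCondition hr hP
  have hle : ρ w ≤ ρ w' := h.monotone hww'.le
  have h1 := hfb w ⟨hw, hww'.le.trans hw'⟩ hpos
  have h2 := hfb w' ⟨hw.trans hww'.le, hw'⟩ (hpos.trans_le hle)
  have h3 := hKm (ρ w) (ρ w') hpos.le hle (hρM w')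
  have h4 := h.hasSubgradientsIn.add_le hΔδ (s := ρ w) hww'.le
  have h5 := hS.mono_of_le (p := (ρ w, w')) (p' := (ρ w', w')) hle le_rfl
  rw [div_mul_eq_mul_div, le_div_iff₀ hδ]
  linarith

end FreeBoundary

end MongeAmpere

end

theorem mainTheorem1 (r₀ R₀ H Ω : ℝ) (hr₀ : 0 < r₀) (hR₀ : 0 < R₀) (hH : 0 < H) (hΩ : 0 < Ω)
    (σ : Measure (ℝ × ℝ)) [IsProbabilityMeasure σ] (hσ : σ.support ⊆ Icc 0 R₀ ×ˢ Icc 0 R₀) :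
    ∃ (Ψ P : ℝ × ℝ → ℝ) (ρ : ℝ → ℝ) (γ : Measure ((ℝ × ℝ) × (ℝ × ℝ))),
      -- the unique maximizer of the dual problem among the Legendre pairs
      MongeAmpere.IsDualMaximizer r₀ H Ω σ Ψ P ∧
      (∀ Ψ' P' : ℝ × ℝ → ℝ, MongeAmpere.IsDualMaximizer r₀ H Ω σ Ψ' P' →
        EqOn Ψ' Ψ MongeAmpere.quadrant ∧ EqOn P' P (closure (MongeAmpere.physDomain r₀ H))) ∧
      -- the minimizer of the primal problem, unique if `σ` does not charge `{Z = 0}`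
      MongeAmpere.IsPrimalMinimizer r₀ H Ω σ ρ γ ∧
      (σ {q | q.2 = 0} = 0 →
        ∀ (ρ' : ℝ → ℝ) (γ' : Measure ((ℝ × ℝ) × (ℝ × ℝ))),
          MongeAmpere.IsPrimalMinimizer r₀ H Ω σ ρ' γ' →
            ρ' =ᵐ[volume.restrict (Icc 0 H)] ρ ∧ γ' = γ) ∧
      MonotoneOn ρ (Icc 0 H) ∧
      (∃ M : ℝ, M < 1 / (2 * r₀ ^ 2) ∧ ∀ z ∈ Icc 0 H, ρ z ≤ M) ∧
      -- `(Ψ, P, ρ)` solves the Monge-Ampère system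
      MongeAmpere.IsDualWeakSolution r₀ H Ω σ P ρ ∧
      (σ ≪ volume → MongeAmpere.IsWeakSolution r₀ H Ω σ Ψ P ρ) ∧
      -- regularity of the free boundary
      (σ.support ⊆ Icc 0 R₀ ×ˢ Icc (1 / R₀) R₀ →
        MongeAmpere.IsFiniteUnionOfLipschitzGraphs (frontier (MongeAmpere.region H ρ))) := by
  open MongeAmpere in
  have hσc : IsCompact σ.support :=
    (isCompact_box R₀).of_isClosed_subset Measure.isClosed_support hσ
  obtain ⟨P, ρ, h⟩ := exists_isTransportSolution hr₀ hΩ hH hR₀.le hσc hσ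
    (Measure.support_mem_ae (μ := σ))
  have hP := (h.hasSubgradientsIn.mono hσ).continuousOn hR₀.le (physBox r₀ H)
  have hfb := h.isOptimalSelection.freeBoundaryCondition hr₀ hP
  obtain ⟨M, -, hM, hρM⟩ := h.isOptimalSelection.exists_le hr₀ hΩ hH hP
  refine ⟨conjugate (physBox r₀ H) P, P, ρ, gradPlan r₀ H P ρ,
    h.isDualMaximizer hr₀ hΩ hH hR₀.le hσc hσ,
    fun Ψ' P' h' => h.eqOn_of_isDualMaximizer hr₀ hΩ hH hR₀.le hσc hσ h',
    h.isPrimalMinimizer hr₀ hΩ hH hR₀.le hσc hσ,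
    fun h0 ρ' γ' h' => h.eq_of_isPrimalMinimizer hr₀ hΩ hH hR₀.le hσc hσ h0 h',
    h.monotone.monotoneOn _, ⟨M, hM, fun z _ => hρM z⟩, ⟨h.map_grad, hfb⟩,
    fun hac => ⟨h.map_grad_conjugate hr₀ hH hR₀.le hσ hac, hfb⟩, fun hσ' => ?_⟩
  obtain ⟨L, hL, hgrow⟩ := h.exists_growth hr₀ hΩ hH hR₀.le hσ (by positivity : 0 < 1 / R₀)
    fun q hq => (hσ' hq).2.1
  exact isFiniteUnionOfLipschitzGraphs_frontier hH h.monotone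
    (h.isOptimalSelection 0).1.1 hL hgrow
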